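/- Let $\mathbb{T}^2=\mathbb{R}^2/2\pi\mathbb{Z}^2$ and $x_0\in\mathbb{T}^2$; let $L^2(\mathbb{T}^2)$ be taken with respect to $dx/4\pi^2$. For $n\ge 0$ let $r_2(n)=\#\{\xi\in\mathbb{Z}^2:|\xi|^2=n\}$, $\mathcal N_2=\{n: r_2(n)>0\}$ and $c_0=\sum_n r_2(n)/(n^2+1)$. For $\varphi\in(-\pi,\pi)$ let $H_\varphi$ be the self-adjoint extension of $-\Delta$ on $C_c^\infty(\mathbb{T}^2\setminus\{x_0\})$ whose domain consists of the functions $f_0+a(G_{i}+e^{i\varphi}G_{-i})$ with $a\in\mathbb{C}$, $f_0\in H^2(\mathbb{T}^2)$, $f_0(x_0)=0$, where $G_z=(\Delta+z)^{-1}\delta_{x_0}$, and $H_\varphi(f_0+a(G_i+e^{i\varphi}G_{-i}))=-\Delta f_0+a(iG_i-ie^{i\varphi}G_{-i})$. The set $\Lambda$ of new eigenvalues of the point scatterer is, in the weak coupling limit with parameter $\varphi\in(-\pi,\pi)$, $\Lambda=\mathrm{Spec}(H_\varphi)\setminus\mathcal N_2$. In the strong coupling limit with parameters $\varphi\in(-\pi,\pi)$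 and $\eta\in(131/146,1)$, it is the set of $\lambda>0$, $\lambda\notin\mathcal N_2$, with $$\sum_{n\in\mathcal N_2,\ |n-n_+(\lambda)|<n_+(\lambda)^\eta} r_2(n)\Big(\frac1{n-\lambda}-\frac n{n^2+1}\Big)=c_0\tan(\varphi/2),$$ where $n_+(\lambda)$ is the smallest element of $\mathcal N_2$ larger than $\lambda$. For $\lambda\in\Lambda$ let $g_\lambda$ denote an $L^2$-normalized eigenfunction with eigenvalue $\lambda$ of $H_{\varphi_\lambda}$, where $\varphi_\lambda=\varphi$ for weak coupling, and for strong coupling $\varphi_\lambda\in(-\pi,\pi)$ is given by $c_0\tan(\varphi_\lambda/2)=c_0\tan(\varphi/2)+\sum_{n\in\mathcal N_2,\ |n-n_+(\lambda)|\ge n_+(\lambda)^\eta} r_2(n)\big(\frac1{n-\lambda}-\frac n{n^2+1}\big)$. For $a\in C^\infty(S^*\mathbb{T}^2)$, $S^*\mathbb{T}^2=\mathbb{T}^2\times\mathbb{S}^1$, let $\mathrm{Op}(a)$ be the bounded operator on $L^2(\mathbb{T}^2)$ with $(\mathrm{Op}(a)f)(x)=\sum_{v\in\mathbb{Z}^2}a(x,v/|v|)\hat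 f(v)e^{iv\cdot x}$ (with $(1,0)$ in place of $v/|v|$ for $v=0$). Then, for the weak and for the strong coupling limit, with any choice of these parameters, and for every $\varepsilon>0$, there is an infinite subset $\Lambda'\subset\Lambda$, with finitely many elements below any bound, along which a quantum limit exists: there is a probability measure $\mu$ on $S^*\mathbb{T}^2$ such that eigenfunctions $g_\lambda$ exist for all $\lambda\in\Lambda'$ and, for any choice of them, $\langle \mathrm{Op}(a)g_\lambda,g_\lambda\rangle\to\int a\,d\mu$ as $\lambda\to\infty$ in $\Lambda'$ for all $a\in C^\infty(S^*\mathbb{T}^2)$. Moreover: 1. (Momentum scarring.) There is a finite nonempty set of points of $\mathbb{S}^1$, each of positive mass for the pushforward of $\mu$ to $\mathbb{S}^1$, and of total mass at least $1/2-\varepsilon$. 2. (Position scarring, along the same $\Lambda'$.) The pushforward of $\mu$ to $\mathbb{T}^2$ has a nonzero Fourier coefficient at some nonzero frequency $w\in\mathbb{Z}^2$. -/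

import Mathlib

open MeasureTheory Filter Topology
open scoped ContDiff

noncomputable section

namespace PointScatterer

instance factTwoPiPos : Fact (0 < 2 * Real.pi) := ⟨Real.two_pi_pos⟩

/-! ### The torus, its Fourier characters and `L²` -/

/-- The torus `𝕋² = ℝ² / 2πℤ²`. -/
abbrev Torus : Type := Fin 2 → AddCircle (2 * Real.pi)

/-- The uniform probability measure `dx / 4π²` on `𝕋²`. -/
def haarTorus : Measure Torus := Measure.pi fun _ => AddCircle.haarAddCircle

instance : IsProbabilityMeasure haarTorus := by
  unfold haarTorus; infer_instance

/-- `L²(𝕋², dx / 4π²)`. -/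
abbrev L2 : Type := Lp ℂ 2 haarTorus

/-- The character `x ↦ e^{i v·x}`, for `v ∈ ℤ²`. -/
def char (v : Fin 2 → ℤ) : C(Torus, ℂ) where
  toFun x := ∏ i, fourier (v i) (x i)
  continuous_toFun := by fun_prop

/-- A continuous function on `𝕋²` as an element of `L²`. -/
def toL2 (f : C(Torus, ℂ)) : L2 := ContinuousMap.toLp 2 haarTorus ℂ f

/-- The Fourier coefficient `f̂(v) = (4π²)⁻¹ ∫ f(x) e^{-i v·x} dx`. -/
def coef (f : L2) (v : Fin 2 → ℤ) : ℂ := inner ℂ (toL2 (char v)) f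

/-- `|v|²` for `v ∈ ℤ²`. -/
def normSq (v : Fin 2 → ℤ) : ℤ := v 0 ^ 2 + v 1 ^ 2

/-! ### The self-adjoint extensions `H_φ` -/

/-- The Green's function `G_z = (Δ + z)⁻¹ δ_{x₀}`, as an `L²` function given by its Fourier
series; `z` is not an eigenvalue of `-Δ`. -/
def green (x₀ : Torus) (z : ℂ) : L2 :=
  ∑' v : Fin 2 → ℤ,
    (-(1 / (4 * (Real.pi : ℂ) ^ 2)) * (starRingEnd ℂ (char v x₀) / ((normSq v : ℂ) - z))) •
      toL2 (char v)

/-- `f` lies in the Sobolev space `H²(𝕋²)` and `h = -Δ f`. -/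
def IsNegLaplacian (f h : L2) : Prop :=
  ∀ v, coef h v = (normSq v : ℂ) * coef f v

/-- `f` (in `H²(𝕋²)`, so that its Fourier series converges absolutely) vanishes at `x₀`. -/
def VanishesAt (x₀ : Torus) (f : L2) : Prop :=
  HasSum (fun v => coef f v * char v x₀) 0

/-- The graph of the self-adjoint extension `H_φ` of `-Δ` on `C_c^∞(𝕋² ∖ {x₀})`. The closure of
that operator is `-Δ` on `{f ∈ H² : f(x₀) = 0}`; its deficiency spaces (the kernels of its adjoint
minus `± i`) are spanned by `G_i` and `G_{-i}`; and, following von Neumann, the domain of `H_φ` is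
the domain of the closure plus the span of `G_i + e^{iφ} G_{-i}`, with
`H_φ (f₀ + a (G_i + e^{iφ} G_{-i})) = -Δ f₀ + a (i G_i - i e^{iφ} G_{-i})`. -/
def scattererGraph (x₀ : Torus) (φ : ℝ) : Submodule ℂ (L2 × L2) where
  carrier := {p | ∃ (f₀ h₀ : L2) (a : ℂ), IsNegLaplacian f₀ h₀ ∧ VanishesAt x₀ f₀ ∧
    p.1 = f₀ + a • (green x₀ Complex.I + Complex.exp (φ * Complex.I) • green x₀ (-Complex.I)) ∧
    p.2 = h₀ + a • (Complex.I • green x₀ Complex.I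
      - (Complex.I * Complex.exp (φ * Complex.I)) • green x₀ (-Complex.I))}
  zero_mem' := by
    refine ⟨0, 0, 0, fun v => ?_, ?_, ?_, ?_⟩ <;> simp [coef, VanishesAt, hasSum_zero]
  add_mem' := by
    rintro p q ⟨f, h, a, hL, hV, h1, h2⟩ ⟨f', h', a', hL', hV', h1', h2'⟩
    refine ⟨f + f', h + h', a + a', fun v => ?_, ?_, ?_, ?_⟩
    · have e := hL v
      have e' := hL' v
      simp only [coef, inner_add_right] at *
      rw [e, e']; ring
    · have := HasSum.add hV hV'
      simpa [VanishesAt, coef, inner_add_right, add_mul] using this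
    · simp only [Prod.fst_add, h1, h1', add_smul]; abel
    · simp only [Prod.snd_add, h2, h2', add_smul]; abel
  smul_mem' := by
    rintro c p ⟨f, h, a, hL, hV, h1, h2⟩
    refine ⟨c • f, c • h, c * a, fun v => ?_, ?_, ?_, ?_⟩
    · have e := hL v
      simp only [coef, inner_smul_right] at *
      rw [e]; ring
    · have := HasSum.mul_left c hV
      simpa [VanishesAt, coef, inner_smul_right, mul_assoc] using this
    · simp only [Prod.smul_fst, h1, smul_add, mul_smul]
    · simp only [Prod.smul_snd, h2, smul_add, mul_smul]

/-- The point scatterer `H_φ` at `x₀`, an unbounded operator on `L²(𝕋²)`. -/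
def scatterer (x₀ : Torus) (φ : ℝ) : L2 →ₗ.[ℂ] L2 := (scattererGraph x₀ φ).toLinearPMap

/-- The spectrum of an unbounded operator: the complement of the set of those `z` for which
`H - z` maps the domain of `H` bijectively onto the space, with bounded inverse. -/
def spec (H : L2 →ₗ.[ℂ] L2) : Set ℂ :=
  {z | ∃ R : L2 →L[ℂ] L2,
    (∀ h, ∃ hR : R h ∈ H.domain, H ⟨R h, hR⟩ - z • R h = h) ∧
    ∀ f : H.domain, R (H f - z • (f : L2)) = f}ᶜ

/-! ### Weak and strong coupling, new eigenvalues and eigenfunctions -/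

/-- `r₂(n)`, the number of `ξ ∈ ℤ²` with `|ξ|² = n`. -/
def r2 (n : ℕ) : ℕ := {v : Fin 2 → ℤ | normSq v = n}.ncard

/-- `𝒩₂`, the set of sums of two squares. -/
def N2 : Set ℕ := {n | 0 < r2 n}

/-- The summand of the spectral equation. -/
def specTerm (l : ℝ) (n : ℕ) : ℝ := r2 n * (1 / (n - l) - n / ((n : ℝ) ^ 2 + 1))

/-- `c₀ = ∑ₙ r₂(n) / (n² + 1)`. -/
def c0 : ℝ := ∑' n : ℕ, r2 n / ((n : ℝ) ^ 2 + 1)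

/-- `n₊(λ)`, the smallest element of `𝒩₂` that is larger than `λ`. -/
def nPlus (l : ℝ) : ℕ := sInf {n : ℕ | n ∈ N2 ∧ l < n}

/-- The energy window around `n₊(λ)`. -/
def window (η l : ℝ) : Set ℕ :=
  {n | n ∈ N2 ∧ |(n : ℝ) - nPlus l| < (nPlus l : ℝ) ^ η}

/-- The two couplings, with their parameters: the angle `φ` of the self-adjoint extension in the
weak coupling limit; the constant angle `φ` and the exponent `η` of the energy window in the
strong coupling limit. -/
inductive Coupling : Type where
  | weak (φ : ℝ) : Coupling
  | strong (φ η : ℝ) : Coupling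

/-- The admissible parameters. (`φ = π` is the unperturbed Laplacian.) -/
def Coupling.Admissible : Coupling → Prop
  | .weak φ => φ ∈ Set.Ioo (-Real.pi) Real.pi
  | .strong φ η => φ ∈ Set.Ioo (-Real.pi) Real.pi ∧ η ∈ Set.Ioo (131 / 146 : ℝ) 1

/-- The angle of the self-adjoint extension that acts at energy `λ`. It is constant for weak
coupling. For strong coupling it is the `φ_λ ∈ (-π, π)` with
`c₀ tan (φ_λ / 2) = c₀ tan (φ / 2) + ∑_{n ∈ 𝒩₂ outside the window} r₂(n) (1/(n-λ) - n/(n²+1))`. -/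
def Coupling.angle : Coupling → ℝ → ℝ
  | .weak φ, _ => φ
  | .strong φ η, l =>
      2 * Real.arctan (Real.tan (φ / 2) + (∑' n : ↥(N2 \ window η l), specTerm l n) / c0)

/-- The set `Λ` of new eigenvalues: `Spec(H_φ) ∖ 𝒩₂` for weak coupling, and the (positive)
solutions of the truncated spectral equation for strong coupling. -/
def newEigenvalues (x₀ : Torus) : Coupling → Set ℝ
  | .weak φ => {l : ℝ | (l : ℂ) ∈ spec (scatterer x₀ φ) ∧ ∀ n ∈ N2, l ≠ n}
  | .strong φ η => {l : ℝ | 0 < l ∧ (∀ n ∈ N2, l ≠ n) ∧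
      ∑' n : ↥(window η l), specTerm l n = c0 * Real.tan (φ / 2)}

/-- `g` is an `L²`-normalized eigenfunction with eigenvalue `λ` of the point scatterer. -/
def IsEigenfunction (x₀ : Torus) (cpl : Coupling) (l : ℝ) (g : L2) : Prop :=
  ‖g‖ = 1 ∧ ∃ hg : g ∈ (scatterer x₀ (cpl.angle l)).domain,
    scatterer x₀ (cpl.angle l) ⟨g, hg⟩ = (l : ℂ) • g

/-! ### Quantization of observables and quantum limits -/

/-- The direction `v / |v|` on the unit circle (and `1` for `v = 0`). -/
def dir (v : Fin 2 → ℤ) : Circle :=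
  Circle.exp (Complex.arg ((v 0 : ℂ) + (v 1 : ℂ) * Complex.I))

/-- The phase space `S*𝕋² = 𝕋² × S¹`. -/
abbrev PhaseSpace : Type := Torus × Circle

instance : MeasurableSpace Circle := borel Circle
instance : BorelSpace Circle := ⟨rfl⟩

/-- `a ∈ C^∞(S*𝕋²)`, expressed through the covering `ℝ² × ℝ → 𝕋² × S¹`. -/
def IsSmooth (a : C(PhaseSpace, ℂ)) : Prop :=
  ContDiff ℝ ∞ fun p : (Fin 2 → ℝ) × ℝ =>
    a ((fun i => (p.1 i : AddCircle (2 * Real.pi))), Circle.exp p.2)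

/-- The function `a(·, θ)` on the torus. -/
def slice (a : C(PhaseSpace, ℂ)) (θ : Circle) : C(Torus, ℂ) where
  toFun x := a (x, θ)
  continuous_toFun := by fun_prop

/-- `T = Op(a)`: the bounded operator on `L²(𝕋²)` with
`(Op(a) f)(x) = ∑_v a(x, v/|v|) f̂(v) e^{i v·x}`, that is
`Op(a) e^{i v·x} = a(x, v/|v|) e^{i v·x}` for all `v ∈ ℤ²`. -/
def IsOp (a : C(PhaseSpace, ℂ)) (T : L2 →L[ℂ] L2) : Prop :=
  ∀ v, T (toL2 (char v)) = toL2 (slice a (dir v) * char v)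

/-- `μ` is the quantum limit of the functions `g_λ` as `λ → ∞` along `Λ'`: the matrix elements
`⟨Op(a) g_λ, g_λ⟩` tend to `∫ a dμ`, for every smooth observable `a` on `S*𝕋²`. -/
def IsQuantumLimit (L : Set ℝ) (g : ℝ → L2) (μ : Measure PhaseSpace) : Prop :=
  ∀ a : C(PhaseSpace, ℂ), IsSmooth a → ∃ T : L2 →L[ℂ] L2, IsOp a T ∧
    Tendsto (fun l => (inner ℂ (g l) (T (g l)) : ℂ)) (atTop ⊓ 𝓟 L) (𝓝 (∫ p, a p ∂μ))

end PointScatterer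

end

open PointScatterer

namespace PointScatterer

/-! For `λ` in `[N - 1/2, N)`, where `N = a² + 1`, two terms of the spectral equation stand out:
that of `N`, about `r₂(N)/(N-λ)` and unbounded as `λ → N`, and that of `a²`, of size `-R` with `R =
r₂(a²)`. If `R` dominates `r₂(N)`, the right-hand side and the total contribution of all other
energies, the equation has a root with `N - λ ≤ 4 r₂(N)/R` (`exists_root`). The Fourier coefficients
of an eigenfunction are proportional to `1/(|v|² - λ)` in modulus, so all but `O(r₂(N)/R)` of its
mass lies on the circle `|v|² = N` (`concentration`). A window of energies is harmless: it is
constant on this interval and contains `a²` and `a² + 1`, and the far sum is bounded in absolute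
value over all energies.

It remains to find infinitely many `a` with `r₂(a² + 1)` bounded and `r₂(a²)` dominating the far sum
(`exists_isolated`). Take `a = Q t` with `Q = (2q)^X`, where `q` is a product of `m` primes `≡ 1 mod
4`, and `t ∈ [T, 2T)` with `T = 2^(C X)`. Then `r₂(a²) ≥ (2X+1)^m` (`exists_base`). A Brun–Hooley
sieve leaves at least `T/(4 X^24)` values of `t` for which `Q²t² + 1` has no prime factor below
`2^X` (`exists_sieve_lower_bound`); such a number has boundedly many prime factors, hence bounded
`r₂`. Averaged over all `t`, the far sum is at most a constant times `X^(A+1)`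
(`sum_sum_r2_div_le`), by counting solutions of `d ∣ Q²t² + k` for small `d`. So some sieved `t` has
a far sum of order at most `X^(A+25)`. The exponents `A` and `24` do not depend on `q`, so `m = A +
26` can be fixed in advance and wins by a factor `X`.

By pigeonhole `r₂(a² + 1) = r` is constant along a sequence. On a subsequence the `r` directions
converge and each difference of two lattice points is eventually constant or leaves every finite
set; this groups the points into clusters (`exists_clusters`). Matrix elements between different
clusters vanish in the limit by the Riemann–Lebesgue lemma, and those within a cluster converge
(`tendsto_inner_op_shell`), so the quantum limit is `clusterMeasure`. Its momentum marginal is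
carried by finitely many points, which therefore have all the mass. The points `(a, 1)` and `(a,
-1)` always differ by `(0, 2)`, and the Fourier coefficient of the position marginal at `(0, 2)` is,
up to a unimodular factor, the number of such pairs divided by `r`; hence it is not zero. -/

/-! ### Elementary symmetric functions and Bonferroni inequalities -/

open Finset in
/-- The elementary symmetric function of degree `k` of the values `g p`, `p ∈ P`. -/
noncomputable def esum (g : ℕ → ℝ) (P : Finset ℕ) (k : ℕ) : ℝ := ∑ S ∈ P.powersetCard k, ∏ p ∈ S, g p

/-- The truncation at degree `b` of the expansion of `∏ p ∈ P, (1 - g p)`. -/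
noncomputable def trunc (g : ℕ → ℝ) (P : Finset ℕ) (b : ℕ) : ℝ :=
  ∑ k ∈ Finset.range (b + 1), (-1) ^ k * esum g P k

theorem esum_zero (g : ℕ → ℝ) (P : Finset ℕ) : esum g P 0 = 1 := by simp [esum]

theorem esum_empty_succ (g : ℕ → ℝ) (k : ℕ) : esum g ∅ (k + 1) = 0 := by
  rw [esum, Finset.powersetCard_eq_empty.2 (by simp), Finset.sum_empty]

theorem esum_nonneg {g : ℕ → ℝ} {P : Finset ℕ} (hg : ∀ p ∈ P, 0 ≤ g p) (k : ℕ) :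
    0 ≤ esum g P k :=
  Finset.sum_nonneg fun _ hS => Finset.prod_nonneg fun p hp =>
    hg p ((Finset.mem_powersetCard.1 hS).1 hp)

theorem esum_insert (g : ℕ → ℝ) {P : Finset ℕ} {p : ℕ} (hp : p ∉ P) (k : ℕ) :
    esum g (insert p P) (k + 1) = esum g P (k + 1) + g p * esum g P k := by
  unfold esum
  rw [Finset.powersetCard_succ_insert hp, Finset.sum_union, Finset.sum_image, Finset.mul_sum]
  · congr 1
    refine Finset.sum_congr rfl fun S hS => ?_
    rw [Finset.prod_insert]
    exact fun h => hp ((Finset.mem_powersetCard.1 hS).1 h)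
  · intro S hS S' hS' h
    have h1 : p ∉ S := fun h => hp ((Finset.mem_powersetCard.1 hS).1 h)
    have h2 : p ∉ S' := fun h => hp ((Finset.mem_powersetCard.1 hS').1 h)
    rw [← Finset.erase_insert h1, ← Finset.erase_insert h2, h]
  · rw [Finset.disjoint_left]
    intro S hS hS'
    obtain ⟨S', -, rfl⟩ := Finset.mem_image.1 hS'
    exact hp ((Finset.mem_powersetCard.1 hS).1 (Finset.mem_insert_self _ _))

/-- In the expansion of the `k`-th power of the sum each squarefree monomial of degree `k` occurs
`k!` times. The induction keeps only two terms of a binomial expansion. -/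
theorem esum_le_pow_div_factorial {g : ℕ → ℝ} {P : Finset ℕ} (hg : ∀ p ∈ P, 0 ≤ g p) (k : ℕ) :
    esum g P k ≤ (∑ p ∈ P, g p) ^ k / k.factorial := by
  induction P using Finset.induction_on generalizing k with
  | empty =>
    cases k with
    | zero => simp [esum_zero]
    | succ k => simp [esum_empty_succ]
  | insert p P hp ih =>
    have hg' : ∀ q ∈ P, 0 ≤ g q := fun q hq => hg q (Finset.mem_insert_of_mem hq)
    have hgp : 0 ≤ g p := hg p (Finset.mem_insert_self _ _)
    have hL : 0 ≤ ∑ q ∈ P, g q := Finset.sum_nonneg hg'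
    cases k with
    | zero => simp [esum_zero]
    | succ k =>
      rw [esum_insert g hp, Finset.sum_insert hp]
      set L := ∑ q ∈ P, g q
      have h1 := ih hg' (k + 1)
      have h2 := mul_le_mul_of_nonneg_left (ih hg' k) hgp
      have h3 : L ^ (k + 1) + (k + 1) * L ^ k * g p ≤ (g p + L) ^ (k + 1) := by
        rw [add_pow, Finset.sum_range_succ', Finset.sum_range_succ' ]
        cases k with
        | zero => simp; ring_nf; rfl
        | succ k =>
          have : 0 ≤ ∑ i ∈ Finset.range (k + 1), g p ^ (i + 1 + 1) * L ^ (k + 1 + 1 - (i + 1 + 1)) *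
              ((k + 1 + 1).choose (i + 1 + 1) : ℝ) := Finset.sum_nonneg fun i _ => by positivity
          simp at this ⊢
          nlinarith
      have hf : (0 : ℝ) < (k + 1).factorial := by positivity
      have hf' : ((k + 1).factorial : ℝ) = (k + 1) * k.factorial := by
        rw [Nat.factorial_succ]; push_cast; ring
      have hk : (0 : ℝ) < k.factorial := by positivity
      calc _ ≤ L ^ (k + 1) / (k + 1).factorial + g p * (L ^ k / k.factorial) := add_le_add h1 h2
        _ = (L ^ (k + 1) + (k + 1) * L ^ k * g p) / (k + 1).factorial := by
            rw [hf']; field_simp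
        _ ≤ _ := by gcongr

theorem trunc_zero (g : ℕ → ℝ) (P : Finset ℕ) : trunc g P 0 = 1 := by simp [trunc, esum_zero]

theorem trunc_succ (g : ℕ → ℝ) (P : Finset ℕ) (b : ℕ) :
    trunc g P (b + 1) = trunc g P b + (-1) ^ (b + 1) * esum g P (b + 1) := by
  simp [trunc, Finset.sum_range_succ _ (b + 1)]

theorem trunc_insert (g : ℕ → ℝ) {P : Finset ℕ} {p : ℕ} (hp : p ∉ P) (b : ℕ) :
    trunc g (insert p P) (b + 1) = trunc g P (b + 1) - g p * trunc g P b := by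
  unfold trunc
  rw [Finset.sum_range_succ' _ (b + 1), Finset.sum_range_succ' _ (b + 1), Finset.mul_sum]
  simp only [esum_insert g hp, esum_zero]
  rw [add_sub_right_comm, ← Finset.sum_sub_distrib]
  congr 1
  exact Finset.sum_congr rfl fun k _ => by ring

/-- When `p` joins `P`, the error at level `b + 1` becomes the old error at `b + 1` minus `g p`
times the old error at `b`. These have opposite signs, so both contributions point the same way. -/
theorem bonferroni {g : ℕ → ℝ} {P : Finset ℕ} (hg : ∀ p ∈ P, 0 ≤ g p ∧ g p ≤ 1) (b : ℕ) :
    0 ≤ (-1) ^ b * (trunc g P b - ∏ p ∈ P, (1 - g p)) := by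
  induction P using Finset.induction_on generalizing b with
  | empty =>
    have : ∀ b, trunc g ∅ b = 1 := by
      intro b
      induction b with
      | zero => exact trunc_zero _ _
      | succ b ih => rw [trunc_succ, ih, esum_empty_succ]; simp
    simp [this]
  | insert p P hp ih =>
    have hg' : ∀ q ∈ P, 0 ≤ g q ∧ g q ≤ 1 := fun q hq => hg q (Finset.mem_insert_of_mem hq)
    have hgp := hg p (Finset.mem_insert_self _ _)
    cases b with
    | zero =>
      rw [trunc_zero, pow_zero, one_mul, sub_nonneg]
      exact Finset.prod_le_one (fun q hq => by linarith [(hg q hq).2])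
        (fun q hq => by linarith [(hg q hq).1])
    | succ b =>
      rw [trunc_insert g hp, Finset.prod_insert hp]
      have h1 := ih hg' (b + 1)
      have h2 := mul_nonneg hgp.1 (ih hg' b)
      rw [pow_succ] at h1 ⊢
      nlinarith

theorem prod_le_trunc {g : ℕ → ℝ} {P : Finset ℕ} (hg : ∀ p ∈ P, 0 ≤ g p ∧ g p ≤ 1) {b : ℕ}
    (hb : Even b) : ∏ p ∈ P, (1 - g p) ≤ trunc g P b := by
  have := bonferroni hg b
  rw [hb.neg_one_pow] at this
  linarith

/-- The truncation at the odd level `b + 1` is a lower bound for the product and differs from the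
one at `b` by a single term. -/
theorem trunc_sub_prod_le {g : ℕ → ℝ} {P : Finset ℕ} (hg : ∀ p ∈ P, 0 ≤ g p ∧ g p ≤ 1) {b : ℕ}
    (hb : Even b) : trunc g P b - ∏ p ∈ P, (1 - g p) ≤ esum g P (b + 1) := by
  have := bonferroni hg (b + 1)
  rw [trunc_succ, pow_succ, hb.neg_one_pow] at this
  linarith

theorem trunc_eq_sum_powerset (g : ℕ → ℝ) (P : Finset ℕ) (b : ℕ) :
    trunc g P b = ∑ S ∈ P.powerset with S.card ≤ b, (-1) ^ S.card * ∏ p ∈ S, g p := by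
  unfold trunc esum
  have : P.powerset.filter (fun S => S.card ≤ b) =
      (Finset.range (b + 1)).biUnion fun k => P.powersetCard k := by
    ext S
    simp [Finset.mem_powersetCard]
    tauto
  rw [this, Finset.sum_biUnion]
  · refine Finset.sum_congr rfl fun k _ => ?_
    rw [Finset.mul_sum]
    exact Finset.sum_congr rfl fun S hS => by rw [(Finset.mem_powersetCard.1 hS).2]
  · intro i _ j _ hij
    rw [Function.onFun, Finset.disjoint_left]
    intro S h1 h2
    exact hij ((Finset.mem_powersetCard.1 h1).2.symm.trans (Finset.mem_powersetCard.1 h2).2)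

/-- A product of zeros and ones is bounded below by products of upper bounds of the factors. -/
theorem prod_sub_sum_mul_prod_erase_le {ι : Type*} [DecidableEq ι] (s : Finset ι)
    (x y e : ι → ℝ) (hx : ∀ i ∈ s, x i = 0 ∨ x i = 1) (hxy : ∀ i ∈ s, x i ≤ y i)
    (he : ∀ i ∈ s, y i - x i ≤ e i) :
    ∏ i ∈ s, y i - ∑ l ∈ s, e l * ∏ i ∈ s.erase l, y i ≤ ∏ i ∈ s, x i := by
  have hy : ∀ i ∈ s, 0 ≤ y i := fun i hi => by
    rcases hx i hi with h | h <;> linarith [hxy i hi]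
  have hx1 : ∀ i ∈ s, x i ≤ 1 := fun i hi => by rcases hx i hi with h | h <;> linarith
  have hnn : ∀ l ∈ s, 0 ≤ e l * ∏ i ∈ s.erase l, y i := fun l hl =>
    mul_nonneg (by linarith [hxy l hl, he l hl])
      (Finset.prod_nonneg fun i hi => hy i (Finset.mem_of_mem_erase hi))
  -- If some `x l` vanishes, then `y l ≤ e l` and the correction term of `l` alone outweighs the
  -- whole product. Otherwise all `x i` are one and the product of the `y i` telescopes.
  by_cases h : ∃ l ∈ s, x l = 0
  · obtain ⟨l, hl, h0⟩ := h
    rw [Finset.prod_eq_zero hl h0, sub_nonpos, ← Finset.mul_prod_erase s y hl]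
    refine le_trans ?_ (Finset.single_le_sum hnn hl)
    refine mul_le_mul_of_nonneg_right (by linarith [he l hl])
      (Finset.prod_nonneg fun i hi => hy i (Finset.mem_of_mem_erase hi))
  · push Not at h
    have h1 : ∀ i ∈ s, x i = 1 := fun i hi => (hx i hi).resolve_left (h i hi)
    rw [Finset.prod_congr rfl h1, Finset.prod_const_one]
    -- telescoping: `∏ y ≤ 1 + ∑ (y - 1) ∏ y`
    have key : ∀ u ⊆ s, ∏ i ∈ u, y i - ∑ l ∈ u, e l * ∏ i ∈ u.erase l, y i ≤ 1 := by
      intro u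
      induction u using Finset.induction_on with
      | empty => simp
      | insert a u ha ih =>
        intro hu
        have hus : u ⊆ s := fun i hi => hu (Finset.mem_insert_of_mem hi)
        have has : a ∈ s := hu (Finset.mem_insert_self _ _)
        have := ih hus
        rw [Finset.prod_insert ha, Finset.sum_insert ha, Finset.erase_insert ha]
        have e1 : ∑ l ∈ u, e l * ∏ i ∈ (insert a u).erase l, y i =
            y a * ∑ l ∈ u, e l * ∏ i ∈ u.erase l, y i := by
          rw [Finset.mul_sum]
          refine Finset.sum_congr rfl fun l hl => ?_
          have hla : a ≠ l := fun h => ha (h ▸ hl)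
          rw [Finset.erase_insert_of_ne hla, Finset.prod_insert
            (fun h => ha (Finset.mem_of_mem_erase h))]
          ring
        rw [e1]
        have p1 : 1 ≤ y a := by have := hxy a has; rw [h1 a has] at this; exact this
        have p2 : y a - 1 ≤ e a := by have := he a has; rw [h1 a has] at this; exact this
        have p3 : 1 ≤ ∏ i ∈ u, y i := by
          calc (1 : ℝ) = ∏ i ∈ u, x i := by
                rw [Finset.prod_congr rfl fun i hi => h1 i (hus hi), Finset.prod_const_one]
            _ ≤ _ := Finset.prod_le_prod (fun i hi => by simp [h1 i (hus hi)])
                fun i hi => hxy i (hus hi)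
        have p4 : 0 ≤ ∑ l ∈ u, e l * ∏ i ∈ u.erase l, y i := Finset.sum_nonneg fun l hl =>
          mul_nonneg (by linarith [hxy l (hus hl), he l (hus hl)])
            (Finset.prod_nonneg fun i hi => hy i (hus (Finset.mem_of_mem_erase hi)))
        nlinarith
    exact key s subset_rfl

/-- Bounds the remainder of one block of the sieve, in which a set `S` of primes costs `2 ^ S.card`.
-/
theorem sum_two_pow_card_le (P : Finset ℕ) (n : ℕ) {F : Finset (Finset ℕ)}
    (hF : ∀ S ∈ F, S ⊆ P ∧ S.card ≤ n) :
    ∑ S ∈ F, (2 : ℝ) ^ S.card ≤ (1 + 2 * P.card) ^ n := by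
  calc ∑ S ∈ F, (2 : ℝ) ^ S.card
      ≤ ∑ S ∈ (Finset.range (n + 1)).biUnion fun k => P.powersetCard k, (2 : ℝ) ^ S.card := by
        refine Finset.sum_le_sum_of_subset_of_nonneg (fun S hS => ?_) fun _ _ _ => by positivity
        have := hF S hS
        simp only [Finset.mem_biUnion, Finset.mem_range, Finset.mem_powersetCard]
        exact ⟨S.card, by omega, this.1, rfl⟩
    _ ≤ ∑ k ∈ Finset.range (n + 1), ∑ S ∈ P.powersetCard k, (2 : ℝ) ^ S.card := by
        refine le_of_eq (Finset.sum_biUnion ?_)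
        intro i _ j _ hij
        rw [Function.onFun, Finset.disjoint_left]
        intro S h1 h2
        exact hij ((Finset.mem_powersetCard.1 h1).2.symm.trans (Finset.mem_powersetCard.1 h2).2)
    _ = ∑ k ∈ Finset.range (n + 1), (P.card.choose k : ℝ) * 2 ^ k := by
        refine Finset.sum_congr rfl fun k _ => ?_
        rw [Finset.sum_congr rfl fun S hS => by rw [(Finset.mem_powersetCard.1 hS).2],
          Finset.sum_const, Finset.card_powersetCard, nsmul_eq_mul]
    _ ≤ ∑ k ∈ Finset.range (n + 1), (2 * (P.card : ℝ)) ^ k * 1 ^ (n - k) * (n.choose k : ℝ) := by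
        refine Finset.sum_le_sum fun k hk => ?_
        have h1 : (P.card.choose k : ℝ) ≤ (P.card : ℝ) ^ k := by
          exact_mod_cast Nat.choose_le_pow P.card k
        have h2 : (1 : ℝ) ≤ n.choose k := by
          exact_mod_cast Nat.choose_pos (by have := Finset.mem_range.1 hk; omega)
        rw [one_pow, mul_one, mul_pow]
        calc _ ≤ (P.card : ℝ) ^ k * 2 ^ k := by gcongr
          _ = 2 ^ k * (P.card : ℝ) ^ k * 1 := by ring
          _ ≤ _ := by gcongr
    _ = (1 + 2 * (P.card : ℝ)) ^ n := by rw [add_comm (1 : ℝ), add_pow]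

/-! ### The Brun–Hooley sieve -/

section Sieve

variable {ι α : Type*} [Fintype ι] [DecidableEq ι]

/-- Multiplying out means choosing one set from each `F i`. As the blocks are disjoint, the product
of the indicators is the indicator of `S ⊆ U t` for the disjoint union `S` of the choices, to which
`hN` applies; the error `2 ^ S.card` is multiplicative, so the errors add up to a product as well.
-/
theorem abs_sum_prod_sub_le (Ω : Finset α) (U : α → Finset ℕ) (T : ℝ) (g : ℕ → ℝ)
    (P : ι → Finset ℕ) (hP : ∀ i j, i ≠ j → Disjoint (P i) (P j))
    (hN : ∀ S : Finset ℕ, S ⊆ Finset.univ.biUnion P →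
      |(((Ω.filter fun t => S ⊆ U t).card : ℕ) : ℝ) - T * ∏ p ∈ S, g p| ≤ 2 ^ S.card)
    (F : ι → Finset (Finset ℕ)) (hF : ∀ i, ∀ S ∈ F i, S ⊆ P i)
    (ε : ι → Finset ℕ → ℝ) (hε : ∀ i, ∀ S ∈ F i, |ε i S| ≤ 1) :
    |∑ t ∈ Ω, ∏ i, ∑ S ∈ F i, ε i S * ∏ p ∈ S, (if p ∈ U t then (1 : ℝ) else 0)
      - T * ∏ i, ∑ S ∈ F i, ε i S * ∏ p ∈ S, g p| ≤ ∏ i, ∑ S ∈ F i, (2 : ℝ) ^ S.card := by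
  have hdisj : ∀ σ ∈ Fintype.piFinset F,
      ((Finset.univ : Finset ι) : Set ι).PairwiseDisjoint σ := by
    intro σ hσ i _ j _ hij
    exact (hP i j hij).mono (hF i _ (Fintype.mem_piFinset.1 hσ i))
      (hF j _ (Fintype.mem_piFinset.1 hσ j))
  have e1 : ∀ h : ℕ → ℝ, ∏ i, ∑ S ∈ F i, ε i S * ∏ p ∈ S, h p =
      ∑ σ ∈ Fintype.piFinset F, (∏ i, ε i (σ i)) * ∏ p ∈ Finset.univ.biUnion σ, h p := by
    intro h
    rw [Finset.prod_univ_sum]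
    refine Finset.sum_congr rfl fun σ hσ => ?_
    rw [Finset.prod_mul_distrib, Finset.prod_biUnion (hdisj σ hσ)]
  have e2 : ∀ S : Finset ℕ, ∑ t ∈ Ω, ∏ p ∈ S, (if p ∈ U t then (1 : ℝ) else 0) =
      ((Ω.filter fun t => S ⊆ U t).card : ℕ) := by
    intro S
    rw [Finset.card_filter, Nat.cast_sum]
    refine Finset.sum_congr rfl fun t _ => ?_
    rw [Finset.prod_ite_zero]
    simp [Finset.subset_iff]
  simp only [e1]
  rw [Finset.sum_comm, Finset.mul_sum, ← Finset.sum_sub_distrib, Finset.prod_univ_sum]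
  refine (Finset.abs_sum_le_sum_abs _ _).trans (Finset.sum_le_sum fun σ hσ => ?_)
  rw [← Finset.mul_sum, e2, mul_left_comm, ← mul_sub, abs_mul]
  have h1 : |∏ i, ε i (σ i)| ≤ 1 := by
    rw [Finset.abs_prod]
    exact Finset.prod_le_one (fun _ _ => abs_nonneg _)
      fun i _ => hε i _ (Fintype.mem_piFinset.1 hσ i)
  have h2 := hN (Finset.univ.biUnion σ) (Finset.biUnion_subset.2 fun i _ =>
    (hF i _ (Fintype.mem_piFinset.1 hσ i)).trans
      (Finset.subset_biUnion_of_mem P (Finset.mem_univ i)))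
  calc _ ≤ 1 * (2 : ℝ) ^ (Finset.univ.biUnion σ).card :=
        mul_le_mul h1 h2 (abs_nonneg _) zero_le_one
    _ = ∏ i, (2 : ℝ) ^ (σ i).card := by
        rw [one_mul, Finset.card_biUnion (fun i _ j _ hij =>
          hdisj σ hσ (Finset.mem_coe.2 (Finset.mem_univ i)) (Finset.mem_coe.2 (Finset.mem_univ j)) hij),
          Finset.prod_pow_eq_pow_sum]

/-- The lower bound of the Brun–Hooley sieve. -/
theorem brun_hooley (Ω : Finset α) (U : α → Finset ℕ) (T : ℝ) (g : ℕ → ℝ)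
    (P : ι → Finset ℕ) (hP : ∀ i j, i ≠ j → Disjoint (P i) (P j))
    (hN : ∀ S : Finset ℕ, S ⊆ Finset.univ.biUnion P →
      |(((Ω.filter fun t => S ⊆ U t).card : ℕ) : ℝ) - T * ∏ p ∈ S, g p| ≤ 2 ^ S.card)
    (b : ι → ℕ) (hb : ∀ i, Even (b i)) :
    T * (∏ i, trunc g (P i) (b i) -
        ∑ l, esum g (P l) (b l + 1) * ∏ i ∈ Finset.univ.erase l, trunc g (P i) (b i)) -
      (Fintype.card ι + 1) * ∏ i, (1 + 2 * ((P i).card : ℝ)) ^ (b i + 1) ≤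
    ((Ω.filter fun t => ∀ i, Disjoint (P i) (U t)).card : ℕ) := by
  set ind : α → ℕ → ℝ := fun t p => if p ∈ U t then 1 else 0 with hind
  set err := ∏ i, (1 + 2 * ((P i).card : ℝ)) ^ (b i + 1) with herr
  have hind01 : ∀ t p, 0 ≤ ind t p ∧ ind t p ≤ 1 := by
    intro t p; simp only [hind]; split_ifs <;> norm_num
  -- the two kinds of averages
  have hbound : ∀ F : ι → Finset (Finset ℕ), (∀ i, ∀ S ∈ F i, S ⊆ P i ∧ S.card ≤ b i + 1) →
      ∏ i, ∑ S ∈ F i, (2 : ℝ) ^ S.card ≤ err := fun F hF =>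
    Finset.prod_le_prod (fun i _ => Finset.sum_nonneg fun _ _ => by positivity)
      fun i _ => sum_two_pow_card_le _ _ (hF i)
  have m1 : T * ∏ i, trunc g (P i) (b i) - err ≤ ∑ t ∈ Ω, ∏ i, trunc (ind t) (P i) (b i) := by
    have h := abs_sum_prod_sub_le Ω U T g P hP hN
      (fun i => (P i).powerset.filter fun S => S.card ≤ b i)
      (fun i S hS => Finset.mem_powerset.1 (Finset.mem_filter.1 hS).1)
      (fun i S => (-1) ^ S.card) (fun i S _ => by simp)
    have h' := h.trans (hbound _ fun i S hS => ⟨Finset.mem_powerset.1 (Finset.mem_filter.1 hS).1,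
      (Finset.mem_filter.1 hS).2.trans (Nat.le_succ _)⟩)
    simp only [← trunc_eq_sum_powerset] at h'
    have := (abs_le.1 h').1
    have e : ∑ t ∈ Ω, ∏ i, trunc (ind t) (P i) (b i) = ∑ t ∈ Ω, ∏ i,
      trunc (fun p => if p ∈ U t then (1 : ℝ) else 0) (P i) (b i) := rfl
    rw [e]; linarith
  -- The correction term of index `l`: block `l` carries the symmetric function of degree `b l + 1`,
  -- all other blocks their truncations.
  have m2 : ∀ l, ∑ t ∈ Ω, esum (ind t) (P l) (b l + 1) *
      ∏ i ∈ Finset.univ.erase l, trunc (ind t) (P i) (b i) ≤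
      T * (esum g (P l) (b l + 1) * ∏ i ∈ Finset.univ.erase l, trunc g (P i) (b i)) + err := by
    intro l
    set F : ι → Finset (Finset ℕ) := fun i => if i = l then (P i).powersetCard (b i + 1) else
      (P i).powerset.filter fun S => S.card ≤ b i with hF
    set ε : ι → Finset ℕ → ℝ := fun i S => if i = l then 1 else (-1) ^ S.card with hε
    have hFm : ∀ i, ∀ S ∈ F i, S ⊆ P i ∧ S.card ≤ b i + 1 := by
      intro i S hS
      simp only [hF] at hS
      split_ifs at hS with h
      · have := Finset.mem_powersetCard.1 hS
        exact ⟨this.1, this.2.le⟩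
      · exact ⟨Finset.mem_powerset.1 (Finset.mem_filter.1 hS).1,
          (Finset.mem_filter.1 hS).2.trans (Nat.le_succ _)⟩
    have key : ∀ h : ℕ → ℝ, ∏ i, ∑ S ∈ F i, ε i S * ∏ p ∈ S, h p =
        esum h (P l) (b l + 1) * ∏ i ∈ Finset.univ.erase l, trunc h (P i) (b i) := by
      intro h
      rw [← Finset.mul_prod_erase _ _ (Finset.mem_univ l)]
      congr 1
      · simp [hF, hε, esum]
      · refine Finset.prod_congr rfl fun i hi => ?_
        have : i ≠ l := Finset.ne_of_mem_erase hi
        simp [hF, hε, this, trunc_eq_sum_powerset]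
    have h := abs_sum_prod_sub_le Ω U T g P hP hN F (fun i S hS => (hFm i S hS).1) ε
      (fun i S _ => by simp only [hε]; split_ifs <;> simp)
    have h' := h.trans (hbound _ hFm)
    simp only [key] at h'
    have := (abs_le.1 h').2
    have e : ∑ t ∈ Ω, esum (ind t) (P l) (b l + 1) *
      ∏ i ∈ Finset.univ.erase l, trunc (ind t) (P i) (b i) = ∑ t ∈ Ω,
      esum (fun p => if p ∈ U t then (1 : ℝ) else 0) (P l) (b l + 1) *
      ∏ i ∈ Finset.univ.erase l, trunc (fun p => if p ∈ U t then (1 : ℝ) else 0) (P i) (b i) := rfl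
    rw [e]; linarith
  -- Hooley's device: for each `t` the product over a block is zero or one, so the product over all
  -- blocks is bounded below by means of upper bounds for the single blocks.
  have hpt : ∀ t ∈ Ω, ∏ i, trunc (ind t) (P i) (b i) - ∑ l, esum (ind t) (P l) (b l + 1) *
      ∏ i ∈ Finset.univ.erase l, trunc (ind t) (P i) (b i) ≤
      if ∀ i, Disjoint (P i) (U t) then 1 else 0 := by
    intro t _
    have hx : ∀ i, (∏ p ∈ P i, (1 - ind t p)) = if Disjoint (P i) (U t) then 1 else 0 := by
      intro i
      have : ∀ p, 1 - ind t p = if p ∉ U t then 1 else 0 := by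
        intro p; simp only [hind]; split_ifs <;> simp_all
      simp only [this]
      rw [Finset.prod_ite_zero]
      simp [Finset.disjoint_left]
    have := prod_sub_sum_mul_prod_erase_le Finset.univ (fun i => ∏ p ∈ P i, (1 - ind t p))
      (fun i => trunc (ind t) (P i) (b i)) (fun i => esum (ind t) (P i) (b i + 1))
      (fun i _ => by rw [hx]; split_ifs <;> simp)
      (fun i _ => prod_le_trunc (fun p _ => hind01 t p) (hb i))
      (fun i _ => trunc_sub_prod_le (fun p _ => hind01 t p) (hb i))
    refine this.trans (le_of_eq ?_)
    simp only [hx]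
    rw [Finset.prod_ite_zero]
    simp
  have hsum := Finset.sum_le_sum hpt
  rw [Finset.sum_sub_distrib, Finset.sum_comm, Finset.sum_boole] at hsum
  have hm2 := Finset.sum_le_sum fun l (_ : l ∈ Finset.univ) => m2 l
  rw [Finset.sum_add_distrib, ← Finset.mul_sum, Finset.sum_const, Finset.card_univ,
    nsmul_eq_mul] at hm2
  linarith

/-- Leaving out one factor of the product costs at most `1 / v`, so by `hE` the correction terms use
up at most half of the main term. -/
theorem brun_hooley_half (Ω : Finset α) (U : α → Finset ℕ) {T : ℝ} (hT : 0 ≤ T) (g : ℕ → ℝ)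
    (P : ι → Finset ℕ) (hP : ∀ i j, i ≠ j → Disjoint (P i) (P j))
    (hN : ∀ S : Finset ℕ, S ⊆ Finset.univ.biUnion P →
      |(((Ω.filter fun t => S ⊆ U t).card : ℕ) : ℝ) - T * ∏ p ∈ S, g p| ≤ 2 ^ S.card)
    (b : ι → ℕ) (hb : ∀ i, Even (b i)) (hg : ∀ i, ∀ p ∈ P i, 0 ≤ g p ∧ g p ≤ 1)
    {v : ℝ} (hv : 0 < v) (hV : ∀ i, v ≤ ∏ p ∈ P i, (1 - g p))
    (hE : ∑ l, esum g (P l) (b l + 1) ≤ v / 2) :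
    T * v ^ Fintype.card ι / 2 -
      (Fintype.card ι + 1) * ∏ i, (1 + 2 * ((P i).card : ℝ)) ^ (b i + 1) ≤
    ((Ω.filter fun t => ∀ i, Disjoint (P i) (U t)).card : ℕ) := by
  refine le_trans ?_ (brun_hooley Ω U T g P hP hN b hb)
  refine sub_le_sub_right ?_ _
  rw [mul_div_assoc]
  refine mul_le_mul_of_nonneg_left ?_ hT
  set Y := fun i => trunc g (P i) (b i) with hY
  have hYv : ∀ i, v ≤ Y i := fun i => (hV i).trans (prod_le_trunc (hg i) (hb i))
  have hprod : v ^ Fintype.card ι ≤ ∏ i, Y i := by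
    rw [← Finset.card_univ, ← Finset.prod_const]
    exact Finset.prod_le_prod (fun _ _ => hv.le) fun i _ => hYv i
  have hpos : 0 ≤ ∏ i, Y i := (pow_nonneg hv.le _).trans hprod
  have hs : ∑ l, esum g (P l) (b l + 1) * ∏ i ∈ Finset.univ.erase l, Y i ≤ (∏ i, Y i) / 2 := by
    calc _ ≤ ∑ l, esum g (P l) (b l + 1) * ((∏ i, Y i) / v) := by
          refine Finset.sum_le_sum fun l _ => mul_le_mul_of_nonneg_left ?_
            (esum_nonneg (fun p hp => (hg l p hp).1) _)
          rw [le_div_iff₀ hv, ← Finset.mul_prod_erase _ Y (Finset.mem_univ l), mul_comm]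
          exact mul_le_mul_of_nonneg_right (hYv l)
            (Finset.prod_nonneg fun i _ => hv.le.trans (hYv i))
      _ = (∑ l, esum g (P l) (b l + 1)) * ((∏ i, Y i) / v) := by rw [Finset.sum_mul]
      _ ≤ v / 2 * ((∏ i, Y i) / v) := by gcongr
      _ = _ := by field_simp
  linarith

end Sieve

/-! ### Roots of `Q² t² + 1` -/

theorem abs_card_filter_modEq_sub_le (a L v : ℕ) {r : ℕ} (hr : 0 < r) :
    |(((Finset.Ico a (a + L)).filter (· ≡ v [MOD r])).card : ℝ) - L / r| ≤ 1 := by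
  have h := Nat.Ico_filter_modEq_card (a := a) (b := a + L) hr v
  set x : ℚ := ((a : ℚ) - v) / r with hx
  have hr' : (0 : ℚ) < r := by exact_mod_cast hr
  have e : (((a + L : ℕ) : ℚ) - v) / r = x + L / r := by rw [hx]; push_cast; ring
  rw [e] at h
  have hL : (0 : ℚ) ≤ (L : ℚ) / r := by positivity
  have hm : max (⌈x + L / r⌉ - ⌈x⌉) 0 = ⌈x + (L : ℚ) / r⌉ - ⌈x⌉ :=
    max_eq_left (sub_nonneg.2 (Int.ceil_mono (by linarith)))
  rw [hm] at h
  have h1 := Int.le_ceil x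
  have h2 := Int.ceil_lt_add_one x
  have h3 := Int.le_ceil (x + (L : ℚ) / r)
  have h4 := Int.ceil_lt_add_one (x + (L : ℚ) / r)
  have hq : |(((Finset.Ico a (a + L)).filter (· ≡ v [MOD r])).card : ℚ) - L / r| ≤ 1 := by
    have : (((Finset.Ico a (a + L)).filter (· ≡ v [MOD r])).card : ℚ) =
        (⌈x + (L : ℚ) / r⌉ : ℚ) - ⌈x⌉ := by exact_mod_cast h
    rw [this, abs_le]
    constructor <;> linarith
  have := (Rat.cast_le (K := ℝ)).2 hq
  push_cast at this
  exact this

/-- The number of roots of `Q² x² + 1` in a commutative ring. -/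
noncomputable def rootCount (Q : ℕ) (R : Type) [CommRing R] : ℕ := Nat.card {x : R // (Q : R) ^ 2 * x ^ 2 + 1 = 0}

theorem rootCount_mul (Q : ℕ) {m n : ℕ} (h : m.Coprime n) :
    rootCount Q (ZMod (m * n)) = rootCount Q (ZMod m) * rootCount Q (ZMod n) := by
  unfold rootCount
  rw [← Nat.card_prod]
  refine Nat.card_congr ((Equiv.subtypeEquiv (ZMod.chineseRemainder h).toEquiv ?_).trans
    (Equiv.subtypeProdEquivProd (p := fun x : ZMod m => (Q : ZMod m) ^ 2 * x ^ 2 + 1 = 0)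
      (q := fun y : ZMod n => (Q : ZMod n) ^ 2 * y ^ 2 + 1 = 0)))
  intro x
  set y := (ZMod.chineseRemainder h) x with hy
  have : (Q : ZMod (m * n)) ^ 2 * x ^ 2 + 1 = 0 ↔ (Q : ZMod m × ZMod n) ^ 2 * y ^ 2 + 1 = 0 := by
    rw [← map_eq_zero_iff _ (ZMod.chineseRemainder h).injective]
    simp [hy]
  rw [this, Prod.ext_iff]
  rfl

theorem rootCount_prime {Q p : ℕ} (hp : p.Prime) (h4 : p % 4 = 1) (hQ : ¬ p ∣ Q) :
    rootCount Q (ZMod p) = 2 := by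
  have : Fact p.Prime := ⟨hp⟩
  obtain ⟨i, hi⟩ := (ZMod.exists_sq_eq_neg_one_iff (p := p)).2 (by omega)
  have hq : (Q : ZMod p) ≠ 0 := by rwa [Ne, ZMod.natCast_eq_zero_iff]
  have h2 : (2 : ZMod p) ≠ 0 := by
    have : ((2 : ℕ) : ZMod p) ≠ 0 := by
      rw [Ne, ZMod.natCast_eq_zero_iff]
      intro h
      have := (Nat.prime_dvd_prime_iff_eq hp Nat.prime_two).1 h
      omega
    simpa using this
  have hi0 : i ≠ 0 := by rintro rfl; simp at hi
  have hset : {x : ZMod p | (Q : ZMod p) ^ 2 * x ^ 2 + 1 = 0} = {i / Q, -(i / Q)} := by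
    ext x
    simp only [Set.mem_ofPred_eq, Set.mem_insert_iff, Set.mem_singleton_iff]
    have : (Q : ZMod p) ^ 2 * x ^ 2 + 1 = (Q * x - i) * (Q * x + i) := by
      linear_combination -hi
    rw [this, mul_eq_zero, eq_div_iff hq, ← neg_div, eq_div_iff hq, sub_eq_zero,
      add_eq_zero_iff_eq_neg, mul_comm x]
  unfold rootCount
  have : Nat.card {x : ZMod p // (Q : ZMod p) ^ 2 * x ^ 2 + 1 = 0} =
      ({x : ZMod p | (Q : ZMod p) ^ 2 * x ^ 2 + 1 = 0} : Set (ZMod p)).ncard := rfl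
  rw [this, hset, Set.ncard_pair]
  intro h
  have : (2 : ZMod p) * (i / Q) = 0 := by linear_combination h
  rcases mul_eq_zero.1 this with h | h
  · exact h2 h
  · exact (div_ne_zero hi0 hq) h

theorem rootCount_prod (Q : ℕ) (S : Finset ℕ) (hS : ∀ p ∈ S, p.Prime ∧ p % 4 = 1 ∧ ¬ p ∣ Q) :
    rootCount Q (ZMod (∏ p ∈ S, p)) = 2 ^ S.card := by
  induction S using Finset.induction_on with
  | empty =>
    unfold rootCount
    rw [Finset.prod_empty, Finset.card_empty, pow_zero, Nat.card_eq_one_iff_unique]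
    have : Subsingleton (ZMod 1) := inferInstanceAs (Subsingleton (Fin 1))
    exact ⟨inferInstance, ⟨0, Subsingleton.elim _ _⟩⟩
  | insert p S hp ih =>
    have h1 := hS p (Finset.mem_insert_self _ _)
    have h2 : ∀ q ∈ S, q.Prime ∧ q % 4 = 1 ∧ ¬ q ∣ Q :=
      fun q hq => hS q (Finset.mem_insert_of_mem hq)
    rw [Finset.prod_insert hp, rootCount_mul, rootCount_prime h1.1 h1.2.1 h1.2.2, ih h2,
      Finset.card_insert_of_notMem hp, pow_succ, mul_comm]
    refine Nat.Coprime.prod_right fun q hq => ?_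
    exact (Nat.coprime_primes h1.1 (h2 q hq).1).2 fun h => hp (h ▸ hq)

/-- Each root modulo `d` is a residue class, which is met `L / d` times up to an error of one. -/
theorem abs_card_dvd_sub_le (Q a L : ℕ) {d : ℕ} (hd : 0 < d) :
    |(((Finset.Ico a (a + L)).filter fun t => d ∣ Q ^ 2 * t ^ 2 + 1).card : ℝ) -
      L * (rootCount Q (ZMod d) / d)| ≤ rootCount Q (ZMod d) := by
  have : NeZero d := ⟨hd.ne'⟩
  classical
  set Z : Finset (ZMod d) := Finset.univ.filter fun x => (Q : ZMod d) ^ 2 * x ^ 2 + 1 = 0 with hZ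
  have hcard : rootCount Q (ZMod d) = Z.card := by
    rw [rootCount, Nat.card_eq_fintype_card, Fintype.card_subtype]
  have hcount : ((Finset.Ico a (a + L)).filter fun t => d ∣ Q ^ 2 * t ^ 2 + 1).card =
      ∑ x ∈ Z, ((Finset.Ico a (a + L)).filter (· ≡ x.val [MOD d])).card := by
    rw [Finset.card_eq_sum_card_fiberwise (f := fun t : ℕ => (t : ZMod d)) (t := Z)]
    · refine Finset.sum_congr rfl fun x hx => ?_
      congr 1
      ext t
      simp only [Finset.mem_filter, Finset.mem_Ico]
      have hx' := (Finset.mem_filter.1 hx).2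
      rw [← ZMod.natCast_eq_natCast_iff, ZMod.natCast_val, ZMod.cast_id', id]
      constructor
      · rintro ⟨⟨h, -⟩, h'⟩; exact ⟨h, h'⟩
      · rintro ⟨h, h'⟩
        refine ⟨⟨h, ?_⟩, h'⟩
        rw [← ZMod.natCast_eq_zero_iff]
        push_cast
        rw [h', hx']
    · intro t ht
      have ht := (Finset.mem_filter.1 (Finset.mem_coe.1 ht)).2
      rw [← ZMod.natCast_eq_zero_iff] at ht
      simpa [hZ] using ht
  rw [hcount, hcard, Nat.cast_sum]
  have : (L : ℝ) * (Z.card / d) = ∑ x ∈ Z, (L : ℝ) / d := by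
    rw [Finset.sum_const, nsmul_eq_mul]; ring
  rw [this, ← Finset.sum_sub_distrib]
  refine (Finset.abs_sum_le_sum_abs _ _).trans ?_
  refine (Finset.sum_le_sum fun x _ => abs_card_filter_modEq_sub_le a L x.val hd).trans ?_
  simp

/-- The hypothesis `hN` of the sieve: the density is `2 / p` at each prime because `Q² t² + 1` has
exactly two roots there. -/
theorem abs_card_subset_primeFactors_sub_le (Q a L : ℕ) (S : Finset ℕ)
    (hS : ∀ p ∈ S, p.Prime ∧ p % 4 = 1 ∧ ¬ p ∣ Q) :
    |(((Finset.Ico a (a + L)).filter fun t => S ⊆ (Q ^ 2 * t ^ 2 + 1).primeFactors).card : ℝ) -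
      L * ∏ p ∈ S, (2 / (p : ℝ))| ≤ 2 ^ S.card := by
  have hpos : 0 < ∏ p ∈ S, p := Finset.prod_pos fun p hp => (hS p hp).1.pos
  have h := abs_card_dvd_sub_le Q a L hpos
  rw [rootCount_prod Q S hS] at h
  have e1 : ((Finset.Ico a (a + L)).filter fun t => S ⊆ (Q ^ 2 * t ^ 2 + 1).primeFactors) =
      (Finset.Ico a (a + L)).filter fun t => ∏ p ∈ S, p ∣ Q ^ 2 * t ^ 2 + 1 := by
    refine Finset.filter_congr fun t _ => ⟨fun hs => ?_, fun hd p hp => ?_⟩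
    · exact Finset.prod_primes_dvd _ (fun p hp => (hS p hp).1.prime)
        fun p hp => Nat.dvd_of_mem_primeFactors (hs hp)
    · exact Nat.mem_primeFactors.2 ⟨(hS p hp).1, (Finset.dvd_prod_of_mem _ hp).trans hd, by omega⟩
  rw [e1]
  push_cast at h
  rwa [Finset.prod_div_distrib, Finset.prod_const]

/-! ### Reciprocals of primes -/

/-- Chebyshev's argument: all these primes divide the primorial of `2 ^ (j + 1)`, which is at most
`4 ^ 2 ^ (j + 1)`. -/
theorem mul_card_primes_Ico_le (j : ℕ) :
    j * ((Finset.Ico (2 ^ j) (2 ^ (j + 1))).filter Nat.Prime).card ≤ 2 ^ (j + 2) := by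
  set s := (Finset.Ico (2 ^ j) (2 ^ (j + 1))).filter Nat.Prime
  have h1 : (2 ^ j) ^ s.card ≤ ∏ p ∈ s, p := by
    rw [← Finset.prod_const]
    exact Finset.prod_le_prod' fun p hp => (Finset.mem_Ico.1 (Finset.mem_filter.1 hp).1).1
  have h2 : ∏ p ∈ s, p ≤ primorial (2 ^ (j + 1)) := by
    refine Nat.le_of_dvd (primorial_pos _) (Finset.prod_primes_dvd _
      (fun p hp => (Finset.mem_filter.1 hp).2.prime) fun p hp => ?_)
    have := Finset.mem_filter.1 hp
    exact this.2.dvd_primorial_iff.2 (Finset.mem_Ico.1 this.1).2.le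
  have h3 := h1.trans (h2.trans (primorial_le_four_pow _))
  rw [← pow_mul, show (4 : ℕ) = 2 ^ 2 by norm_num, ← pow_mul] at h3
  have := (Nat.pow_le_pow_iff_right (by norm_num : 1 < 2)).1 h3
  calc _ ≤ _ := this
    _ = _ := by ring

theorem sum_inv_primes_dyadic_le {j : ℕ} (hj : 0 < j) :
    ∑ p ∈ (Finset.Ico (2 ^ j) (2 ^ (j + 1))).filter Nat.Prime, 1 / (p : ℝ) ≤ 4 / j := by
  calc _ ≤ ∑ p ∈ (Finset.Ico (2 ^ j) (2 ^ (j + 1))).filter Nat.Prime, 1 / (2 : ℝ) ^ j := by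
        refine Finset.sum_le_sum fun p hp => ?_
        have := (Finset.mem_Ico.1 (Finset.mem_filter.1 hp).1).1
        have : (2 : ℝ) ^ j ≤ p := by exact_mod_cast this
        gcongr
    _ = ((Finset.Ico (2 ^ j) (2 ^ (j + 1))).filter Nat.Prime).card / (2 : ℝ) ^ j := by
        rw [Finset.sum_const, nsmul_eq_mul]; ring
    _ ≤ 4 / j := by
        rw [div_le_div_iff₀ (by positivity) (by exact_mod_cast hj)]
        have := mul_card_primes_Ico_le j
        have : (j : ℝ) * ((Finset.Ico (2 ^ j) (2 ^ (j + 1))).filter Nat.Prime).card ≤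
          2 ^ (j + 2) := by exact_mod_cast this
        have e : (2 : ℝ) ^ (j + 2) = 4 * 2 ^ j := by ring
        linarith

/-- The range consists of `2 ^ i` dyadic intervals, each contributing at most `4 / 2 ^ i`. The bound
is uniform in `i`, so all blocks of the sieve have comparable density. -/
theorem sum_inv_primes_le (i : ℕ) :
    ∑ p ∈ (Finset.Ico (2 ^ 2 ^ i) (2 ^ 2 ^ (i + 1))).filter Nat.Prime, 1 / (p : ℝ) ≤ 4 := by
  rw [← Finset.sum_fiberwise_of_maps_to (g := fun p => Nat.log 2 p)
    (t := Finset.Ico (2 ^ i) (2 ^ (i + 1)))]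
  · calc _ ≤ ∑ j ∈ Finset.Ico (2 ^ i) (2 ^ (i + 1)), 4 / (2 : ℝ) ^ i := by
          refine Finset.sum_le_sum fun j hj => ?_
          have hj' := Finset.mem_Ico.1 hj
          have hj0 : 0 < j := lt_of_lt_of_le (by positivity) hj'.1
          calc _ ≤ ∑ p ∈ (Finset.Ico (2 ^ j) (2 ^ (j + 1))).filter Nat.Prime, 1 / (p : ℝ) := by
                refine Finset.sum_le_sum_of_subset_of_nonneg (fun p hp => ?_)
                  fun _ _ _ => by positivity
                simp only [Finset.mem_filter, Finset.mem_Ico] at hp ⊢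
                have hp0 : p ≠ 0 := hp.1.2.ne_zero
                refine ⟨⟨?_, ?_⟩, hp.1.2⟩
                · rw [← hp.2]; exact Nat.pow_log_le_self 2 hp0
                · rw [← hp.2]; exact Nat.lt_pow_succ_log_self (by norm_num) p
            _ ≤ 4 / j := sum_inv_primes_dyadic_le hj0
            _ ≤ _ := by
                have : (2 : ℝ) ^ i ≤ j := by exact_mod_cast hj'.1
                gcongr
      _ = 4 := by
          rw [Finset.sum_const, Nat.card_Ico, nsmul_eq_mul]
          have : 2 ^ (i + 1) - 2 ^ i = 2 ^ i := by rw [pow_succ]; omega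
          rw [this]
          push_cast
          field_simp
  · intro p hp
    simp only [Finset.mem_filter, Finset.mem_Ico] at hp
    have hp0 : p ≠ 0 := hp.2.ne_zero
    rw [Finset.mem_Ico]
    exact ⟨(Nat.le_log_iff_pow_le (by norm_num) hp0).2 hp.1.1,
      (Nat.log_lt_iff_lt_pow (by norm_num) hp0).2 hp.1.2⟩

/-! ### The sieving ranges and many rough values of `Q² t² + 1` -/

/-- The primes `p ≡ 1 mod 4` not dividing `Q` in `[2 ^ 2 ^ i, 2 ^ 2 ^ (i + 1))`. -/
def sieveRange (Q i : ℕ) : Finset ℕ :=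
  (Finset.Ico (2 ^ 2 ^ i) (2 ^ 2 ^ (i + 1))).filter fun p => p.Prime ∧ p % 4 = 1 ∧ ¬ p ∣ Q

theorem mem_sieveRange {Q i p : ℕ} : p ∈ sieveRange Q i ↔
    (2 ^ 2 ^ i ≤ p ∧ p < 2 ^ 2 ^ (i + 1)) ∧ p.Prime ∧ p % 4 = 1 ∧ ¬ p ∣ Q := by
  rw [sieveRange, Finset.mem_filter, Finset.mem_Ico]

theorem five_le_of_mem_sieveRange {Q i p : ℕ} (h : p ∈ sieveRange Q i) : 5 ≤ p := by
  obtain ⟨-, hp, h4, -⟩ := mem_sieveRange.1 h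
  have := hp.two_le
  omega

theorem disjoint_sieveRange (Q : ℕ) {i j : ℕ} (h : i ≠ j) :
    Disjoint (sieveRange Q i) (sieveRange Q j) := by
  wlog hij : i < j generalizing i j
  · exact (this h.symm (lt_of_le_of_ne (not_lt.1 hij) h.symm)).symm
  rw [Finset.disjoint_left]
  intro p h1 h2
  have a := (mem_sieveRange.1 h1).1.2
  have b := (mem_sieveRange.1 h2).1.1
  have : 2 ^ 2 ^ (i + 1) ≤ 2 ^ 2 ^ j :=
    Nat.pow_le_pow_right (by norm_num) (Nat.pow_le_pow_right (by norm_num) hij)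
  omega

theorem sum_sieveRange_le (Q i : ℕ) : ∑ p ∈ sieveRange Q i, 2 / (p : ℝ) ≤ 8 := by
  calc _ ≤ ∑ p ∈ (Finset.Ico (2 ^ 2 ^ i) (2 ^ 2 ^ (i + 1))).filter Nat.Prime, 2 / (p : ℝ) := by
        refine Finset.sum_le_sum_of_subset_of_nonneg (fun p hp => ?_) fun _ _ _ => by positivity
        rw [mem_sieveRange] at hp
        rw [Finset.mem_filter, Finset.mem_Ico]
        exact ⟨hp.1, hp.2.1⟩
    _ = 2 * ∑ p ∈ (Finset.Ico (2 ^ 2 ^ i) (2 ^ 2 ^ (i + 1))).filter Nat.Prime, 1 / (p : ℝ) := by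
        rw [Finset.mul_sum]
        exact Finset.sum_congr rfl fun p _ => by ring
    _ ≤ 8 := by linarith [sum_inv_primes_le i]

/-- The source of the exponent 24: `exp 2` is less than `2 ^ 3`, and `16 = 8 · 2`. -/
theorem exp_sixteen_le : Real.exp 16 ≤ 2 ^ 24 := by
  have h : Real.exp 2 ≤ 2 ^ 3 := by
    have e : Real.exp 2 = Real.exp 1 ^ 2 := by rw [← Real.exp_nat_mul]; norm_num
    have := Real.exp_one_lt_d9
    have h0 := Real.exp_pos 1
    rw [e]; nlinarith
  have e : Real.exp 16 = Real.exp 2 ^ 8 := by rw [← Real.exp_nat_mul]; norm_num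
  rw [e, show (2 : ℝ) ^ 24 = (2 ^ 3) ^ 8 by norm_num]
  gcongr

/-- `1 - x ≥ exp (-2x)` for `0 ≤ x ≤ 2/5`, which covers `x = 2 / p` as `p ≥ 5`; these `x` sum to at
most 8. -/
theorem le_prod_sieveRange (Q i : ℕ) :
    ((2 : ℝ) ^ 24)⁻¹ ≤ ∏ p ∈ sieveRange Q i, (1 - 2 / (p : ℝ)) := by
  calc ((2 : ℝ) ^ 24)⁻¹ ≤ Real.exp (-16) := by
        rw [Real.exp_neg]
        exact inv_anti₀ (Real.exp_pos _) exp_sixteen_le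
    _ ≤ Real.exp (∑ p ∈ sieveRange Q i, -2 * (2 / (p : ℝ))) := by
        rw [← Finset.mul_sum]
        gcongr
        linarith [sum_sieveRange_le Q i]
    _ = ∏ p ∈ sieveRange Q i, Real.exp (-2 * (2 / (p : ℝ))) := Real.exp_sum _ _
    _ ≤ _ := by
        refine Finset.prod_le_prod (fun _ _ => (Real.exp_pos _).le) fun p hp => ?_
        have h5 : (5 : ℝ) ≤ p := by exact_mod_cast five_le_of_mem_sieveRange hp
        set x := 2 / (p : ℝ) with hx
        have hx0 : 0 ≤ x := by positivity
        have hx1 : x ≤ 2 / 5 := by rw [hx]; gcongr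
        rw [neg_mul, Real.exp_neg, inv_le_comm₀ (Real.exp_pos _) (by linarith)]
        refine le_trans ?_ (Real.add_one_le_exp _)
        rw [inv_le_iff_one_le_mul₀ (by linarith)]
        nlinarith

theorem card_sieveRange_le (Q i : ℕ) :
    1 + 2 * ((sieveRange Q i).card : ℝ) ≤ 2 ^ 2 ^ (i + 2) := by
  have h1 : (sieveRange Q i).card ≤ 2 ^ 2 ^ (i + 1) - 2 ^ 2 ^ i := by
    rw [← Nat.card_Ico]; exact Finset.card_filter_le _ _
  have h2 : 1 ≤ 2 ^ 2 ^ i := Nat.one_le_two_pow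
  have h3 : 2 ≤ 2 ^ 2 ^ (i + 1) := by
    calc 2 = 2 ^ 1 := by norm_num
      _ ≤ _ := Nat.pow_le_pow_right (by norm_num) Nat.one_le_two_pow
  have h4 : 2 ^ 2 ^ (i + 2) = 2 ^ 2 ^ (i + 1) * 2 ^ 2 ^ (i + 1) := by
    rw [← pow_add]; congr 1; ring
  have : 1 + 2 * (sieveRange Q i).card ≤ 2 ^ 2 ^ (i + 2) := by
    rw [h4]
    have h5 : 2 * 2 ^ 2 ^ (i + 1) ≤ 2 ^ 2 ^ (i + 1) * 2 ^ 2 ^ (i + 1) := Nat.mul_le_mul_right _ h3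
    omega
  exact_mod_cast this

/-- The exponent of the total remainder. The truncation level rises only linearly from the largest
block down to smaller ones, while the logarithms of the primes halve, so the largest block
dominates. -/
theorem sum_weights_le (b r : ℕ) :
    ∑ i : Fin r, 2 ^ ((i : ℕ) + 2) * (b + 2 * (r - 1 - i) + 1) ≤ (4 * b + 12) * 2 ^ r := by
  rw [Fin.sum_univ_eq_sum_range (fun i => 2 ^ (i + 2) * (b + 2 * (r - 1 - i) + 1)) r]
  have h : ∀ r, ∑ i ∈ Finset.range r, 2 ^ i * (r - 1 - i) ≤ 2 ^ r ∧
      ∑ i ∈ Finset.range r, 2 ^ i ≤ 2 ^ r := by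
    intro r
    induction r with
    | zero => simp
    | succ r ih =>
      rw [Finset.sum_range_succ, Finset.sum_range_succ]
      have e : ∑ i ∈ Finset.range r, 2 ^ i * (r + 1 - 1 - i) =
          ∑ i ∈ Finset.range r, 2 ^ i * (r - 1 - i) + ∑ i ∈ Finset.range r, 2 ^ i := by
        rw [← Finset.sum_add_distrib]
        refine Finset.sum_congr rfl fun i hi => ?_
        have := Finset.mem_range.1 hi
        rw [show r + 1 - 1 - i = (r - 1 - i) + 1 by omega]; ring
      rw [e, pow_succ]
      have : r + 1 - 1 - r = 0 := by omega
      rw [this]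
      constructor <;> linarith [ih.1, ih.2]
  have e : ∑ i ∈ Finset.range r, 2 ^ (i + 2) * (b + 2 * (r - 1 - i) + 1) =
      (4 * b + 4) * ∑ i ∈ Finset.range r, 2 ^ i +
        8 * ∑ i ∈ Finset.range r, 2 ^ i * (r - 1 - i) := by
    rw [Finset.mul_sum, Finset.mul_sum, ← Finset.sum_add_distrib]
    exact Finset.sum_congr rfl fun i _ => by ring
  rw [e]
  nlinarith [h r, Nat.mul_le_mul_left (4 * b + 4) (h r).2]

/-- The rising truncation levels make the relative errors of the blocks summable, uniformly in the
number `r` of blocks. -/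
theorem sum_inv_two_pow_le (b r : ℕ) :
    ∑ i : Fin r, ((2 : ℝ) ^ (b + 2 * (r - 1 - i) + 1))⁻¹ ≤ 1 := by
  rw [Fin.sum_univ_eq_sum_range (fun i => ((2 : ℝ) ^ (b + 2 * (r - 1 - i) + 1))⁻¹) r]
  calc _ ≤ ∑ i ∈ Finset.range r, (2 : ℝ) ^ i / 2 ^ r := by
        refine Finset.sum_le_sum fun i hi => ?_
        have := Finset.mem_range.1 hi
        rw [inv_eq_one_div, div_le_div_iff₀ (by positivity) (by positivity), one_mul, ← pow_add]
        exact pow_le_pow_right₀ (by norm_num) (by omega)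
    _ = ((2 : ℝ) ^ r - 1) / 2 ^ r := by
        rw [← Finset.sum_div, geom_sum_eq (by norm_num)]; norm_num
    _ ≤ 1 := by rw [div_le_one (by positivity)]; linarith

/-- `n` has no prime factor below `z`. -/
def IsRough (z n : ℕ) : Prop := ∀ p < z, p.Prime → ¬ p ∣ n

-- A prime factor `p` of `Q² t² + 1` does not divide `Q`, so it is odd, and `-1` is a square modulo
-- `p`, so `p ≡ 1 mod 4`. Hence only the primes in the sieving ranges need to be removed.
open Classical in
theorem filter_disjoint_sieveRange_subset {Q : ℕ} (hQ : 2 ∣ Q) (r : ℕ) (Ω : Finset ℕ) :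
    (Ω.filter fun t => ∀ i : Fin r,
      Disjoint (sieveRange Q i) (Q ^ 2 * t ^ 2 + 1).primeFactors) ⊆
      Ω.filter fun t => IsRough (2 ^ 2 ^ r) (Q ^ 2 * t ^ 2 + 1) := by
  intro t ht
  rw [Finset.mem_filter] at ht ⊢
  refine ⟨ht.1, fun p hlt hp hd => ?_⟩
  have hQp : ¬ p ∣ Q := fun h => by
    have : p ∣ 1 := (Nat.dvd_add_right ((h.trans (dvd_pow_self Q two_ne_zero)).mul_right _)).1 hd
    exact hp.one_lt.ne' (Nat.dvd_one.1 this)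
  have h2 : p ≠ 2 := fun h => hQp (h ▸ hQ)
  have h4 : p % 4 = 1 := by
    have : Fact p.Prime := ⟨hp⟩
    have hs : IsSquare (-1 : ZMod p) := by
      refine ⟨Q * t, ?_⟩
      have := (ZMod.natCast_eq_zero_iff _ p).2 hd
      push_cast at this
      linear_combination -this
    have h3 := ZMod.exists_sq_eq_neg_one_iff.1 hs
    have := hp.eq_two_or_odd
    omega
  -- The block of `p` is the integer part of the iterated binary logarithm.
  obtain ⟨i, hi⟩ : ∃ i : Fin r, 2 ^ 2 ^ (i : ℕ) ≤ p ∧ p < 2 ^ 2 ^ ((i : ℕ) + 1) := by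
    have hl0 : Nat.log 2 p ≠ 0 := by
      have := (Nat.le_log_iff_pow_le (b := 2) (x := 1) (by norm_num) hp.ne_zero).2 (by
        have := hp.two_le; omega)
      omega
    refine ⟨⟨Nat.log 2 (Nat.log 2 p), ?_⟩, ?_, ?_⟩
    · rw [Nat.log_lt_iff_lt_pow (by norm_num) hl0,
        Nat.log_lt_iff_lt_pow (by norm_num) hp.ne_zero]
      exact hlt
    · exact (Nat.le_log_iff_pow_le (by norm_num) hp.ne_zero).1 (Nat.pow_log_le_self 2 hl0)
    · exact (Nat.log_lt_iff_lt_pow (by norm_num) hp.ne_zero).1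
        (Nat.lt_pow_succ_log_self (by norm_num) _)
  exact Finset.disjoint_left.1 (ht.2 i) (mem_sieveRange.2 ⟨hi, hp, h4, hQp⟩)
    (Nat.mem_primeFactors.2 ⟨hp, hd, by omega⟩)

theorem prod_card_sieveRange_le (Q b r : ℕ) :
    ∏ i : Fin r, (1 + 2 * ((sieveRange Q i).card : ℝ)) ^ (b + 2 * (r - 1 - i) + 1) ≤
      2 ^ ((4 * b + 12) * 2 ^ r) := by
  calc _ ≤ ∏ i : Fin r, (2 : ℝ) ^ (2 ^ ((i : ℕ) + 2) * (b + 2 * (r - 1 - i) + 1)) := by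
        refine Finset.prod_le_prod (fun _ _ => by positivity) fun i _ => ?_
        rw [pow_mul]
        gcongr
        exact card_sieveRange_le Q i
    _ = 2 ^ ∑ i : Fin r, 2 ^ ((i : ℕ) + 2) * (b + 2 * (r - 1 - i) + 1) :=
        Finset.prod_pow_eq_pow_sum _ _ _
    _ ≤ _ := pow_le_pow_right₀ (by norm_num) (sum_weights_le b r)

-- Each block has `∑ 2 / p ≤ 8`, so its first omitted term is at most `8 ^ n / n!`. Asking for `16 ^
-- n / n!` to be small gains the factor `2 ^ n` that makes these errors summable over the blocks.
-- The base level `2 * n₀` is even, as the sieve requires.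
open Classical in
theorem sieve_lower_bound {v : ℝ} (hv0 : 0 < v)
    (hV : ∀ Q i, v ≤ ∏ p ∈ sieveRange Q i, (1 - 2 / (p : ℝ))) {n₀ : ℕ}
    (hn₀ : ∀ n ≥ n₀, (16 : ℝ) ^ n / n.factorial ≤ v / 2) (T r Q : ℕ) (hQ : 2 ∣ Q) :
    T * v ^ r / 2 - (r + 1) * 2 ^ ((4 * (2 * n₀) + 12) * 2 ^ r) ≤
      (((Finset.Ico T (T + T)).filter fun t => IsRough (2 ^ 2 ^ r) (Q ^ 2 * t ^ 2 + 1)).card : ℝ) := by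
  obtain ⟨b, hb⟩ : ∃ b, b = 2 * n₀ := ⟨_, rfl⟩
  obtain ⟨U, hU⟩ : ∃ U : ℕ → Finset ℕ, U = fun t => (Q ^ 2 * t ^ 2 + 1).primeFactors := ⟨_, rfl⟩
  have hN : ∀ S : Finset ℕ, S ⊆ Finset.univ.biUnion (fun i : Fin r => sieveRange Q i) →
      |(((Finset.Ico T (T + T)).filter fun t => S ⊆ U t).card : ℝ) -
        T * ∏ p ∈ S, (2 / (p : ℝ))| ≤ 2 ^ S.card := by
    intro S hS
    have hS' : ∀ p ∈ S, p.Prime ∧ p % 4 = 1 ∧ ¬ p ∣ Q := fun p hp => by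
      obtain ⟨i, -, hi⟩ := Finset.mem_biUnion.1 (hS hp)
      exact (mem_sieveRange.1 hi).2
    rw [hU]
    exact abs_card_subset_primeFactors_sub_le Q T T S hS'
  have hg : ∀ i : Fin r, ∀ p ∈ sieveRange Q i, 0 ≤ 2 / (p : ℝ) ∧ 2 / (p : ℝ) ≤ 1 := by
    intro i p hp
    have : (5 : ℝ) ≤ p := by exact_mod_cast five_le_of_mem_sieveRange hp
    exact ⟨by positivity, by rw [div_le_one (by linarith)]; linarith⟩
  have hb' : ∀ i : Fin r, Even (b + 2 * (r - 1 - (i : ℕ))) := fun i => by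
    rw [hb]; exact (even_two_mul _).add (even_two_mul _)
  have hE : ∑ l : Fin r, esum (fun p => 2 / (p : ℝ)) (sieveRange Q l) (b + 2 * (r - 1 - l) + 1) ≤
      v / 2 := by
    calc _ ≤ ∑ i : Fin r, v / 2 * ((2 : ℝ) ^ (b + 2 * (r - 1 - i) + 1))⁻¹ := by
          refine Finset.sum_le_sum fun i _ => ?_
          set n := b + 2 * (r - 1 - (i : ℕ)) + 1 with hn
          refine (esum_le_pow_div_factorial (fun p _ => by positivity) n).trans ?_
          have h1 := hn₀ n (by omega)
          have h2 : (∑ p ∈ sieveRange Q i, 2 / (p : ℝ)) ^ n ≤ 8 ^ n := by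
            gcongr
            exact sum_sieveRange_le Q i
          calc _ ≤ (8 : ℝ) ^ n / n.factorial := by gcongr
            _ = (16 : ℝ) ^ n / n.factorial * (2 ^ n)⁻¹ := by
                rw [show (16 : ℝ) = 8 * 2 by norm_num, mul_pow]; field_simp
            _ ≤ _ := by gcongr
      _ = v / 2 * ∑ i : Fin r, ((2 : ℝ) ^ (b + 2 * (r - 1 - i) + 1))⁻¹ := by rw [Finset.mul_sum]
      _ ≤ v / 2 * 1 := by gcongr; exact sum_inv_two_pow_le b r
      _ = v / 2 := mul_one _
  have key := brun_hooley_half (Finset.Ico T (T + T)) U (T := (T : ℝ)) (Nat.cast_nonneg _)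
    (fun p => 2 / (p : ℝ)) (fun i : Fin r => sieveRange Q i)
    (fun i j h => disjoint_sieveRange Q fun h' => h (Fin.ext h')) hN
    (fun i => b + 2 * (r - 1 - i)) hb' hg hv0 (fun i => hV Q i) hE
  rw [Fintype.card_fin] at key
  have hcard : (((Finset.Ico T (T + T)).filter fun t => ∀ i : Fin r,
      Disjoint (sieveRange Q i) (U t)).card : ℝ) ≤
      ((Finset.Ico T (T + T)).filter fun t => IsRough (2 ^ 2 ^ r) (Q ^ 2 * t ^ 2 + 1)).card := by
    rw [hU]
    exact_mod_cast Finset.card_le_card (filter_disjoint_sieveRange_subset hQ r _)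
  refine le_trans ?_ ((key.trans (le_of_eq (by congr!))).trans hcard)
  rw [← hb]
  have := mul_le_mul_of_nonneg_left (prod_card_sieveRange_le Q b r)
    (by positivity : (0 : ℝ) ≤ (r : ℝ) + 1)
  linarith

open Classical in
/-- Many values of `Q² t² + 1` are free of small prime factors. -/
theorem exists_sieve_lower_bound : ∃ C₀ : ℕ, ∀ C ≥ C₀, ∀ T r Q : ℕ, 2 ∣ Q → T = 2 ^ (C * 2 ^ r) →
    (T : ℝ) / (4 * 2 ^ (24 * r)) ≤
      (((Finset.Ico T (T + T)).filter fun t => IsRough (2 ^ 2 ^ r) (Q ^ 2 * t ^ 2 + 1)).card : ℝ) := by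
  obtain ⟨v, hv⟩ : ∃ v : ℝ, v = ((2 : ℝ) ^ 24)⁻¹ := ⟨_, rfl⟩
  have hv0 : 0 < v := by rw [hv]; positivity
  obtain ⟨n₀, hn₀⟩ : ∃ n₀ : ℕ, ∀ n ≥ n₀, (16 : ℝ) ^ n / n.factorial ≤ v / 2 := by
    have := (FloorSemiring.tendsto_pow_div_factorial_atTop (16 : ℝ)).eventually
      (Iio_mem_nhds (half_pos hv0))
    obtain ⟨n₀, h⟩ := Filter.eventually_atTop.1 this
    exact ⟨n₀, fun n hn => (h n hn).le⟩
  -- The `27` leaves room for the factor `r + 1 ≤ 2 ^ 2 ^ r` and for the density `2 ^ (24 * r)` with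
  -- its constant.
  refine ⟨4 * (2 * n₀) + 12 + 27, fun C hC T r Q hQ hT => ?_⟩
  refine le_trans ?_ (sieve_lower_bound hv0 (fun Q i => hv ▸ le_prod_sieveRange Q i) hn₀ T r Q hQ)
  have hr1 : (r : ℝ) + 1 ≤ 2 ^ (2 ^ r) := by
    have h1 : r + 1 ≤ 2 ^ r := Nat.lt_two_pow_self
    have h2 : 2 ^ r ≤ 2 ^ 2 ^ r := Nat.lt_two_pow_self.le
    exact_mod_cast h1.trans h2
  have hTe : (T : ℝ) * v ^ r = T / 2 ^ (24 * r) := by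
    rw [hv, inv_pow, ← pow_mul]; rfl
  have hfin : ((r : ℝ) + 1) * 2 ^ ((4 * (2 * n₀) + 12) * 2 ^ r) ≤ T / 2 ^ (24 * r) / 4 := by
    rw [div_div, le_div_iff₀ (by positivity)]
    calc _ ≤ (2 : ℝ) ^ (2 ^ r) * 2 ^ ((4 * (2 * n₀) + 12) * 2 ^ r) * (2 ^ (24 * r) * 2 ^ 2) := by
          gcongr; norm_num
      _ = 2 ^ (2 ^ r + (4 * (2 * n₀) + 12) * 2 ^ r + (24 * r + 2)) := by
          rw [← pow_add, ← pow_add, ← pow_add]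
      _ ≤ 2 ^ (C * 2 ^ r) := by
          refine pow_le_pow_right₀ (by norm_num) ?_
          have h1 : r + 1 ≤ 2 ^ r := Nat.lt_two_pow_self
          have h3 := Nat.mul_le_mul_right (2 ^ r) hC
          nlinarith
      _ = T := by rw [hT]; push_cast; rfl
  rw [hTe]
  have e : (T : ℝ) / (4 * 2 ^ (24 * r)) = T / 2 ^ (24 * r) / 4 := by
    rw [div_div, mul_comm]
  rw [e]
  linarith

/-! ### The function `r₂` through Gaussian integers -/

/-- The Gaussian integers of norm `n`. -/
def gaussSphere (n : ℕ) : Set GaussianInt := {z | z.norm = n}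

theorem gaussNorm_eq (z : GaussianInt) : z.norm = z.re ^ 2 + z.im ^ 2 := by
  rw [Zsqrtd.norm_def]; ring

theorem finite_sphere (n : ℕ) : {v : Fin 2 → ℤ | normSq v = n}.Finite := by
  refine (Set.Finite.pi' (t := fun _ : Fin 2 => Set.Icc (-(n : ℤ)) n)
    fun _ => Set.finite_Icc _ _).subset ?_
  intro v hv
  simp only [normSq, Set.mem_ofPred_eq] at hv
  simp only [Set.mem_ofPred_eq, Fin.forall_fin_two, Set.mem_Icc]
  refine ⟨⟨?_, ?_⟩, ?_, ?_⟩ <;> nlinarith [sq_nonneg (v 0), sq_nonneg (v 1)]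

theorem r2_eq_ncard_gaussSphere (n : ℕ) : r2 n = (gaussSphere n).ncard := by
  unfold r2
  refine Set.ncard_congr (fun v _ => (⟨v 0, v 1⟩ : GaussianInt)) ?_ ?_ ?_
  · intro v hv
    simpa [gaussSphere, gaussNorm_eq, normSq] using hv
  · intro v w _ _ h
    have h0 := congrArg Zsqrtd.re h
    have h1 := congrArg Zsqrtd.im h
    funext i
    fin_cases i <;> assumption
  · intro z hz
    refine ⟨![z.re, z.im], ?_, ?_⟩
    · simpa [gaussSphere, gaussNorm_eq, normSq] using hz
    · ext <;> rfl

theorem finite_gaussSphere (n : ℕ) : (gaussSphere n).Finite := by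
  refine ((finite_sphere n).image fun v => (⟨v 0, v 1⟩ : GaussianInt)).subset ?_
  intro z hz
  refine ⟨![z.re, z.im], ?_, ?_⟩
  · simpa [gaussSphere, gaussNorm_eq, normSq] using hz
  · ext <;> rfl

theorem r2_le_of_surjOn {m n k : ℕ} (f : ℕ → GaussianInt → GaussianInt)
    (h : ∀ z ∈ gaussSphere n, ∃ i < k, ∃ w ∈ gaussSphere m, f i w = z) : r2 n ≤ k * r2 m := by
  rw [r2_eq_ncard_gaussSphere, r2_eq_ncard_gaussSphere]
  have hfin : ((Finset.range k : Set ℕ) ×ˢ gaussSphere m).Finite :=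
    (Finset.finite_toSet _).prod (finite_gaussSphere m)
  calc (gaussSphere n).ncard
      ≤ ((fun q : ℕ × GaussianInt => f q.1 q.2) ''
          ((Finset.range k : Set ℕ) ×ˢ gaussSphere m)).ncard := by
        refine Set.ncard_le_ncard (fun z hz => ?_) (hfin.image _)
        obtain ⟨i, hi, w, hw, rfl⟩ := h z hz
        exact ⟨(i, w), ⟨by simpa using hi, hw⟩, rfl⟩
    _ ≤ ((Finset.range k : Set ℕ) ×ˢ gaussSphere m).ncard := Set.ncard_image_le hfin
    _ = k * (gaussSphere m).ncard := by rw [Set.ncard_prod, Set.ncard_coe_finset, Finset.card_range]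

theorem natCast_prime_or_exists_norm_eq {p : ℕ} (hp : p.Prime) :
    Prime (p : GaussianInt) ∨ ∃ ϖ : GaussianInt, ϖ.norm = p := by
  have : Fact p.Prime := ⟨hp⟩
  by_cases h : Irreducible (p : GaussianInt)
  · exact Or.inl h.prime
  · obtain ⟨a, b, hab⟩ := GaussianInt.sq_add_sq_of_nat_prime_of_not_irreducible p h
    refine Or.inr ⟨⟨a, b⟩, ?_⟩
    rw [gaussNorm_eq, ← hab]
    push_cast; ring

theorem prime_of_norm_prime {ϖ : GaussianInt} {p : ℕ} (hp : p.Prime) (h : ϖ.norm = p) :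
    Prime ϖ := by
  refine Irreducible.prime ⟨fun hu => ?_, fun a b hab => ?_⟩
  · have := Zsqrtd.norm_eq_one_iff.2 hu
    rw [h, Int.natAbs_natCast] at this
    exact hp.one_lt.ne' this
  · have hn : a.norm.natAbs * b.norm.natAbs = p := by
      rw [← Int.natAbs_mul, ← Zsqrtd.norm_mul, ← hab, h, Int.natAbs_natCast]
    rcases Nat.prime_mul_iff.1 (hn ▸ hp) with h | h
    · exact Or.inr (Zsqrtd.norm_eq_one_iff.1 h.2)
    · exact Or.inl (Zsqrtd.norm_eq_one_iff.1 h.2)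

theorem norm_star_eq (z : GaussianInt) : (star z).norm = z.norm := by
  rw [gaussNorm_eq, gaussNorm_eq]; simp

theorem norm_pow_eq (z : GaussianInt) (k : ℕ) : (z ^ k).norm = z.norm ^ k :=
  map_pow Zsqrtd.normMonoidHom z k

/-- If `p` stays prime in `ℤ[i]`, it divides every element whose norm it divides, so `z` is `p ^ (k
/ 2)` times an element of norm `m`. Otherwise `p` is the norm of some `ϖ`, and `z = ϖ ^ i * star ϖ ^
(k - i) * w` with `k + 1` possible exponents `i`. -/
theorem r2_prime_pow_mul_le {p : ℕ} (hp : p.Prime) (k : ℕ) {m : ℕ} (hm : ¬ p ∣ m) :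
    r2 (p ^ k * m) ≤ (k + 1) * r2 m := by
  have hp0 : (p : ℤ) ≠ 0 := by exact_mod_cast hp.ne_zero
  rcases natCast_prime_or_exists_norm_eq hp with h | ⟨ϖ, hϖ⟩
  · have key : ∀ k, ∀ z ∈ gaussSphere (p ^ k * m), ∃ w ∈ gaussSphere m,
        (p : GaussianInt) ^ (k / 2) * w = z := by
      intro k
      induction k using Nat.strong_induction_on with
      | _ k ih =>
        intro z hz
        rcases Nat.eq_zero_or_pos k with rfl | hk
        · exact ⟨z, by simpa [gaussSphere] using hz, by simp⟩
        have hz' : z.norm = ((p ^ k * m : ℕ) : ℤ) := hz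
        have hdvd : (p : GaussianInt) ∣ z * star z := by
          have : (z * star z) = ((z.norm : ℤ) : GaussianInt) := (Zsqrtd.norm_eq_mul_conj z).symm
          rw [this, hz', Int.cast_natCast]
          exact Nat.cast_dvd_cast ((dvd_pow_self p hk.ne').mul_right m)
        have hpz : (p : GaussianInt) ∣ z := by
          rcases h.dvd_or_dvd hdvd with h1 | h1
          · exact h1
          · obtain ⟨w, hw⟩ := h1
            refine ⟨star w, ?_⟩
            have := congrArg star hw
            rw [star_star, star_mul, star_natCast] at this
            rw [this, mul_comm]
        obtain ⟨w, rfl⟩ := hpz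
        have hw : (p : ℤ) ^ 2 * w.norm = (p : ℤ) ^ k * m := by
          rw [Zsqrtd.norm_mul, Zsqrtd.norm_natCast] at hz'
          push_cast at hz'
          linarith
        rcases Nat.lt_or_ge k 2 with h2 | h2
        · have hk1 : k = 1 := by omega
          subst hk1
          -- An inert prime cannot divide a norm exactly once.
          exfalso
          apply hm
          have : (p : ℤ) * w.norm = m := by
            apply mul_left_cancel₀ hp0
            linarith
          have : (p : ℤ) ∣ m := ⟨_, this.symm⟩
          exact_mod_cast this
        · obtain ⟨k, rfl⟩ := Nat.exists_eq_add_of_le' h2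
          have hw' : w.norm = ((p ^ k * m : ℕ) : ℤ) := by
            apply mul_left_cancel₀ (pow_ne_zero 2 hp0)
            rw [hw]; push_cast; ring
          obtain ⟨u, hu, rfl⟩ := ih k (by omega) w hw'
          refine ⟨u, hu, ?_⟩
          rw [show (k + 2) / 2 = k / 2 + 1 by omega]
          ring
    refine r2_le_of_surjOn (fun _ w => (p : GaussianInt) ^ (k / 2) * w) fun z hz => ?_
    obtain ⟨w, hw, rfl⟩ := key k z hz
    exact ⟨0, by omega, w, hw, rfl⟩
  · have hpr := prime_of_norm_prime hp hϖ
    have hfac : ϖ * star ϖ = (p : GaussianInt) := by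
      rw [← Zsqrtd.norm_eq_mul_conj, hϖ, Int.cast_natCast]
    refine r2_le_of_surjOn (fun i w => ϖ ^ i * star ϖ ^ (k - i) * w) ?_
    clear hm
    induction k with
    | zero =>
      intro z hz
      exact ⟨0, by omega, z, by simpa [gaussSphere] using hz, by simp⟩
    | succ k ih =>
      intro z hz
      have hz' : z.norm = ((p ^ (k + 1) * m : ℕ) : ℤ) := hz
      have hdvd : ϖ ∣ z * star z := by
        have : (z * star z) = ((z.norm : ℤ) : GaussianInt) := (Zsqrtd.norm_eq_mul_conj z).symm
        rw [this, hz', Int.cast_natCast]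
        refine (Dvd.intro _ hfac).trans (Nat.cast_dvd_cast ?_)
        exact (dvd_pow_self p (Nat.succ_ne_zero k)).mul_right m
      have hcase : ∀ ρ w : GaussianInt, ρ.norm = p → z = ρ * w → w ∈ gaussSphere (p ^ k * m) := by
        intro ρ w hρ hw
        show w.norm = ((p ^ k * m : ℕ) : ℤ)
        apply mul_left_cancel₀ hp0
        rw [hw, Zsqrtd.norm_mul, hρ] at hz'
        rw [hz']; push_cast; ring
      rcases hpr.dvd_or_dvd hdvd with ⟨w, hw⟩ | ⟨w, hw⟩
      · obtain ⟨i, hi, u, hu, rfl⟩ := ih w (hcase ϖ w hϖ hw)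
        refine ⟨i + 1, by omega, u, hu, ?_⟩
        rw [hw, Nat.add_sub_add_right]; ring
      · have hw' : z = star ϖ * star w := by
          rw [← star_star z, hw, star_mul, mul_comm]
        obtain ⟨i, hi, u, hu, hiu⟩ := ih (star w) (hcase (star ϖ) _ (by rw [norm_star_eq, hϖ]) hw')
        refine ⟨i, by omega, u, hu, ?_⟩
        rw [hw', ← hiu, show k + 1 - i = k - i + 1 by omega]; ring

theorem r2_one_le : r2 1 ≤ 4 := by
  have : {v : Fin 2 → ℤ | normSq v = (1 : ℕ)} ⊆
      (({![1, 0], ![-1, 0], ![0, 1], ![0, -1]} : Finset (Fin 2 → ℤ)) : Set (Fin 2 → ℤ)) := by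
    intro v hv
    have hv : v 0 ^ 2 + v 1 ^ 2 = 1 := by simpa [normSq] using hv
    have h0 : v 0 ≤ 1 ∧ -1 ≤ v 0 := by constructor <;> nlinarith [sq_nonneg (v 1)]
    have h1 : v 1 ≤ 1 ∧ -1 ≤ v 1 := by constructor <;> nlinarith [sq_nonneg (v 0)]
    have hv2 : v = ![v 0, v 1] := by funext i; fin_cases i <;> rfl
    generalize v 0 = x at *
    generalize v 1 = y at *
    obtain ⟨h0, h0'⟩ := h0
    obtain ⟨h1, h1'⟩ := h1
    rw [hv2]
    interval_cases x <;> interval_cases y <;> simp_all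
  calc r2 1 ≤ _ := Set.ncard_le_ncard this (Finset.finite_toSet _)
    _ ≤ 4 := by rw [Set.ncard_coe_finset]; exact Finset.card_le_four

/-- The divisor bound for `r₂`. -/
theorem r2_le_four_mul_card_divisors {n : ℕ} (hn : n ≠ 0) : r2 n ≤ 4 * n.divisors.card := by
  induction n using Nat.strong_induction_on with
  | _ n ih =>
    rcases eq_or_ne n 1 with rfl | h1
    · simpa using r2_one_le
    have hp := Nat.minFac_prime h1
    set p := n.minFac
    obtain ⟨k, m, hm, hnm⟩ := Nat.exists_eq_pow_mul_and_not_dvd hn p hp.ne_one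
    have hm0 : m ≠ 0 := by rintro rfl; simp at hm
    have hk : k ≠ 0 := by
      rintro rfl
      apply hm
      have : p ∣ n := Nat.minFac_dvd n
      rwa [hnm, pow_zero, one_mul] at this
    have hlt : m < n := by
      rw [hnm]
      have : 1 < p ^ k := Nat.one_lt_pow hk hp.one_lt
      nlinarith [Nat.pos_of_ne_zero hm0]
    have hcop : (p ^ k).Coprime m := Nat.Coprime.pow_left k ((Nat.Prime.coprime_iff_not_dvd hp).2 hm)
    rw [hnm, hcop.card_divisors_mul, Nat.divisors_prime_pow hp, Finset.card_map, Finset.card_range]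
    calc _ ≤ (k + 1) * r2 m := r2_prime_pow_mul_le hp k hm
      _ ≤ (k + 1) * (4 * m.divisors.card) := Nat.mul_le_mul_left _ (ih m hlt hm0)
      _ = _ := by ring

/-- For `p = ϖ * star ϖ` the elements `ϖ ^ i * star ϖ ^ (k - i) * w` are distinct: `ϖ` divides
neither `star ϖ`, as it would then divide `2 a` for its real part `a`, nor any `w` of norm `m`. -/
theorem mul_r2_le_r2_prime_pow_mul {p : ℕ} (hp : p.Prime) (h4 : p % 4 = 1) (k : ℕ) {m : ℕ}
    (hm : ¬ p ∣ m) : (k + 1) * r2 m ≤ r2 (p ^ k * m) := by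
  have : Fact p.Prime := ⟨hp⟩
  obtain ⟨a, b, hab⟩ := Nat.Prime.sq_add_sq (p := p) (by omega)
  set ϖ : GaussianInt := ⟨a, b⟩ with hϖd
  have hϖ : ϖ.norm = p := by rw [gaussNorm_eq, ← hab]; push_cast; ring
  have hpr := prime_of_norm_prime hp hϖ
  have hϖ0 : ϖ ≠ 0 := hpr.ne_zero
  have hs0 : star ϖ ≠ 0 := fun h => hϖ0 (by simpa using h)
  have hns : ¬ ϖ ∣ star ϖ := by
    intro h
    have h1 : ϖ ∣ ((2 * a : ℕ) : GaussianInt) := by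
      have : ((2 * a : ℕ) : GaussianInt) = ϖ + star ϖ := by
        ext
        · simp [hϖd]; ring
        · simp [hϖd]
      rw [this]
      exact dvd_add dvd_rfl h
    obtain ⟨w, hw⟩ := h1
    have h2 := congrArg Zsqrtd.norm hw
    rw [Zsqrtd.norm_natCast, Zsqrtd.norm_mul, hϖ] at h2
    have h3 : (p : ℤ) ∣ ((2 * a * (2 * a) : ℕ) : ℤ) := ⟨w.norm, by rw [← h2]; push_cast; ring⟩
    have h4' : p ∣ 2 * a * (2 * a) := by exact_mod_cast h3
    have h5 : p ∣ 2 * a := by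
      rcases hp.dvd_mul.1 h4' with h | h <;> exact h
    have h6 : p ∣ a := by
      rcases hp.dvd_mul.1 h5 with h | h
      · have := Nat.le_of_dvd (by norm_num) h
        have := hp.two_le
        have : p = 2 := by omega
        omega
      · exact h
    rcases Nat.eq_zero_or_pos a with ha | ha
    · have hb : b * b = p := by rw [← hab, ha]; ring
      have : b ∣ p := ⟨b, hb.symm⟩
      rcases (Nat.dvd_prime hp).1 this with h | h
      · rw [h] at hb; exact hp.one_lt.ne (by omega)
      · rw [h] at hb; nlinarith [hp.one_lt]
    · have := Nat.le_of_dvd ha h6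
      nlinarith [hp.one_lt]
  have hnw : ∀ w ∈ gaussSphere m, ¬ ϖ ∣ w := by
    rintro w hw ⟨u, rfl⟩
    apply hm
    have hw' : (ϖ * u).norm = (m : ℤ) := hw
    rw [Zsqrtd.norm_mul, hϖ] at hw'
    have : (p : ℤ) ∣ m := ⟨_, hw'.symm⟩
    exact_mod_cast this
  rw [r2_eq_ncard_gaussSphere, r2_eq_ncard_gaussSphere]
  have hcard : (k + 1) * (gaussSphere m).ncard =
      ((Finset.range (k + 1) : Set ℕ) ×ˢ gaussSphere m).ncard := by
    rw [Set.ncard_prod, Set.ncard_coe_finset, Finset.card_range]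
  rw [hcard]
  have hlt : ∀ i j : ℕ, i ≤ k → j ≤ k → i < j → ∀ w w', w ∈ gaussSphere m →
      ϖ ^ i * star ϖ ^ (k - i) * w ≠ ϖ ^ j * star ϖ ^ (k - j) * w' := by
    intro i j hi hj hij w w' hw h
    obtain ⟨e, rfl⟩ := Nat.exists_eq_add_of_lt hij
    have e1 : k - i = (k - (i + e + 1)) + (e + 1) := by omega
    rw [e1] at h
    have h' : ϖ ^ i * star ϖ ^ (k - (i + e + 1)) * (star ϖ ^ (e + 1) * w) =
        ϖ ^ i * star ϖ ^ (k - (i + e + 1)) * (ϖ ^ (e + 1) * w') := by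
      linear_combination h
    have h2 := mul_left_cancel₀ (mul_ne_zero (pow_ne_zero _ hϖ0) (pow_ne_zero _ hs0)) h'
    have h3 : ϖ ∣ star ϖ ^ (e + 1) * w := by
      rw [h2]; exact (dvd_pow_self ϖ (Nat.succ_ne_zero e)).mul_right _
    rcases hpr.dvd_or_dvd h3 with h | h
    · exact hns (hpr.dvd_of_dvd_pow h)
    · exact hnw w hw h
  refine Set.ncard_le_ncard_of_injOn (fun q : ℕ × GaussianInt => ϖ ^ q.1 * star ϖ ^ (k - q.1) * q.2)
    ?_ ?_ (finite_gaussSphere _)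
  · rintro ⟨i, w⟩ ⟨hi, hw⟩
    have hi : i ≤ k := by simpa [Nat.lt_succ_iff] using hi
    have hw : w.norm = m := hw
    show (ϖ ^ i * star ϖ ^ (k - i) * w).norm = ((p ^ k * m : ℕ) : ℤ)
    rw [Zsqrtd.norm_mul, Zsqrtd.norm_mul, norm_pow_eq, norm_pow_eq, norm_star_eq, hϖ, hw, ← pow_add,
      Nat.add_sub_cancel' hi]
    push_cast; ring
  · rintro ⟨i, w⟩ ⟨hi, hw⟩ ⟨j, w'⟩ ⟨hj, hw'⟩ h
    have hi : i ≤ k := by simpa [Nat.lt_succ_iff] using hi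
    have hj : j ≤ k := by simpa [Nat.lt_succ_iff] using hj
    simp only at h
    rcases lt_trichotomy i j with hij | rfl | hij
    · exact absurd h (hlt i j hi hj hij w w' hw)
    · rw [mul_left_cancel₀ (mul_ne_zero (pow_ne_zero _ hϖ0) (pow_ne_zero _ hs0)) h]
    · exact absurd h.symm (hlt j i hj hi hij w' w hw')

theorem r2_le_r2_mul_sq (n : ℕ) {s : ℕ} (hs : 0 < s) : r2 n ≤ r2 (n * s ^ 2) := by
  rw [r2_eq_ncard_gaussSphere, r2_eq_ncard_gaussSphere]
  refine Set.ncard_le_ncard_of_injOn (fun z => (s : GaussianInt) * z) ?_ ?_ (finite_gaussSphere _)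
  · intro z hz
    have hz : z.norm = n := hz
    show ((s : GaussianInt) * z).norm = ((n * s ^ 2 : ℕ) : ℤ)
    rw [Zsqrtd.norm_mul, Zsqrtd.norm_natCast, hz]
    push_cast; ring
  · intro z _ w _ h
    exact mul_left_cancel₀ (by exact_mod_cast hs.ne') h

theorem r2_pos_of_sq_add_sq (a b : ℕ) : 0 < r2 (a ^ 2 + b ^ 2) := by
  refine (Set.ncard_pos (finite_sphere _)).2 ⟨![a, b], ?_⟩
  simp [normSq]

theorem pow_card_le_r2_prod (S : Finset ℕ) (hS : ∀ p ∈ S, p.Prime ∧ p % 4 = 1) (k : ℕ) :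
    (k + 1) ^ S.card ≤ r2 (∏ p ∈ S, p ^ k) := by
  induction S using Finset.induction_on with
  | empty =>
    have h : 0 < r2 (1 ^ 2 + 0 ^ 2) := r2_pos_of_sq_add_sq 1 0
    simp only [Finset.card_empty, pow_zero, Finset.prod_empty]
    exact h
  | insert p S hp ih =>
    have h1 := hS p (Finset.mem_insert_self _ _)
    have h2 : ∀ q ∈ S, q.Prime ∧ q % 4 = 1 := fun q hq => hS q (Finset.mem_insert_of_mem hq)
    rw [Finset.prod_insert hp, Finset.card_insert_of_notMem hp, pow_succ, mul_comm]
    refine (Nat.mul_le_mul_left _ (ih h2)).trans (mul_r2_le_r2_prime_pow_mul h1.1 h1.2 k ?_)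
    intro hd
    obtain ⟨q, hq, hpq⟩ := (h1.1.prime.dvd_finsetProd_iff _).1 hd
    have := (Nat.prime_dvd_prime_iff_eq h1.1 (h2 q hq).1).1 (h1.1.dvd_of_dvd_pow hpq)
    exact hp (this ▸ hq)

/-- The squares of multiples of a suitable `Q` have many representations. -/
theorem exists_base (m : ℕ) : ∃ q : ℕ, 0 < q ∧ ∀ k t : ℕ, 0 < t →
    (2 * k + 1) ^ m ≤ r2 (((2 * q) ^ k * t) ^ 2) := by
  have hinf : {p : ℕ | p.Prime ∧ p % 4 = 1}.Infinite := by
    refine Set.infinite_of_not_bddAbove ?_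
    rintro ⟨B, hB⟩
    obtain ⟨p, hp, hlt, hmod⟩ := Nat.exists_prime_gt_modEq_one B (k := 4) (by norm_num)
    exact absurd (hB ⟨hp, hmod⟩) (not_le.2 hlt)
  obtain ⟨S, hS, hcard⟩ := hinf.exists_subset_card_eq m
  have hS' : ∀ p ∈ S, p.Prime ∧ p % 4 = 1 := fun p hp => hS hp
  have hq : 0 < ∏ p ∈ S, p := Finset.prod_pos fun p hp => (hS' p hp).1.pos
  refine ⟨∏ p ∈ S, p, hq, fun k t ht => ?_⟩
  have h1 := pow_card_le_r2_prod S hS' (2 * k)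
  rw [hcard, Finset.prod_pow] at h1
  refine h1.trans ?_
  -- The powers of 2 and the factor `t` only scale the lattice points, so no representation is lost.
  -- The 2 is present because the sieve needs an even `Q`.
  have h2 := r2_le_r2_mul_sq ((∏ p ∈ S, p) ^ (2 * k)) (s := 2 ^ k * t) (by positivity)
  refine h2.trans (le_of_eq ?_)
  congr 1
  rw [mul_pow, mul_pow, mul_pow, mul_pow, pow_mul']
  ring

/-- A point of the circle is determined by its first coordinate and the sign of the second. This
crude bound is enough for the convergence of the spectral sums. -/
theorem r2_le_sqrt (n : ℕ) : r2 n ≤ 2 * (2 * n.sqrt + 1) := by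
  have h : ∀ v : Fin 2 → ℤ, normSq v = n → v 0 ∈ Finset.Icc (-(n.sqrt : ℤ)) n.sqrt := by
    intro v hv
    have h1 : (v 0).natAbs ^ 2 ≤ n := by
      have : ((v 0).natAbs : ℤ) ^ 2 ≤ n := by
        rw [Int.natAbs_sq, ← hv, normSq]; nlinarith [sq_nonneg (v 1)]
      exact_mod_cast this
    have h2 := Nat.le_sqrt'.2 h1
    rw [Finset.mem_Icc]
    omega
  unfold r2
  calc _ ≤ ((Finset.Icc (-(n.sqrt : ℤ)) n.sqrt ×ˢ (Finset.univ : Finset Bool) :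
        Finset (ℤ × Bool)) : Set (ℤ × Bool)).ncard := by
        refine Set.ncard_le_ncard_of_injOn (fun v => (v 0, decide (0 ≤ v 1))) ?_ ?_
          (Finset.finite_toSet _)
        · intro v hv
          exact Finset.mem_coe.2 (Finset.mem_product.2 ⟨h v hv, Finset.mem_univ _⟩)
        · intro v hv w hw hvw
          simp only [Prod.mk.injEq, decide_eq_decide] at hvw
          have hv : v 0 ^ 2 + v 1 ^ 2 = n := hv
          have hw : w 0 ^ 2 + w 1 ^ 2 = n := hw
          have hsq : v 1 ^ 2 = w 1 ^ 2 := by rw [hvw.1] at hv; linarith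
          have h1 : v 1 = w 1 := by
            rcases sq_eq_sq_iff_eq_or_eq_neg.1 hsq with h | h
            · exact h
            · have := hvw.2; omega
          funext i
          fin_cases i
          · exact hvw.1
          · exact h1
    _ = 2 * (2 * n.sqrt + 1) := by
        rw [Set.ncard_coe_finset, Finset.card_product, Int.card_Icc, Finset.card_univ,
          Fintype.card_bool]
        omega

/-! ### Divisor sums -/

theorem card_divisors_mul_le (a b : ℕ) :
    (a * b).divisors.card ≤ a.divisors.card * b.divisors.card := by
  rw [Nat.divisors_mul]
  exact Finset.card_mul_le

/-- When two factorizations are multiplied, the remainders `s` and `s'` merge if their product is at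
most `D`. If not, one of them exceeds the square root of `D` and becomes a block of its own. -/
theorem exists_factorization_blocks {D : ℕ} (hD : 1 ≤ D) {n : ℕ} (hn : n ≠ 0) :
    ∃ (s : ℕ) (l : List ℕ), n = s * l.prod ∧ 1 ≤ s ∧ s ≤ D ∧
      ∀ m ∈ l, D < m ^ 2 ∧ (m.Prime ∨ m ≤ D) := by
  induction n using Nat.recOnMul with
  | zero => exact absurd rfl hn
  | one => exact ⟨1, [], by simp, le_rfl, hD, by simp⟩
  | prime p hp =>
    by_cases h : p ≤ D
    · exact ⟨p, [], by simp, hp.one_lt.le, h, by simp⟩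
    · refine ⟨1, [p], by simp, le_rfl, hD, ?_⟩
      intro m hm
      rw [List.mem_singleton] at hm
      subst hm
      exact ⟨by nlinarith, Or.inl hp⟩
  | mul a b iha ihb =>
    obtain ⟨s, l, h1, h2, h3, h4⟩ := iha (left_ne_zero_of_mul hn)
    obtain ⟨s', l', h1', h2', h3', h4'⟩ := ihb (right_ne_zero_of_mul hn)
    have hl : ∀ m ∈ l ++ l', D < m ^ 2 ∧ (m.Prime ∨ m ≤ D) := by
      intro m hm
      rcases List.mem_append.1 hm with h | h
      · exact h4 m h
      · exact h4' m h
    have hab : a * b = s * s' * (l ++ l').prod := by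
      rw [h1, h1', List.prod_append]; ring
    by_cases hss : s * s' ≤ D
    · exact ⟨s * s', l ++ l', hab, Nat.mul_pos h2 h2', hss, hl⟩
    · push Not at hss
      have : D < s ^ 2 ∨ D < s' ^ 2 := by
        by_contra hcon
        push Not at hcon
        rcases le_total s s' with h | h <;> nlinarith
      rcases this with h | h
      · refine ⟨s', s :: (l ++ l'), ?_, h2', h3', ?_⟩
        · rw [hab, List.prod_cons]; ring
        · intro m hm
          rcases List.mem_cons.1 hm with rfl | hm
          · exact ⟨h, Or.inr h3⟩
          · exact hl m hm
      · refine ⟨s, s' :: (l ++ l'), ?_, h2, h3, ?_⟩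
        · rw [hab, List.prod_cons]; ring
        · intro m hm
          rcases List.mem_cons.1 hm with rfl | hm
          · exact ⟨h, Or.inr h3'⟩
          · exact hl m hm

/-- The number of divisors is controlled by that of the small divisors. -/
theorem card_divisors_le_sum {D e n : ℕ} (hD : 2 ≤ D) (hn : n ≠ 0) (hne : n ≤ D ^ e) :
    n.divisors.card ≤ 2 ^ (2 * e + 1) *
      ∑ d ∈ Finset.Icc 1 D with d ∣ n, d.divisors.card ^ (2 * e + 1) := by
  obtain ⟨s, l, h1, h2, h3, h4⟩ := exists_factorization_blocks (by omega : 1 ≤ D) hn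
  -- Every block exceeds the square root of `D`.
  have hlen : l.length ≤ 2 * e := by
    have a1 : ∀ l : List ℕ, (∀ m ∈ l, D < m ^ 2 ∧ (m.Prime ∨ m ≤ D)) →
        D ^ l.length ≤ l.prod ^ 2 := by
      intro l
      induction l with
      | nil => simp
      | cons m l ih =>
        intro h
        rw [List.length_cons, List.prod_cons, pow_succ, mul_pow, mul_comm]
        exact Nat.mul_le_mul (h m List.mem_cons_self).1.le
          (ih fun m' hm' => h m' (List.mem_cons_of_mem _ hm'))
    have a2 : l.prod ≤ n := by rw [h1]; exact Nat.le_mul_of_pos_left _ h2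
    have a3 : D ^ l.length ≤ D ^ (2 * e) := by
      calc _ ≤ l.prod ^ 2 := a1 l h4
        _ ≤ (D ^ e) ^ 2 := Nat.pow_le_pow_left (a2.trans hne) 2
        _ = _ := by rw [← pow_mul, mul_comm]
    exact (Nat.pow_le_pow_iff_right (by omega)).1 a3
  set F := (Finset.Icc 1 D).filter (· ∣ n) with hF
  have hFne : F.Nonempty := ⟨1, by simp [hF]; omega⟩
  -- The divisor up to `D` with the most divisors dominates the remainder and all blocks up to `D`;
  -- the other blocks are primes and have two divisors.
  obtain ⟨d, hd, hmax⟩ := Finset.exists_max_image F (fun d => d.divisors.card) hFne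
  have hd1 : 1 ≤ d.divisors.card := by
    have : d ≠ 0 := by
      have := (Finset.mem_Icc.1 (Finset.mem_filter.1 hd).1).1; omega
    exact Finset.card_pos.2 ⟨1, Nat.one_mem_divisors.2 this⟩
  have hbl : ∀ m, m ∣ n → 1 ≤ m → m ≤ D → m.divisors.card ≤ d.divisors.card := fun m hm h h' =>
    hmax m (Finset.mem_filter.2 ⟨Finset.mem_Icc.2 ⟨h, h'⟩, hm⟩)
  have a4 : ∀ l : List ℕ, l.prod ∣ n → (∀ m ∈ l, D < m ^ 2 ∧ (m.Prime ∨ m ≤ D)) →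
      l.prod.divisors.card ≤ (2 * d.divisors.card) ^ l.length := by
    intro l
    induction l with
    | nil => simp
    | cons m l ih =>
      intro hdv h
      rw [List.prod_cons] at hdv ⊢
      rw [List.length_cons, pow_succ, mul_comm (_ ^ _)]
      refine (card_divisors_mul_le _ _).trans (Nat.mul_le_mul ?_
        (ih (dvd_of_mul_left_dvd hdv) fun m' hm' => h m' (List.mem_cons_of_mem _ hm')))
      have hm := h m List.mem_cons_self
      rcases hm.2 with hp | hle
      · rw [hp.divisors, Finset.card_pair hp.one_lt.ne]; omega
      · have hm1 : 1 ≤ m := by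
          rcases Nat.eq_zero_or_pos m with rfl | h0
          · simp at hm
          · exact h0
        have := hbl m (dvd_of_mul_right_dvd hdv) hm1 hle
        omega
  calc n.divisors.card ≤ s.divisors.card * l.prod.divisors.card := by
        rw [h1]; exact card_divisors_mul_le _ _
    _ ≤ (2 * d.divisors.card) * (2 * d.divisors.card) ^ (2 * e) := by
        refine Nat.mul_le_mul ?_ ((a4 l (Dvd.intro_left s h1.symm) h4).trans
          (Nat.pow_le_pow_right (by omega) hlen))
        have := hbl s (Dvd.intro _ h1.symm) h2 h3
        omega
    _ = 2 ^ (2 * e + 1) * d.divisors.card ^ (2 * e + 1) := by rw [← pow_succ', mul_pow]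
    _ ≤ _ := Nat.mul_le_mul_left _
        (Finset.single_le_sum (f := fun d : ℕ => d.divisors.card ^ (2 * e + 1))
          (fun _ _ => Nat.zero_le _) hd)

/-- The harmonic numbers. -/
noncomputable def harm (n : ℕ) : ℝ := ∑ i ∈ Finset.Icc 1 n, 1 / (i : ℝ)

theorem harm_nonneg (n : ℕ) : 0 ≤ harm n := Finset.sum_nonneg fun _ _ => by positivity

theorem harm_two_pow_le (k : ℕ) : harm (2 ^ k) ≤ k + 1 := by
  induction k with
  | zero => simp [harm]
  | succ k ih =>
    have hsub : Finset.Icc 1 (2 ^ (k + 1)) ⊆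
        Finset.Icc 1 (2 ^ k) ∪ Finset.Ioc (2 ^ k) (2 ^ k + 2 ^ k) := by
      intro i hi
      rw [Finset.mem_union, Finset.mem_Icc, Finset.mem_Ioc]
      rw [Finset.mem_Icc, pow_succ] at hi
      omega
    calc harm (2 ^ (k + 1))
        ≤ ∑ i ∈ Finset.Icc 1 (2 ^ k) ∪ Finset.Ioc (2 ^ k) (2 ^ k + 2 ^ k), 1 / ((i : ℕ) : ℝ) :=
          Finset.sum_le_sum_of_subset_of_nonneg hsub fun _ _ _ => by positivity
      _ ≤ harm (2 ^ k) + ∑ i ∈ Finset.Ioc (2 ^ k) (2 ^ k + 2 ^ k), 1 / ((i : ℕ) : ℝ) := by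
          rw [Finset.sum_union]
          · rfl
          · rw [Finset.disjoint_left]
            intro i hi hi'
            rw [Finset.mem_Icc] at hi
            rw [Finset.mem_Ioc] at hi'
            omega
      _ ≤ (k + 1) + ∑ i ∈ Finset.Ioc (2 ^ k : ℕ) (2 ^ k + 2 ^ k), 1 / (2 : ℝ) ^ k := by
          refine add_le_add ih (Finset.sum_le_sum fun i hi => ?_)
          have : (2 : ℝ) ^ k ≤ i := by exact_mod_cast (Finset.mem_Ioc.1 hi).1.le
          gcongr
      _ = (k + 1 : ℕ) + 1 := by
          rw [Finset.sum_const, Nat.card_Ioc, Nat.add_sub_cancel, nsmul_eq_mul]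
          push_cast
          field_simp

/-- One factor `τ(d)` counts the factorizations `d = x y`. Since `τ(x y) ≤ τ(x) τ(y)`, the sum for
`j + 1` is at most the square of the sum for `j`. -/
theorem sum_card_divisors_pow_div_le (D j : ℕ) :
    ∑ d ∈ Finset.Icc 1 D, (d.divisors.card : ℝ) ^ j / d ≤ harm D ^ 2 ^ j := by
  induction j with
  | zero => simp [harm]
  | succ j ih =>
    set S := ∑ d ∈ Finset.Icc 1 D, (d.divisors.card : ℝ) ^ j / d
    have hS : 0 ≤ S := Finset.sum_nonneg fun _ _ => by positivity
    set F : ℕ × ℕ → ℝ := fun x =>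
      ((x.1.divisors.card : ℝ) ^ j / x.1) * ((x.2.divisors.card : ℝ) ^ j / x.2) with hF
    have hF0 : ∀ x, 0 ≤ F x := fun x => by positivity
    have h1 : ∀ d ∈ Finset.Icc 1 D, (d.divisors.card : ℝ) ^ (j + 1) / d ≤
        ∑ x ∈ (Finset.Icc 1 D ×ˢ Finset.Icc 1 D) with x.1 * x.2 = d, F x := by
      intro d hd
      have hd' := Finset.mem_Icc.1 hd
      calc (d.divisors.card : ℝ) ^ (j + 1) / d
          = ∑ x ∈ d.divisorsAntidiagonal, (d.divisors.card : ℝ) ^ j / d := by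
            rw [Finset.sum_const, nsmul_eq_mul, pow_succ, ← Nat.map_div_right_divisors,
              Finset.card_map]
            ring
        _ ≤ ∑ x ∈ d.divisorsAntidiagonal, F x := by
            refine Finset.sum_le_sum fun x hx => ?_
            obtain ⟨hx, -⟩ := Nat.mem_divisorsAntidiagonal.1 hx
            rw [hF, ← hx]
            simp only
            rw [div_mul_div_comm, ← mul_pow]
            push_cast
            gcongr
            exact_mod_cast card_divisors_mul_le x.1 x.2
        _ ≤ _ := by
            refine Finset.sum_le_sum_of_subset_of_nonneg (fun x hx => ?_) fun x _ _ => hF0 x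
            obtain ⟨hx, hd0⟩ := Nat.mem_divisorsAntidiagonal.1 hx
            have a : 0 < x.1 := Nat.pos_of_ne_zero fun h => hd0 (by rw [← hx, h, zero_mul])
            have b : 0 < x.2 := Nat.pos_of_ne_zero fun h => hd0 (by rw [← hx, h, mul_zero])
            rw [Finset.mem_filter, Finset.mem_product, Finset.mem_Icc, Finset.mem_Icc]
            have c := Nat.le_mul_of_pos_right x.1 b
            have c' := Nat.le_mul_of_pos_left x.2 a
            exact ⟨⟨⟨a, by omega⟩, b, by omega⟩, hx⟩
    calc _ ≤ ∑ d ∈ Finset.Icc 1 D,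
          ∑ x ∈ (Finset.Icc 1 D ×ˢ Finset.Icc 1 D) with x.1 * x.2 = d, F x := Finset.sum_le_sum h1
      _ ≤ ∑ x ∈ Finset.Icc 1 D ×ˢ Finset.Icc 1 D, F x :=
          Finset.sum_fiberwise_le_sum_of_sum_fiber_nonneg fun _ _ =>
            Finset.sum_nonneg fun x _ => hF0 x
      _ = S * S := by rw [Finset.sum_mul_sum, Finset.sum_product]
      _ ≤ harm D ^ 2 ^ j * harm D ^ 2 ^ j := mul_le_mul ih ih hS (hS.trans ih)
      _ = _ := by rw [← pow_add, pow_succ 2 j, mul_two]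

/-- The gcd of `k` and `d` is bounded by the sum of all common divisors `e`; writing `k = e j`
cancels the factor `e` and leaves a harmonic sum for each divisor of `d`. -/
theorem sum_gcd_div_le (d M : ℕ) (hd : d ≠ 0) :
    ∑ k ∈ Finset.Icc 1 M, (Nat.gcd (4 * k) d : ℝ) / k ≤ 4 * d.divisors.card * harm M := by
  have h1 : ∀ k ∈ Finset.Icc 1 M, (Nat.gcd (4 * k) d : ℝ) / k ≤
      ∑ e ∈ d.divisors, if e ∣ k then 4 * (e : ℝ) / k else 0 := by
    intro k hk
    have hk' := Finset.mem_Icc.1 hk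
    have hg : Nat.gcd (4 * k) d ≤ 4 * Nat.gcd k d := by
      refine Nat.le_of_dvd (by have := Nat.gcd_pos_of_pos_left d hk'.1; omega) ?_
      calc Nat.gcd (4 * k) d ∣ Nat.gcd (4 * k) (4 * d) :=
            Nat.gcd_dvd_gcd_of_dvd_right _ (Dvd.intro_left 4 rfl)
        _ = _ := Nat.gcd_mul_left _ _ _
    have hg' : (Nat.gcd (4 * k) d : ℝ) ≤ 4 * (Nat.gcd k d : ℕ) := by exact_mod_cast hg
    calc _ ≤ 4 * (Nat.gcd k d : ℝ) / k := by gcongr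
      _ = if Nat.gcd k d ∣ k then 4 * (Nat.gcd k d : ℝ) / k else 0 := by
          rw [if_pos (Nat.gcd_dvd_left k d)]
      _ ≤ _ := Finset.single_le_sum (f := fun e : ℕ => if e ∣ k then 4 * (e : ℝ) / k else 0)
          (fun e _ => by split_ifs <;> positivity)
          (Nat.mem_divisors.2 ⟨Nat.gcd_dvd_right k d, hd⟩)
  refine (Finset.sum_le_sum h1).trans ?_
  rw [Finset.sum_comm]
  calc _ ≤ ∑ e ∈ d.divisors, 4 * harm M := by
        refine Finset.sum_le_sum fun e he => ?_
        have he0 : 0 < e := Nat.pos_of_mem_divisors he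
        rw [← Finset.sum_filter, harm, Finset.mul_sum]
        calc _ = ∑ k ∈ ((Finset.Icc 1 M).filter (e ∣ ·)), 4 * (1 / ((k / e : ℕ) : ℝ)) := by
              refine Finset.sum_congr rfl fun k hk => ?_
              obtain ⟨j, rfl⟩ := (Finset.mem_filter.1 hk).2
              rw [Nat.mul_div_cancel_left _ he0]
              have : (e : ℝ) ≠ 0 := by exact_mod_cast he0.ne'
              push_cast
              rw [mul_one_div, mul_comm (4 : ℝ), mul_div_mul_left _ _ this]
          _ = ∑ j ∈ ((Finset.Icc 1 M).filter (e ∣ ·)).image (· / e), 4 * (1 / (j : ℝ)) := by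
              rw [Finset.sum_image]
              intro a ha b hb hab
              have ha' := (Finset.mem_filter.1 (Finset.mem_coe.1 ha)).2
              have hb' := (Finset.mem_filter.1 (Finset.mem_coe.1 hb)).2
              have hab : a / e = b / e := hab
              rw [← Nat.div_mul_cancel ha', ← Nat.div_mul_cancel hb', hab]
          _ ≤ _ := by
              refine Finset.sum_le_sum_of_subset_of_nonneg (fun j hj => ?_)
                fun _ _ _ => by positivity
              obtain ⟨k, hk, rfl⟩ := Finset.mem_image.1 hj
              obtain ⟨hk, j, rfl⟩ := Finset.mem_filter.1 hk
              rw [Nat.mul_div_cancel_left _ he0]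
              rw [Finset.mem_Icc] at hk ⊢
              constructor
              · rcases Nat.eq_zero_or_pos j with rfl | h
                · simp at hk
                · exact h
              · exact (Nat.le_mul_of_pos_left j he0).trans hk.2
    _ = _ := by rw [Finset.sum_const, nsmul_eq_mul]; ring

/-! ### Average number of representations near the values of `Q² t² + 1` -/

theorem div_gcd_dvd_of_dvd_mul {d Q : ℕ} (hd : 0 < d) {x : ℤ} (h : (d : ℤ) ∣ Q * x) :
    ((d / Nat.gcd d Q : ℕ) : ℤ) ∣ x := by
  have hg : 0 < Nat.gcd d Q := Nat.gcd_pos_of_pos_left _ hd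
  rw [Int.natCast_dvd, Int.natAbs_mul, Int.natAbs_natCast] at h
  rw [Int.natCast_dvd]
  refine (Nat.coprime_div_gcd_div_gcd hg).dvd_of_dvd_mul_left ?_
  refine Nat.dvd_of_mul_dvd_mul_left hg ?_
  rwa [Nat.mul_div_cancel' (Nat.gcd_dvd_left d Q), ← mul_assoc,
    Nat.mul_div_cancel' (Nat.gcd_dvd_right d Q)]

theorem mul_card_filter_dvd_sub_le {T L : ℕ} (hL : L ≤ T) (hL0 : 0 < L) (t₁ : ℕ)
    (A : Finset ℕ) (hA : ∀ t ∈ A, t ∈ Finset.Ico T (T + T) ∧ (L : ℤ) ∣ (t : ℤ) - t₁) :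
    L * A.card ≤ 2 * T := by
  have h1 : A ⊆ (Finset.Ico T (T + T)).filter (· ≡ t₁ [MOD L]) := by
    intro t ht
    refine Finset.mem_filter.2 ⟨(hA t ht).1, ?_⟩
    exact ((Nat.modEq_iff_dvd).2 (by simpa using (hA t ht).2)).symm
  have h2 := (abs_le.1 (abs_card_filter_modEq_sub_le T T t₁ hL0)).2
  have h3 : (A.card : ℝ) ≤ ((Finset.Ico T (T + T)).filter (· ≡ t₁ [MOD L])).card := by
    exact_mod_cast Finset.card_le_card h1
  have hLr : (0 : ℝ) < L := by exact_mod_cast hL0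
  have hLT : (L : ℝ) ≤ T := by exact_mod_cast hL
  have h4 : (A.card : ℝ) ≤ T / L + 1 := by linarith
  have h5 : (L : ℝ) * A.card ≤ 2 * T := by
    calc (L : ℝ) * A.card ≤ L * (T / L + 1) := by gcongr
      _ = T + L := by field_simp
      _ ≤ 2 * T := by linarith
  exact_mod_cast h5

/-- An upper bound for the number of `t ∈ [T, 2T)` such that `d` divides `Q² t² + k`. -/
theorem mul_card_dvd_le {d Q T : ℕ} (hd : 0 < d) (hdT : d ≤ T) (k : ℤ) :
    d * ((Finset.Ico T (T + T)).filter fun t : ℕ => (d : ℤ) ∣ (Q : ℤ) ^ 2 * t ^ 2 + k).card ≤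
      d.divisors.card * (2 * T * Nat.gcd (4 * k.natAbs) d) := by
  set A := (Finset.Ico T (T + T)).filter fun t : ℕ => (d : ℤ) ∣ (Q : ℤ) ^ 2 * t ^ 2 + k with hA
  rcases A.eq_empty_or_nonempty with h | ⟨t₀, ht₀⟩
  · simp [h]
  have hk₀ := (Finset.mem_filter.1 ht₀).2
  -- For a fixed solution `t₀`, every solution has `d` dividing `Q (t - t₀) · Q (t + t₀)`. The
  -- solutions are sorted by the part `d₁` of `d` that goes into the first factor; each class lies
  -- in one progression modulo `L`.
  set B : ℕ → Finset ℕ := fun d₁ => A.filter fun t : ℕ =>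
    (d₁ : ℤ) ∣ (Q : ℤ) * ((t : ℤ) - t₀) ∧ ((d / d₁ : ℕ) : ℤ) ∣ (Q : ℤ) * ((t : ℤ) + t₀) with hB
  have hcover : A ⊆ d.divisors.biUnion B := by
    intro t ht
    have hk := (Finset.mem_filter.1 ht).2
    set d₁ := Nat.gcd d ((Q : ℤ) * ((t : ℤ) - t₀)).natAbs with hd₁
    have hdd : d₁ ∣ d := Nat.gcd_dvd_left _ _
    have hd₁0 : 0 < d₁ := Nat.gcd_pos_of_pos_left _ hd
    refine Finset.mem_biUnion.2 ⟨d₁, Nat.mem_divisors.2 ⟨hdd, hd.ne'⟩,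
      Finset.mem_filter.2 ⟨ht, ?_, ?_⟩⟩
    · rw [Int.natCast_dvd]; exact Nat.gcd_dvd_right _ _
    · have hprod : (d : ℤ) ∣ ((Q : ℤ) * ((t : ℤ) - t₀)) * ((Q : ℤ) * ((t : ℤ) + t₀)) := by
        have : ((Q : ℤ) * ((t : ℤ) - t₀)) * ((Q : ℤ) * ((t : ℤ) + t₀)) =
            ((Q : ℤ) ^ 2 * t ^ 2 + k) - ((Q : ℤ) ^ 2 * t₀ ^ 2 + k) := by ring
        rw [this]
        exact dvd_sub hk hk₀
      rw [Int.natCast_dvd, Int.natAbs_mul] at hprod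
      rw [Int.natCast_dvd]
      refine (Nat.coprime_div_gcd_div_gcd hd₁0).dvd_of_dvd_mul_left ?_
      refine Nat.dvd_of_mul_dvd_mul_left hd₁0 ?_
      rwa [Nat.mul_div_cancel' hdd, ← mul_assoc,
        Nat.mul_div_cancel' (Nat.gcd_dvd_right d _)]
  have hpart : ∀ d₁ ∈ d.divisors, d * (B d₁).card ≤ 2 * T * Nat.gcd (4 * k.natAbs) d := by
    intro d₁ hd₁
    have hdd : d₁ ∣ d := (Nat.mem_divisors.1 hd₁).1
    have hd₁0 : 0 < d₁ := Nat.pos_of_mem_divisors hd₁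
    set d₂ := d / d₁ with hd₂
    have hd12 : d₁ * d₂ = d := Nat.mul_div_cancel' hdd
    have hd₂0 : 0 < d₂ := Nat.pos_of_ne_zero fun h => by rw [h, mul_zero] at hd12; omega
    rcases (B d₁).eq_empty_or_nonempty with h | ⟨t₁, ht₁⟩
    · simp [h]
    obtain ⟨ht₁A, h1, h2⟩ := Finset.mem_filter.1 ht₁
    have hk₁ := (Finset.mem_filter.1 ht₁A).2
    set q₁ := Nat.gcd d₁ Q
    set q₂ := Nat.gcd d₂ Q
    set e₁ := d₁ / q₁
    set e₂ := d₂ / q₂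
    have hq₁ : q₁ * e₁ = d₁ := Nat.mul_div_cancel' (Nat.gcd_dvd_left _ _)
    have hq₂ : q₂ * e₂ = d₂ := Nat.mul_div_cancel' (Nat.gcd_dvd_left _ _)
    have hq₁0 : 0 < q₁ := Nat.gcd_pos_of_pos_left _ hd₁0
    have hq₂0 : 0 < q₂ := Nat.gcd_pos_of_pos_left _ hd₂0
    have he₁0 : 0 < e₁ := Nat.pos_of_ne_zero fun h => by rw [h, mul_zero] at hq₁; omega
    have he₂0 : 0 < e₂ := Nat.pos_of_ne_zero fun h => by rw [h, mul_zero] at hq₂; omega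
    set g := Nat.gcd e₁ e₂
    set L := Nat.lcm e₁ e₂
    have hgL : g * L = e₁ * e₂ := Nat.gcd_mul_lcm _ _
    have hL0 : 0 < L := Nat.lcm_pos he₁0 he₂0
    have hdL : d = q₁ * q₂ * g * L := by
      rw [mul_assoc _ g L, hgL, ← hd12, ← hq₁, ← hq₂]; ring
    have hLT : L ≤ T := by
      refine le_trans (Nat.le_of_dvd hd ?_) hdT
      rw [hdL]; exact Dvd.intro_left _ rfl
    have hcard : L * (B d₁).card ≤ 2 * T := by
      refine mul_card_filter_dvd_sub_le hLT hL0 t₁ _ fun t ht => ?_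
      obtain ⟨htA, h1', h2'⟩ := Finset.mem_filter.1 ht
      refine ⟨(Finset.mem_filter.1 htA).1, ?_⟩
      have a1 : (d₁ : ℤ) ∣ Q * ((t : ℤ) - t₁) := by
        have := dvd_sub h1' h1
        rwa [← mul_sub, sub_sub_sub_cancel_right] at this
      have a2 : (d₂ : ℤ) ∣ Q * ((t : ℤ) - t₁) := by
        have := dvd_sub h2' h2
        rwa [← mul_sub, add_sub_add_right_eq_sub] at this
      have b1 := div_gcd_dvd_of_dvd_mul hd₁0 a1
      have b2 := div_gcd_dvd_of_dvd_mul hd₂0 a2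
      rw [Int.natCast_dvd] at b1 b2 ⊢
      exact Nat.lcm_dvd b1 b2
    -- The part of `d` that the progression modulo `L` does not see. As `g` divides `t₁ - t₀` and
    -- `t₁ + t₀`, it divides `2 t₁`; so `q₁ q₂ g²` divides `4 Q² t₁²` as well as `4 (Q² t₁² + k)`.
    have he : q₁ * q₂ * g ∣ 4 * k.natAbs := by
      have c1 := div_gcd_dvd_of_dvd_mul hd₁0 h1
      have c2 := div_gcd_dvd_of_dvd_mul hd₂0 h2
      have hg2 : (g : ℤ) ∣ 2 * t₁ := by
        have u1 : (g : ℤ) ∣ (t₁ : ℤ) - t₀ :=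
          (Int.natCast_dvd_natCast.2 (Nat.gcd_dvd_left e₁ e₂)).trans c1
        have u2 : (g : ℤ) ∣ (t₁ : ℤ) + t₀ :=
          (Int.natCast_dvd_natCast.2 (Nat.gcd_dvd_right e₁ e₂)).trans c2
        have := dvd_add u1 u2
        have e : (2 : ℤ) * t₁ = (t₁ - t₀) + (t₁ + t₀) := by ring
        rwa [e]
      have hQ1 : (q₁ : ℤ) ∣ Q := Int.natCast_dvd_natCast.2 (Nat.gcd_dvd_right _ _)
      have hQ2 : (q₂ : ℤ) ∣ Q := Int.natCast_dvd_natCast.2 (Nat.gcd_dvd_right _ _)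
      have f1 : ((q₁ * q₂ * (g * g) : ℕ) : ℤ) ∣ (Q : ℤ) * Q * ((2 * t₁) * (2 * t₁)) := by
        push_cast
        exact mul_dvd_mul (mul_dvd_mul hQ1 hQ2) (mul_dvd_mul hg2 hg2)
      have f2 : ((q₁ * q₂ * (g * g) : ℕ) : ℤ) ∣ (d : ℤ) := by
        rw [Int.natCast_dvd_natCast, ← hd12, ← hq₁, ← hq₂]
        have : q₁ * e₁ * (q₂ * e₂) = q₁ * q₂ * (e₁ * e₂) := by ring
        rw [this]
        exact mul_dvd_mul_left _ (mul_dvd_mul (Nat.gcd_dvd_left _ _) (Nat.gcd_dvd_right _ _))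
      have f3 : ((q₁ * q₂ * (g * g) : ℕ) : ℤ) ∣ 4 * k := by
        have h4 := dvd_sub ((f2.trans hk₁).mul_left 4) f1
        have e : 4 * ((Q : ℤ) ^ 2 * t₁ ^ 2 + k) - (Q : ℤ) * Q * ((2 * t₁) * (2 * t₁)) = 4 * k := by
          ring
        rwa [e] at h4
      rw [Int.natCast_dvd, Int.natAbs_mul] at f3
      refine Dvd.dvd.trans ?_ f3
      exact mul_dvd_mul_left _ (Dvd.intro _ rfl)
    have hle : q₁ * q₂ * g ≤ Nat.gcd (4 * k.natAbs) d := by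
      refine Nat.le_of_dvd (Nat.gcd_pos_of_pos_right _ hd) (Nat.dvd_gcd he ?_)
      rw [hdL]; exact Dvd.intro _ rfl
    calc d * (B d₁).card = q₁ * q₂ * g * (L * (B d₁).card) := by rw [hdL]; ring
      _ ≤ Nat.gcd (4 * k.natAbs) d * (2 * T) := Nat.mul_le_mul hle hcard
      _ = _ := by ring
  calc d * A.card ≤ d * ∑ d₁ ∈ d.divisors, (B d₁).card :=
        Nat.mul_le_mul_left _ ((Finset.card_le_card hcover).trans Finset.card_biUnion_le)
    _ = ∑ d₁ ∈ d.divisors, d * (B d₁).card := Finset.mul_sum _ _ _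
    _ ≤ ∑ d₁ ∈ d.divisors, 2 * T * Nat.gcd (4 * k.natAbs) d := Finset.sum_le_sum hpart
    _ = _ := by rw [Finset.sum_const, smul_eq_mul]

/-- The number of divisors is first replaced by a sum over divisors `d ≤ T`, because the count of
`t` modulo `d` is of the expected order only when `d` does not exceed the length `T` of the range.
-/
theorem sum_r2_quadratic_le {e Q T M : ℕ} (hT : 2 ≤ T) (hM : M ≤ T ^ e) (k : ℤ) :
    ∑ t ∈ Finset.Ico T (T + T) with (1 ≤ (Q : ℤ) ^ 2 * (t : ℕ) ^ 2 + k ∧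
        (Q : ℤ) ^ 2 * (t : ℕ) ^ 2 + k ≤ M), (r2 ((Q : ℤ) ^ 2 * (t : ℕ) ^ 2 + k).toNat : ℝ) ≤
      2 ^ (2 * e + 4) * T * ∑ d ∈ Finset.Icc 1 T, (d.divisors.card : ℝ) ^ (2 * e + 2) / d *
        Nat.gcd (4 * k.natAbs) d := by
  set S := (Finset.Ico T (T + T)).filter fun t => (1 ≤ (Q : ℤ) ^ 2 * (t : ℕ) ^ 2 + k ∧
        (Q : ℤ) ^ 2 * (t : ℕ) ^ 2 + k ≤ M)
  have h1 : ∀ t ∈ S, (r2 ((Q : ℤ) ^ 2 * (t : ℕ) ^ 2 + k).toNat : ℝ) ≤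
      2 ^ (2 * e + 3) * ∑ d ∈ Finset.Icc 1 T, if (d : ℤ) ∣ (Q : ℤ) ^ 2 * (t : ℕ) ^ 2 + k
        then (d.divisors.card : ℝ) ^ (2 * e + 1) else 0 := by
    intro t ht
    obtain ⟨-, hlo, hhi⟩ := Finset.mem_filter.1 ht
    obtain ⟨n, hn⟩ := Int.eq_ofNat_of_zero_le (by omega : 0 ≤ (Q : ℤ) ^ 2 * (t : ℕ) ^ 2 + k)
    rw [hn] at hlo hhi ⊢
    rw [Int.toNat_natCast]
    have hn0 : n ≠ 0 := by omega
    have hnM : n ≤ T ^ e := by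
      have : n ≤ M := by exact_mod_cast hhi
      exact this.trans hM
    have a1 := r2_le_four_mul_card_divisors hn0
    have a2 := card_divisors_le_sum hT hn0 hnM
    have a3 := a1.trans (Nat.mul_le_mul_left 4 a2)
    have a4 : (r2 n : ℝ) ≤ ((4 * (2 ^ (2 * e + 1) *
      ∑ d ∈ Finset.Icc 1 T with d ∣ n, d.divisors.card ^ (2 * e + 1)) : ℕ) : ℝ) := by
        exact_mod_cast a3
    refine a4.trans (le_of_eq ?_)
    push_cast
    rw [Finset.sum_filter, ← mul_assoc]
    congr 1
    · ring
    · refine Finset.sum_congr rfl fun d _ => ?_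
      simp only [Int.natCast_dvd_natCast]
  have h2 : ∀ d ∈ Finset.Icc 1 T, ∑ t ∈ S, (if (d : ℤ) ∣ (Q : ℤ) ^ 2 * (t : ℕ) ^ 2 + k
        then (d.divisors.card : ℝ) ^ (2 * e + 1) else 0) ≤
      2 * T * ((d.divisors.card : ℝ) ^ (2 * e + 2) / d * Nat.gcd (4 * k.natAbs) d) := by
    intro d hd
    have hd' := Finset.mem_Icc.1 hd
    have hd0 : (0 : ℝ) < d := by exact_mod_cast hd'.1
    have a1 := mul_card_dvd_le (Q := Q) hd'.1 hd'.2 k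
    set A := (Finset.Ico T (T + T)).filter fun t : ℕ => (d : ℤ) ∣ (Q : ℤ) ^ 2 * t ^ 2 + k
    have a2 : (d : ℝ) * A.card ≤ d.divisors.card * (2 * T * Nat.gcd (4 * k.natAbs) d) := by
      exact_mod_cast a1
    have a3 : ∑ t ∈ S, (if (d : ℤ) ∣ (Q : ℤ) ^ 2 * (t : ℕ) ^ 2 + k
        then (d.divisors.card : ℝ) ^ (2 * e + 1) else 0) ≤
        A.card * (d.divisors.card : ℝ) ^ (2 * e + 1) := by
      rw [← Finset.sum_filter, Finset.sum_const, nsmul_eq_mul]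
      gcongr
      intro t ht
      obtain ⟨h, h'⟩ := Finset.mem_filter.1 ht
      exact Finset.mem_filter.2 ⟨(Finset.mem_filter.1 h).1, h'⟩
    refine a3.trans ?_
    have a4 : (A.card : ℝ) ≤ d.divisors.card * (2 * T * Nat.gcd (4 * k.natAbs) d) / d := by
      rw [le_div_iff₀ hd0]; linarith
    calc _ ≤ d.divisors.card * (2 * T * Nat.gcd (4 * k.natAbs) d) / d *
          (d.divisors.card : ℝ) ^ (2 * e + 1) := by gcongr
      _ = _ := by rw [show 2 * e + 2 = (2 * e + 1) + 1 by ring, pow_succ _ (2 * e + 1)]; ring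
  calc _ ≤ ∑ t ∈ S, 2 ^ (2 * e + 3) * ∑ d ∈ Finset.Icc 1 T,
        (if (d : ℤ) ∣ (Q : ℤ) ^ 2 * (t : ℕ) ^ 2 + k
        then (d.divisors.card : ℝ) ^ (2 * e + 1) else 0) := Finset.sum_le_sum h1
    _ = 2 ^ (2 * e + 3) * ∑ d ∈ Finset.Icc 1 T, ∑ t ∈ S,
        (if (d : ℤ) ∣ (Q : ℤ) ^ 2 * (t : ℕ) ^ 2 + k
        then (d.divisors.card : ℝ) ^ (2 * e + 1) else 0) := by
        rw [← Finset.mul_sum, Finset.sum_comm]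
    _ ≤ 2 ^ (2 * e + 3) * ∑ d ∈ Finset.Icc 1 T,
        2 * T * ((d.divisors.card : ℝ) ^ (2 * e + 2) / d * Nat.gcd (4 * k.natAbs) d) := by
        gcongr with d hd
        exact h2 d hd
    _ = _ := by rw [← Finset.mul_sum]; ring

/-- Here `k` is the distance from `Q² t²`, and the excluded values 0 and 1 are the two distinguished
energies. For the other `k` one has `|k| ≤ 2 |k - 1|`. -/
theorem sum_gcd_div_abs_sub_one_le (d M : ℕ) (hd : d ≠ 0) :
    ∑ k ∈ (Finset.Icc (-(M : ℤ)) M) with (k ≠ 0 ∧ k ≠ 1),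
      (Nat.gcd (4 * k.natAbs) d : ℝ) / |(k : ℝ) - 1| ≤ 16 * d.divisors.card * harm M := by
  set F : ℤ → ℝ := fun k => 2 * ((Nat.gcd (4 * k.natAbs) d : ℝ) / |(k : ℝ)|) with hF
  have hF0 : ∀ k, 0 ≤ F k := fun k => by positivity
  have h1 : ∀ k : ℤ, k ≠ 0 → k ≠ 1 → (Nat.gcd (4 * k.natAbs) d : ℝ) / |(k : ℝ) - 1| ≤ F k := by
    intro k h0 h1
    have hk0 : 0 < |(k : ℝ)| := abs_pos.2 (by exact_mod_cast h0)
    have hk1 : 0 < |(k : ℝ) - 1| := abs_pos.2 (sub_ne_zero.2 (by exact_mod_cast h1))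
    have h2 : |(k : ℝ)| ≤ 2 * |(k : ℝ) - 1| := by
      have : |k| ≤ 2 * |k - 1| := by
        rcases abs_cases k with h | h <;> rcases abs_cases (k - 1) with h' | h' <;> omega
      exact_mod_cast this
    rw [hF]
    simp only
    rw [mul_div_assoc', div_le_div_iff₀ hk1 hk0]
    have hg : (0 : ℝ) ≤ Nat.gcd (4 * k.natAbs) d := Nat.cast_nonneg _
    nlinarith
  have hsub : (Finset.Icc (-(M : ℤ)) M).filter (fun k => k ≠ 0 ∧ k ≠ 1) ⊆
      (Finset.Icc 1 M).image (fun j : ℕ => (j : ℤ)) ∪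
        (Finset.Icc 1 M).image (fun j : ℕ => -(j : ℤ)) := by
    intro k hk
    obtain ⟨hk, h0, -⟩ := Finset.mem_filter.1 hk
    rw [Finset.mem_Icc] at hk
    rw [Finset.mem_union, Finset.mem_image, Finset.mem_image]
    rcases lt_or_gt_of_ne h0 with h | h
    · exact Or.inr ⟨k.natAbs, Finset.mem_Icc.2 ⟨by omega, by omega⟩, by omega⟩
    · exact Or.inl ⟨k.natAbs, Finset.mem_Icc.2 ⟨by omega, by omega⟩, by omega⟩
  calc _ ≤ ∑ k ∈ (Finset.Icc (-(M : ℤ)) M) with (k ≠ 0 ∧ k ≠ 1), F k :=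
        Finset.sum_le_sum fun k hk => h1 k (Finset.mem_filter.1 hk).2.1 (Finset.mem_filter.1 hk).2.2
    _ ≤ ∑ k ∈ (Finset.Icc 1 M).image (fun j : ℕ => (j : ℤ)) ∪
        (Finset.Icc 1 M).image (fun j : ℕ => -(j : ℤ)), F k :=
        Finset.sum_le_sum_of_subset_of_nonneg hsub fun k _ _ => hF0 k
    _ ≤ ∑ k ∈ (Finset.Icc 1 M).image (fun j : ℕ => (j : ℤ)), F k +
        ∑ k ∈ (Finset.Icc 1 M).image (fun j : ℕ => -(j : ℤ)), F k := by
        rw [← Finset.sum_union_inter]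
        exact le_add_of_nonneg_right (Finset.sum_nonneg fun k _ => hF0 k)
    _ = 4 * ∑ j ∈ Finset.Icc 1 M, (Nat.gcd (4 * j) d : ℝ) / j := by
        rw [Finset.sum_image fun a _ b _ h => by simpa using h,
          Finset.sum_image fun a _ b _ h => by simpa using h, ← Finset.sum_add_distrib,
          Finset.mul_sum]
        refine Finset.sum_congr rfl fun j _ => ?_
        simp only [hF, Int.natAbs_natCast, Int.natAbs_neg, Int.cast_neg, Int.cast_natCast, abs_neg,
          Nat.abs_cast]
        ring
    _ ≤ 4 * (4 * d.divisors.card * harm M) := by gcongr; exact sum_gcd_div_le d M hd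
    _ = _ := by ring

/-- On average over `t`, there are few sums of two squares near `Q² t² + 1`, other than
`Q² t² + 1` and `Q² t²`. -/
theorem sum_sum_r2_div_le {e Q T M : ℕ} (hT : 2 ≤ T) (hM : M ≤ T ^ e)
    (hQM : Q ^ 2 * (2 * T) ^ 2 ≤ M) :
    ∑ t ∈ Finset.Ico T (T + T), ∑ n ∈ Finset.Icc 1 M with
        (n ≠ Q ^ 2 * t ^ 2 + 1 ∧ n ≠ Q ^ 2 * t ^ 2),
        (r2 n : ℝ) / |(n : ℝ) - (Q ^ 2 * t ^ 2 + 1 : ℕ)| ≤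
      2 ^ (2 * e + 8) * T * harm M * harm T ^ 2 ^ (2 * e + 3) := by
  set 𝒦 := (Finset.Icc (-(M : ℤ)) M).filter (fun k => k ≠ 0 ∧ k ≠ 1) with h𝒦
  have h1 : ∀ t ∈ Finset.Ico T (T + T), ∑ n ∈ Finset.Icc 1 M with
        (n ≠ Q ^ 2 * t ^ 2 + 1 ∧ n ≠ Q ^ 2 * t ^ 2),
        (r2 n : ℝ) / |(n : ℝ) - (Q ^ 2 * t ^ 2 + 1 : ℕ)| ≤
      ∑ k ∈ 𝒦, (if (1 ≤ (Q : ℤ) ^ 2 * (t : ℕ) ^ 2 + k ∧ (Q : ℤ) ^ 2 * (t : ℕ) ^ 2 + k ≤ M) then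
        (r2 ((Q : ℤ) ^ 2 * (t : ℕ) ^ 2 + k).toNat : ℝ) else 0) / |(k : ℝ) - 1| := by
    intro t ht
    have htlt : t ≤ 2 * T := by have := Finset.mem_Ico.1 ht; omega
    have hQt : Q ^ 2 * t ^ 2 ≤ M := le_trans (by gcongr) hQM
    -- The shift `k = n - Q² t²` makes the weights independent of `t`, so that the sums over `t` and
    -- `k` can be exchanged.
    set φ : ℕ → ℤ := fun n => (n : ℤ) - (Q ^ 2 * t ^ 2 : ℕ) with hφ
    have hinj : Function.Injective φ := fun a b h => by simpa [hφ] using h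
    set G : ℤ → ℝ := fun k =>
      (if (1 ≤ (Q : ℤ) ^ 2 * (t : ℕ) ^ 2 + k ∧ (Q : ℤ) ^ 2 * (t : ℕ) ^ 2 + k ≤ M) then
        (r2 ((Q : ℤ) ^ 2 * (t : ℕ) ^ 2 + k).toNat : ℝ) else 0) / |(k : ℝ) - 1| with hG
    calc _ = ∑ n ∈ Finset.Icc 1 M with
        (n ≠ Q ^ 2 * t ^ 2 + 1 ∧ n ≠ Q ^ 2 * t ^ 2), G (φ n) := by
          refine Finset.sum_congr rfl fun n hn => ?_
          have hn' := Finset.mem_Icc.1 (Finset.mem_filter.1 hn).1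
          have e1 : (Q : ℤ) ^ 2 * (t : ℕ) ^ 2 + φ n = n := by simp only [hφ]; push_cast; ring
          have e2 : ((φ n : ℤ) : ℝ) - 1 = (n : ℝ) - (Q ^ 2 * t ^ 2 + 1 : ℕ) := by
            simp only [hφ]; push_cast; ring
          simp only [hG]
          rw [e1, e2, if_pos ⟨by exact_mod_cast hn'.1, by exact_mod_cast hn'.2⟩, Int.toNat_natCast]
      _ = ∑ k ∈ ((Finset.Icc 1 M).filter fun n =>
        (n ≠ Q ^ 2 * t ^ 2 + 1 ∧ n ≠ Q ^ 2 * t ^ 2)).image φ, G k := by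
          rw [Finset.sum_image fun a _ b _ h => hinj h]
      _ ≤ _ := by
          refine Finset.sum_le_sum_of_subset_of_nonneg (fun k hk => ?_) fun k _ _ => ?_
          · obtain ⟨n, hn, rfl⟩ := Finset.mem_image.1 hk
            obtain ⟨hn, hn1, hn2⟩ := Finset.mem_filter.1 hn
            rw [Finset.mem_Icc] at hn
            rw [h𝒦, Finset.mem_filter, Finset.mem_Icc]
            simp only [hφ]
            generalize Q ^ 2 * t ^ 2 = N at *
            omega
          · simp only [hG]
            split_ifs <;> positivity
  refine (Finset.sum_le_sum h1).trans ?_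
  rw [Finset.sum_comm]
  have h2 : ∀ k ∈ 𝒦, ∑ t ∈ Finset.Ico T (T + T),
      (if (1 ≤ (Q : ℤ) ^ 2 * (t : ℕ) ^ 2 + k ∧ (Q : ℤ) ^ 2 * (t : ℕ) ^ 2 + k ≤ M) then
        (r2 ((Q : ℤ) ^ 2 * (t : ℕ) ^ 2 + k).toNat : ℝ) else 0) / |(k : ℝ) - 1| ≤
      2 ^ (2 * e + 4) * T * ∑ d ∈ Finset.Icc 1 T, (d.divisors.card : ℝ) ^ (2 * e + 2) / d *
        (Nat.gcd (4 * k.natAbs) d / |(k : ℝ) - 1|) := by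
    intro k _
    rw [← Finset.sum_div, ← Finset.sum_filter]
    refine (div_le_div_of_nonneg_right (sum_r2_quadratic_le hT hM k) (abs_nonneg _)).trans
      (le_of_eq ?_)
    rw [mul_div_assoc, Finset.sum_div]
    congr 1
    exact Finset.sum_congr rfl fun d _ => by rw [mul_div_assoc]
  refine (Finset.sum_le_sum h2).trans ?_
  rw [← Finset.mul_sum, Finset.sum_comm]
  have h3 : ∀ d ∈ Finset.Icc 1 T, ∑ k ∈ 𝒦, (d.divisors.card : ℝ) ^ (2 * e + 2) / d *
        (Nat.gcd (4 * k.natAbs) d / |(k : ℝ) - 1|) ≤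
      16 * harm M * ((d.divisors.card : ℝ) ^ (2 * e + 3) / d) := by
    intro d hd
    have hd' := Finset.mem_Icc.1 hd
    rw [← Finset.mul_sum]
    calc _ ≤ (d.divisors.card : ℝ) ^ (2 * e + 2) / d * (16 * d.divisors.card * harm M) := by
          gcongr
          exact sum_gcd_div_abs_sub_one_le d M (by omega)
      _ = _ := by rw [show 2 * e + 3 = (2 * e + 2) + 1 by ring, pow_succ _ (2 * e + 2)]; ring
  calc _ ≤ 2 ^ (2 * e + 4) * (T : ℝ) *
        ∑ d ∈ Finset.Icc 1 T, 16 * harm M * ((d.divisors.card : ℝ) ^ (2 * e + 3) / d) := by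
        gcongr with d hd
        exact h3 d hd
    _ = 2 ^ (2 * e + 4) * (T : ℝ) * (16 * harm M *
        ∑ d ∈ Finset.Icc 1 T, (d.divisors.card : ℝ) ^ (2 * e + 3) / d) := by rw [← Finset.mul_sum]
    _ ≤ 2 ^ (2 * e + 4) * (T : ℝ) * (16 * harm M * harm T ^ 2 ^ (2 * e + 3)) := by
        have := harm_nonneg M
        gcongr
        exact sum_card_divisors_pow_div_le T (2 * e + 3)
    _ = _ := by rw [show 2 * e + 8 = (2 * e + 4) + 4 by ring, pow_add _ (2 * e + 4)]; ring

/-! ### Isolated sums of two squares -/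

/-- All prime factors are at least `z`, so there are at most `k` of them with multiplicity, and each
at most doubles the number of divisors. -/
theorem card_divisors_le_of_isRough {z : ℕ} (k : ℕ) {n : ℕ} (hn : n ≠ 0) (hr : IsRough z n)
    (hlt : n < z ^ (k + 1)) : n.divisors.card ≤ 2 ^ k := by
  induction k generalizing n with
  | zero =>
    rcases eq_or_ne n 1 with rfl | h1
    · simp
    · exfalso
      refine hr n.minFac ?_ (Nat.minFac_prime h1) (Nat.minFac_dvd n)
      have := Nat.minFac_le (Nat.pos_of_ne_zero hn)
      simp only [zero_add, pow_one] at hlt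
      omega
  | succ k ih =>
    rcases eq_or_ne n 1 with rfl | h1
    · simpa using Nat.one_le_two_pow
    have hp := Nat.minFac_prime h1
    obtain ⟨n', hn'⟩ := Nat.minFac_dvd n
    set p := n.minFac
    have hzp : z ≤ p := by
      by_contra h
      exact hr p (not_le.1 h) hp (Nat.minFac_dvd n)
    have hn'0 : n' ≠ 0 := by rintro rfl; simp at hn'; exact hn hn'
    have hr' : IsRough z n' := fun q hq hqp hd => hr q hq hqp (hn' ▸ hd.mul_left p)
    have hlt' : n' < z ^ (k + 1) := by
      by_contra h
      push Not at h
      have : z ^ (k + 1 + 1) ≤ n := by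
        rw [hn', pow_succ, mul_comm]
        exact Nat.mul_le_mul hzp h
      omega
    rw [hn']
    refine (card_divisors_mul_le _ _).trans ?_
    rw [hp.divisors, Finset.card_pair hp.one_lt.ne, pow_succ, mul_comm]
    exact Nat.mul_le_mul_right 2 (ih hn'0 hr' hlt')

/-! ### The far part of the spectral sum near `a² + 1` -/

/-- The size of the difference of `1 / (n - N)` and `n / (n² + 1)`. -/
noncomputable def kern (N n : ℕ) : ℝ := (1 + n * N) / (|(n : ℝ) - N| * ((n : ℝ) ^ 2 + 1))

theorem kern_nonneg (N n : ℕ) : 0 ≤ kern N n := by unfold kern; positivity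

/-- The contribution of `n ∉ {a², a² + 1}` to the spectral equation near `a² + 1`. -/
noncomputable def farTerm (a n : ℕ) : ℝ :=
  if n = a ^ 2 + 1 ∨ n = a ^ 2 then 0 else r2 n * kern (a ^ 2 + 1) n

theorem farTerm_nonneg (a n : ℕ) : 0 ≤ farTerm a n := by
  unfold farTerm
  split_ifs
  · exact le_rfl
  · exact mul_nonneg (Nat.cast_nonneg _) (kern_nonneg _ _)

theorem kern_le {N n : ℕ} (h : n ≠ N) (hn : n ≠ 0) : kern N n ≤ 1 / |(n : ℝ) - N| + 1 / n := by
  have hn0 : (0 : ℝ) < n := by positivity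
  have h1 : (n : ℝ) - N ≠ 0 := sub_ne_zero.2 (by exact_mod_cast h)
  have h2 : 0 < |(n : ℝ) - N| := abs_pos.2 h1
  have h3 : (N : ℝ) ≤ |(n : ℝ) - N| + n := by linarith [neg_abs_le ((n : ℝ) - N)]
  unfold kern
  rw [div_add_div _ _ h2.ne' hn0.ne', div_le_div_iff₀ (by positivity) (by positivity)]
  have : (1 + (n : ℝ) * N) * n ≤ (1 * n + |(n : ℝ) - N| * 1) * (n ^ 2 + 1) := by nlinarith
  nlinarith

theorem kern_le_of_large {N n : ℕ} (hN : 1 ≤ N) (h : 2 * N ≤ n) : kern N n ≤ 4 * N / (n : ℝ) ^ 2 := by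
  have hN' : (1 : ℝ) ≤ N := by exact_mod_cast hN
  have h' : 2 * (N : ℝ) ≤ n := by exact_mod_cast h
  have habs : |(n : ℝ) - N| = n - N := abs_of_nonneg (by linarith)
  unfold kern
  rw [habs, div_le_div_iff₀ (mul_pos (by linarith) (by positivity)) (by nlinarith)]
  have h1 : (1 + (n : ℝ) * N) ≤ 2 * (n * N) := by nlinarith
  have h2 : (n : ℝ) ≤ 2 * (n - N) := by linarith
  calc (1 + (n : ℝ) * N) * (n : ℝ) ^ 2 ≤ 2 * ((n : ℝ) * N) * (n : ℝ) ^ 2 := by gcongr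
    _ ≤ 2 * (2 * ((n : ℝ) - N) * N) * ((n : ℝ) ^ 2 + 1) := by
        have : 0 ≤ (n : ℝ) - N := by linarith
        gcongr
        linarith
    _ = _ := by ring

theorem r2_le_six_sqrt {n : ℕ} (hn : 1 ≤ n) : (r2 n : ℝ) ≤ 6 * (n : ℝ) ^ (1 / 2 : ℝ) := by
  have h1 := r2_le_sqrt n
  have h2 : 1 ≤ n.sqrt := Nat.le_sqrt.2 (by simpa using hn)
  have h3 : (r2 n : ℝ) ≤ 6 * n.sqrt := by
    have : r2 n ≤ 6 * n.sqrt := by omega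
    exact_mod_cast this
  rw [← Real.sqrt_eq_rpow]
  refine h3.trans ?_
  gcongr
  exact Real.nat_sqrt_le_real_sqrt

theorem summable_rpow_five_quarters : Summable fun n : ℕ => (n : ℝ) ^ (-(5 / 4) : ℝ) :=
  Real.summable_nat_rpow.2 (by norm_num)

/-- With `N = a² + 1`, beyond `N⁴` the factor `N` is at most `n ^ (1/4)`, and `1/2 + 1/4 - 2 = -5/4`
is summable with a bound that does not involve `a`. -/
theorem farTerm_le_of_large {a n : ℕ} (h : (a ^ 2 + 1) ^ 4 ≤ n) (hn : 2 * (a ^ 2 + 1) ≤ n) :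
    farTerm a n ≤ 24 * (n : ℝ) ^ (-(5 / 4) : ℝ) := by
  set N := a ^ 2 + 1 with hN
  have hn1 : 1 ≤ n := by omega
  have hn0 : (0 : ℝ) < n := by exact_mod_cast hn1
  have hNn : (N : ℝ) ≤ (n : ℝ) ^ (1 / 4 : ℝ) := by
    have : (N : ℝ) ^ 4 ≤ n := by exact_mod_cast h
    calc (N : ℝ) = ((N : ℝ) ^ 4) ^ (1 / 4 : ℝ) := by
          rw [← Real.rpow_natCast, ← Real.rpow_mul (Nat.cast_nonneg _)]; norm_num
      _ ≤ _ := Real.rpow_le_rpow (by positivity) this (by norm_num)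
  unfold farTerm
  split_ifs
  · positivity
  · calc (r2 n : ℝ) * kern N n ≤ (6 * (n : ℝ) ^ (1 / 2 : ℝ)) * (4 * N / (n : ℝ) ^ 2) :=
          mul_le_mul (r2_le_six_sqrt hn1) (kern_le_of_large (by omega) hn) (kern_nonneg _ _)
            (by positivity)
      _ ≤ (6 * (n : ℝ) ^ (1 / 2 : ℝ)) * (4 * (n : ℝ) ^ (1 / 4 : ℝ) / (n : ℝ) ^ 2) := by gcongr
      _ = 24 * ((n : ℝ) ^ (1 / 2 : ℝ) * (n : ℝ) ^ (1 / 4 : ℝ) * (n : ℝ) ^ (-2 : ℝ)) := by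
          rw [Real.rpow_neg hn0.le, show (n : ℝ) ^ (2 : ℝ) = (n : ℝ) ^ 2 from Real.rpow_natCast _ 2]
          field_simp
          norm_num
      _ = _ := by
          rw [← Real.rpow_add hn0, ← Real.rpow_add hn0]; norm_num

theorem summable_farTerm (a : ℕ) : Summable (farTerm a) := by
  have h := (summable_nat_add_iff ((a ^ 2 + 1) ^ 4 + 2 * (a ^ 2 + 1))).2
    (summable_rpow_five_quarters.mul_left 24)
  refine (summable_nat_add_iff ((a ^ 2 + 1) ^ 4 + 2 * (a ^ 2 + 1))).1
    (Summable.of_nonneg_of_le (fun n => farTerm_nonneg _ _) (fun n => ?_) h)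
  exact farTerm_le_of_large (by omega) (by omega)

theorem tsum_farTerm_tail_le {a M : ℕ} (h : (a ^ 2 + 1) ^ 4 ≤ M) (hM : 2 * (a ^ 2 + 1) ≤ M) :
    ∑' n, farTerm a (n + (M + 1)) ≤ 24 * ∑' n : ℕ, (n : ℝ) ^ (-(5 / 4) : ℝ) := by
  have hs := summable_rpow_five_quarters.mul_left 24
  have hs' := (summable_nat_add_iff (M + 1)).2 hs
  have hle : ∀ n : ℕ, farTerm a (n + (M + 1)) ≤
      24 * ((n + (M + 1) : ℕ) : ℝ) ^ (-(5 / 4) : ℝ) := fun n =>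
    farTerm_le_of_large (h.trans (by omega)) (hM.trans (by omega))
  have hf : Summable fun n => farTerm a (n + (M + 1)) :=
    Summable.of_nonneg_of_le (fun n => farTerm_nonneg _ _) hle hs'
  have h1 : ∑' n, farTerm a (n + (M + 1)) ≤
      ∑' n : ℕ, 24 * ((n + (M + 1) : ℕ) : ℝ) ^ (-(5 / 4) : ℝ) := hf.tsum_le_tsum hle hs'
  have h0 : 0 ≤ ∑ i ∈ Finset.range (M + 1), 24 * (i : ℝ) ^ (-(5 / 4) : ℝ) :=
    Finset.sum_nonneg fun i _ => by positivity
  have h2 := hs.sum_add_tsum_nat_add (M + 1)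
  rw [← tsum_mul_left]
  linarith

theorem farTerm_zero_le (a : ℕ) : farTerm a 0 ≤ 4 := by
  unfold farTerm
  by_cases h : 0 = a ^ 2 + 1 ∨ 0 = a ^ 2
  · rw [if_pos h]; norm_num
  · rw [if_neg h]
    have h1 : r2 0 ≤ 2 := by simpa using r2_le_sqrt 0
    have h1' : (r2 0 : ℝ) ≤ 2 := by exact_mod_cast h1
    have h2 : kern (a ^ 2 + 1) 0 ≤ 1 := by
      unfold kern
      have : (1 : ℝ) ≤ |((0 : ℕ) : ℝ) - ((a ^ 2 + 1 : ℕ) : ℝ)| := by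
        rw [abs_sub_comm, abs_of_nonneg (by push_cast; nlinarith [sq_nonneg (a : ℝ)])]
        push_cast; nlinarith [sq_nonneg (a : ℝ)]
      rw [div_le_one (by positivity)]
      push_cast at this ⊢
      linarith
    have := kern_nonneg (a ^ 2 + 1) 0
    nlinarith [Nat.cast_nonneg (α := ℝ) (r2 0)]

theorem sum_r2_div_le (M : ℕ) : ∑ n ∈ Finset.Icc 1 M, (r2 n : ℝ) / n ≤ 4 * harm M ^ 2 := by
  have h := sum_card_divisors_pow_div_le M 1
  simp only [pow_one] at h
  calc _ ≤ ∑ n ∈ Finset.Icc 1 M, 4 * ((n.divisors.card : ℝ) / n) := by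
        refine Finset.sum_le_sum fun n hn => ?_
        have := r2_le_four_mul_card_divisors (n := n) (by
          have := (Finset.mem_Icc.1 hn).1; omega)
        have : (r2 n : ℝ) ≤ 4 * n.divisors.card := by exact_mod_cast this
        rw [mul_div_assoc']
        gcongr
    _ ≤ _ := by rw [← Finset.mul_sum]; gcongr

theorem sum_farTerm_le (a M : ℕ) : ∑ n ∈ Finset.range (M + 1), farTerm a n ≤
      4 + (∑ n ∈ Finset.Icc 1 M with (n ≠ a ^ 2 + 1 ∧ n ≠ a ^ 2),
        (r2 n : ℝ) / |(n : ℝ) - (a ^ 2 + 1 : ℕ)| + 4 * harm M ^ 2) := by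
  have e : Finset.range (M + 1) = insert 0 (Finset.Icc 1 M) := by
    ext i; simp only [Finset.mem_range, Finset.mem_insert, Finset.mem_Icc]; omega
  rw [e, Finset.sum_insert (by simp)]
  refine add_le_add (farTerm_zero_le a) ?_
  refine le_trans ?_ (add_le_add_right (sum_r2_div_le M) _)
  rw [Finset.sum_filter, ← Finset.sum_add_distrib]
  refine Finset.sum_le_sum fun n hn => ?_
  have hn0 : n ≠ 0 := by have := (Finset.mem_Icc.1 hn).1; omega
  unfold farTerm
  split_ifs with h1 h2 h2
  · rcases h1 with h1 | h1
    · exact absurd h1 h2.1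
    · exact absurd h1 h2.2
  · positivity
  · calc (r2 n : ℝ) * kern (a ^ 2 + 1) n ≤
          r2 n * (1 / |(n : ℝ) - (a ^ 2 + 1 : ℕ)| + 1 / n) := by gcongr; exact kern_le h2.1 hn0
      _ = _ := by ring
  · exact absurd (not_or.1 h1) h2

/-- Only the first sum on the right is sensitive to the position of `a`; it is the one that
`sum_sum_r2_div_le` controls on average. -/
theorem tsum_farTerm_le {a M : ℕ} (h : (a ^ 2 + 1) ^ 4 ≤ M) (hM : 2 * (a ^ 2 + 1) ≤ M) :
    ∑' n, farTerm a n ≤ ∑ n ∈ Finset.Icc 1 M with (n ≠ a ^ 2 + 1 ∧ n ≠ a ^ 2),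
        (r2 n : ℝ) / |(n : ℝ) - (a ^ 2 + 1 : ℕ)| + 4 * harm M ^ 2 + 4 +
      24 * ∑' n : ℕ, (n : ℝ) ^ (-(5 / 4) : ℝ) := by
  have h1 := (summable_farTerm a).sum_add_tsum_nat_add (M + 1)
  have h2 := sum_farTerm_le a M
  have h3 := tsum_farTerm_tail_le h hM
  linarith

open Classical in
/-- There are infinitely many `a` such that `a² + 1` has a bounded number of representations as a
sum of two squares, while those of `a²` dominate the contributions of all other energies. -/
theorem exists_isolated : ∃ K : ℕ, ∀ δ > (0 : ℝ), ∀ A₀ : ℕ, ∃ a ≥ A₀, r2 (a ^ 2 + 1) ≤ K ∧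
    1 ≤ δ * r2 (a ^ 2) ∧ ∑' n, farTerm a n ≤ δ * r2 (a ^ 2) := by
  -- As `a² + 1 ≤ T³`, the cut-off `T ^ 12` lies beyond `(a² + 1)⁴`, where the tail bound starts.
  obtain ⟨e, he⟩ : ∃ e : ℕ, e = 12 := ⟨_, rfl⟩
  obtain ⟨A, hA⟩ : ∃ A : ℕ, A = 2 ^ (2 * e + 3) := ⟨_, rfl⟩
  -- The exponents of `X`: `A + 1` from the average, `24` from the density of the sieved set, and
  -- one more to beat `1 / δ` and all constants.
  obtain ⟨q, hq, hrep⟩ := exists_base (A + 1 + 24 + 1)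
  obtain ⟨C₀, hsieve⟩ := exists_sieve_lower_bound
  -- `C` may depend on `q`, since it enters the constants but none of the exponents of `X`. The
  -- middle condition gives `Q ^ 4 ≤ T`.
  obtain ⟨C, hCC, hCq, hC1⟩ : ∃ C : ℕ, C₀ ≤ C ∧ (2 * q) ^ 4 ≤ 2 ^ C ∧ 1 ≤ C := by
    refine ⟨max C₀ ((2 * q) ^ 4), le_max_left _ _, ?_, ?_⟩
    · exact (le_max_right C₀ _).trans Nat.lt_two_pow_self.le
    · exact le_trans (Nat.one_le_pow _ _ (by omega)) (le_max_right _ _)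
  set s : ℝ := ∑' n : ℕ, (n : ℝ) ^ (-(5 / 4) : ℝ) with hs
  have hs0 : 0 ≤ s := tsum_nonneg fun n => by positivity
  -- the constants of the average bound
  set c : ℝ := 2 ^ (2 * e + 8) * (13 * C) * (2 * C) ^ A with hc
  have hCr : (1 : ℝ) ≤ C := by exact_mod_cast hC1
  have hc0 : 0 < c := by positivity
  set c' : ℝ := 8 * c + 4 * (13 * C) ^ 2 + 4 + 24 * s with hc'
  have hc'0 : 0 < c' := by positivity
  refine ⟨4 * 2 ^ (3 * C), fun δ hδ A₀ => ?_⟩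
  obtain ⟨r, hr⟩ := exists_nat_ge (max (A₀ : ℝ) (max (c' / δ) (1 / δ)))
  obtain ⟨X, hX⟩ : ∃ X : ℕ, X = 2 ^ r := ⟨_, rfl⟩
  have hrX : r ≤ X := hX ▸ Nat.lt_two_pow_self.le
  have hX1 : 1 ≤ X := hX ▸ Nat.one_le_two_pow
  have hX1r : (1 : ℝ) ≤ X := by exact_mod_cast hX1
  have hrXr : (r : ℝ) ≤ X := by exact_mod_cast hrX
  have hXA : A₀ ≤ X := by
    have : (A₀ : ℝ) ≤ X := ((le_max_left _ _).trans hr).trans hrXr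
    exact_mod_cast this
  have hXc : c' ≤ δ * X := by
    have := (((le_max_left _ _).trans (le_max_right _ _)).trans hr).trans hrXr
    rw [div_le_iff₀ hδ] at this
    linarith
  have hXδ : 1 ≤ δ * X := by
    have := (((le_max_right _ _).trans (le_max_right _ _)).trans hr).trans hrXr
    rw [div_le_iff₀ hδ] at this
    linarith
  obtain ⟨T, hT⟩ : ∃ T : ℕ, T = 2 ^ (C * X) := ⟨_, rfl⟩
  obtain ⟨Q, hQ⟩ : ∃ Q : ℕ, Q = (2 * q) ^ X := ⟨_, rfl⟩
  have hXT : X < T := by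
    rw [hT]
    exact Nat.lt_two_pow_self.trans_le (Nat.pow_le_pow_right (by norm_num)
      (Nat.le_mul_of_pos_left X (by omega)))
  have hT2 : 2 ≤ T := by omega
  have h2Q : 2 ∣ Q := by rw [hQ]; exact (Dvd.intro _ rfl : 2 ∣ 2 * q).trans (dvd_pow_self _ (by omega))
  have hQ0 : 0 < Q := by rw [hQ]; positivity
  have hQ2 : 2 ≤ Q := Nat.le_of_dvd hQ0 h2Q
  have hQT : Q ^ 4 ≤ T := by
    rw [hQ, hT, ← pow_mul, mul_comm X 4, pow_mul, pow_mul]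
    exact Nat.pow_le_pow_left hCq X
  have h4QT : Q ^ 2 * (2 * T) ^ 2 ≤ T ^ 3 := by
    have : 4 * Q ^ 2 ≤ T := by
      refine le_trans ?_ hQT
      have : 2 ^ 2 ≤ Q ^ 2 := Nat.pow_le_pow_left hQ2 2
      calc 4 * Q ^ 2 ≤ Q ^ 2 * Q ^ 2 := by gcongr; exact this
        _ = Q ^ 4 := by ring
    calc Q ^ 2 * (2 * T) ^ 2 = 4 * Q ^ 2 * T ^ 2 := by ring
      _ ≤ T * T ^ 2 := by gcongr
      _ = T ^ 3 := by ring
  have hT312 : T ^ 3 ≤ T ^ e := Nat.pow_le_pow_right (by omega) (by omega)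
  obtain ⟨M, hM⟩ : ∃ M : ℕ, M = T ^ e := ⟨_, rfl⟩
  have hharmM : harm M ≤ 13 * C * X := by
    rw [hM, hT, ← pow_mul]
    refine (harm_two_pow_le _).trans ?_
    push_cast
    rw [he]
    push_cast
    nlinarith
  have hharmT : harm T ≤ 2 * C * X := by
    rw [hT]
    refine (harm_two_pow_le _).trans ?_
    push_cast
    nlinarith
  set S : ℕ → ℝ := fun t => ∑ n ∈ Finset.Icc 1 M with
        (n ≠ Q ^ 2 * t ^ 2 + 1 ∧ n ≠ Q ^ 2 * t ^ 2),
        (r2 n : ℝ) / |(n : ℝ) - (Q ^ 2 * t ^ 2 + 1 : ℕ)| with hS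
  have hS0 : ∀ t, 0 ≤ S t := fun t => Finset.sum_nonneg fun _ _ => by positivity
  have havg : ∑ t ∈ Finset.Ico T (T + T), S t ≤ c * T * X ^ (A + 1) := by
    have := sum_sum_r2_div_le (e := e) (Q := Q) (M := M) hT2 hM.le
      (h4QT.trans (hT312.trans hM.ge))
    rw [← hA] at this
    refine this.trans ?_
    calc _ ≤ (2 : ℝ) ^ (2 * e + 8) * T * (13 * C * X) * (2 * C * X) ^ A := by
          have := harm_nonneg M
          have := harm_nonneg T
          gcongr
      _ = _ := by rw [hc, mul_pow (2 * (C : ℝ)) X A, pow_succ (X : ℝ) A]; ring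
  have hW := hsieve C hCC T r Q h2Q (by rw [hT, hX])
  rw [← hX] at hW
  set W := (Finset.Ico T (T + T)).filter fun t => IsRough (2 ^ X) (Q ^ 2 * t ^ 2 + 1) with hWd
  have hX24 : (2 : ℝ) ^ (24 * r) = (X : ℝ) ^ 24 := by
    rw [hX, mul_comm, pow_mul]; push_cast; rfl
  rw [hX24] at hW
  have hTr : (0 : ℝ) < T := by exact_mod_cast (by omega : 0 < T)
  -- If every sieved `t` had a larger sum, then the sieved set alone would contribute more than the
  -- bound for the whole range.
  obtain ⟨t, htW, htS⟩ : ∃ t ∈ W, S t ≤ 8 * c * X ^ (A + 1 + 24) := by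
    by_contra hcon
    push Not at hcon
    have h1 : (W.card : ℝ) * (8 * c * X ^ (A + 1 + 24)) ≤ ∑ t ∈ W, S t := by
      rw [← nsmul_eq_mul, ← Finset.sum_const]
      exact Finset.sum_le_sum fun t ht => (hcon t ht).le
    have h2 : ∑ t ∈ W, S t ≤ ∑ t ∈ Finset.Ico T (T + T), S t :=
      Finset.sum_le_sum_of_subset_of_nonneg (Finset.filter_subset _ _) fun t _ _ => hS0 t
    have h3 : (T : ℝ) / (4 * X ^ 24) * (8 * c * X ^ (A + 1 + 24)) = 2 * (c * T * X ^ (A + 1)) := by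
      rw [pow_add (X : ℝ) (A + 1) 24]; field_simp; ring
    have h4 : (T : ℝ) / (4 * X ^ 24) * (8 * c * X ^ (A + 1 + 24)) ≤
        (W.card : ℝ) * (8 * c * X ^ (A + 1 + 24)) :=
      mul_le_mul_of_nonneg_right hW (by positivity)
    have h5 : 0 < c * T * (X : ℝ) ^ (A + 1) := by positivity
    linarith
  obtain ⟨htI, htR⟩ := Finset.mem_filter.1 htW
  have htI' := Finset.mem_Ico.1 htI
  have ht0 : 0 < t := by omega
  have haQ : (Q * t) ^ 2 = Q ^ 2 * t ^ 2 := mul_pow _ _ _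
  have hN3 : (Q * t) ^ 2 + 1 ≤ T ^ 3 := by
    refine le_trans ?_ h4QT
    have : t + 1 ≤ 2 * T := by omega
    calc (Q * t) ^ 2 + 1 ≤ Q ^ 2 * (t + 1) ^ 2 := by
          have : 1 ≤ Q ^ 2 := Nat.one_le_pow _ _ hQ0
          rw [haQ]; nlinarith
      _ ≤ _ := by gcongr
  have hR : (X : ℝ) ^ (A + 1 + 24) * X ≤ r2 ((Q * t) ^ 2) := by
    have h1 := hrep X t ht0
    rw [← hQ] at h1
    have h2 : X ^ (A + 1 + 24 + 1) ≤ r2 ((Q * t) ^ 2) :=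
      (Nat.pow_le_pow_left (by omega) _).trans h1
    rw [pow_succ] at h2
    exact_mod_cast h2
  have hXp : (1 : ℝ) ≤ (X : ℝ) ^ (A + 1 + 24) := one_le_pow₀ hX1r
  refine ⟨Q * t, ?_, ?_, ?_, ?_⟩
  · have : t ≤ Q * t := Nat.le_mul_of_pos_left t hQ0
    omega
  · refine (r2_le_four_mul_card_divisors (by omega)).trans (Nat.mul_le_mul_left 4 ?_)
    refine card_divisors_le_of_isRough (z := 2 ^ X) (3 * C) (by omega) (by rwa [haQ]) ?_
    refine lt_of_le_of_lt hN3 ?_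
    rw [hT, ← pow_mul, ← pow_mul]
    refine Nat.pow_lt_pow_right (by norm_num) ?_
    nlinarith
  · calc 1 ≤ δ * X := hXδ
      _ = δ * (1 * X) := by ring
      _ ≤ δ * ((X : ℝ) ^ (A + 1 + 24) * X) := by gcongr
      _ ≤ _ := by gcongr
  · have h12 : ((Q * t) ^ 2 + 1) ^ 4 ≤ M := by
      calc ((Q * t) ^ 2 + 1) ^ 4 ≤ (T ^ 3) ^ 4 := Nat.pow_le_pow_left hN3 4
        _ = T ^ (3 * 4) := (pow_mul T 3 4).symm
        _ = M := by rw [hM, he]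
    have h2M : 2 * ((Q * t) ^ 2 + 1) ≤ M := by
      calc 2 * ((Q * t) ^ 2 + 1) ≤ T * T ^ 3 := Nat.mul_le_mul hT2 hN3
        _ = T ^ 4 := by ring
        _ ≤ M := by rw [hM]; exact Nat.pow_le_pow_right (by omega) (by omega)
    have h1 := tsum_farTerm_le h12 h2M
    rw [haQ] at h1
    have h2 : harm M ^ 2 ≤ (13 * C) ^ 2 * (X : ℝ) ^ (A + 1 + 24) := by
      calc harm M ^ 2 ≤ (13 * C * X) ^ 2 := by
            have := harm_nonneg M
            gcongr
        _ = (13 * C) ^ 2 * (X : ℝ) ^ 2 := by ring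
        _ ≤ _ := by
            exact mul_le_mul_of_nonneg_left (pow_le_pow_right₀ hX1r (by omega)) (by positivity)
    calc _ ≤ _ := h1
      _ ≤ 8 * c * X ^ (A + 1 + 24) + 4 * ((13 * C) ^ 2 * (X : ℝ) ^ (A + 1 + 24)) + 4 + 24 * s := by
          gcongr
      _ ≤ c' * (X : ℝ) ^ (A + 1 + 24) := by
          have h3 : 4 + 24 * s ≤ (4 + 24 * s) * (X : ℝ) ^ (A + 1 + 24) :=
            le_mul_of_one_le_right (by positivity) hXp
          rw [hc', add_assoc (8 * c + 4 * (13 * (C : ℝ)) ^ 2) 4, add_mul, add_mul]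
          linarith
      _ ≤ δ * X * (X : ℝ) ^ (A + 1 + 24) := by gcongr
      _ = δ * ((X : ℝ) ^ (A + 1 + 24) * X) := by ring
      _ ≤ _ := by gcongr

/-- The number of representations of `a² + 1` can be fixed. -/
theorem exists_isolated_eq : ∃ r : ℕ, ∀ δ > (0 : ℝ), ∀ A₀ : ℕ, ∃ a ≥ A₀, r2 (a ^ 2 + 1) = r ∧
    1 ≤ δ * r2 (a ^ 2) ∧ ∑' n, farTerm a n ≤ δ * r2 (a ^ 2) := by
  obtain ⟨K, hK⟩ := exists_isolated
  by_contra hcon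
  push Not at hcon
  choose δ hδ A hA using hcon
  -- Pigeonhole: if every `r ≤ K` failed with its own `δ` and `A`, the least of these `δ` together
  -- with the largest `A` would contradict `exists_isolated`.
  obtain ⟨a, ha, hr, h1, h2⟩ := hK ((Finset.range (K + 1)).inf' ⟨0, by simp⟩ δ)
    ((Finset.lt_inf'_iff _).2 fun r _ => hδ r) ((Finset.range (K + 1)).sup A)
  have hmem : r2 (a ^ 2 + 1) ∈ Finset.range (K + 1) := Finset.mem_range.2 (by omega)
  have hδle : (Finset.range (K + 1)).inf' ⟨0, by simp⟩ δ ≤ δ (r2 (a ^ 2 + 1)) :=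
    Finset.inf'_le _ hmem
  have hle := mul_le_mul_of_nonneg_right hδle (Nat.cast_nonneg (α := ℝ) (r2 (a ^ 2)))
  have := hA (r2 (a ^ 2 + 1)) a ((Finset.le_sup hmem).trans ha) rfl (h1.trans hle)
  linarith

open scoped ComplexConjugate

/-! ### Fourier series on the torus -/

theorem char_neg_apply (v : Fin 2 → ℤ) (x : Torus) : char (-v) x = conj (char v x) := by
  simp only [char, Pi.neg_apply, fourier_neg, ContinuousMap.coe_mk, map_prod]

theorem char_add_apply (v w : Fin 2 → ℤ) (x : Torus) : char (v + w) x = char v x * char w x := by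
  simp only [char, Pi.add_apply, fourier_add, ContinuousMap.coe_mk, ← Finset.prod_mul_distrib]

theorem char_add (v w : Fin 2 → ℤ) : char (v + w) = char v * char w :=
  ContinuousMap.ext (char_add_apply v w)

theorem char_zero : char 0 = 1 := by
  ext x
  simp [char]

theorem norm_char_apply (v : Fin 2 → ℤ) (x : Torus) : ‖char v x‖ = 1 := by
  simp only [char, fourier_apply, ContinuousMap.coe_mk, norm_prod, Circle.norm_coe,
    Finset.prod_const_one]

theorem conj_char_mul_char (v : Fin 2 → ℤ) (x : Torus) : conj (char v x) * char v x = 1 := by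
  rw [← char_neg_apply, ← char_add_apply, neg_add_cancel, char_zero]; rfl

theorem char_ne_zero (v : Fin 2 → ℤ) (x : Torus) : char v x ≠ 0 := by
  have := norm_char_apply v x
  intro h
  simp [h] at this

theorem char_single (x : Torus) (i : Fin 2) : char (Pi.single i 1) x = fourier 1 (x i) := by
  fin_cases i <;> simp [char]

/-- The span of the characters, as a star subalgebra. -/
noncomputable def charSubalgebra : StarSubalgebra ℂ C(Torus, ℂ) where
  toSubalgebra := Algebra.adjoin ℂ (Set.range char)
  star_mem' := by
    change Algebra.adjoin ℂ (Set.range char) ≤ star (Algebra.adjoin ℂ (Set.range char))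
    refine Algebra.adjoin_le ?_
    rintro _ ⟨n, rfl⟩
    refine Algebra.subset_adjoin ⟨-n, ?_⟩
    ext1 x
    simp only [char_neg_apply, starRingEnd_apply, ContinuousMap.star_apply]

theorem charSubalgebra_toSubmodule :
    charSubalgebra.toSubalgebra.toSubmodule = Submodule.span ℂ (Set.range char) := by
  apply Algebra.adjoin_eq_span_of_subset
  refine .trans (fun x ↦ Submonoid.closure_induction (fun _ ↦ id) ⟨0, char_zero⟩ ?_)
    Submodule.subset_span
  rintro _ _ _ _ ⟨m, rfl⟩ ⟨n, rfl⟩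
  exact ⟨m + n, char_add m n⟩

theorem charSubalgebra_separatesPoints : charSubalgebra.SeparatesPoints := by
  intro x y hxy
  rw [Ne, funext_iff, not_forall] at hxy
  obtain ⟨i, hi⟩ := hxy
  refine ⟨_, ⟨char (Pi.single i 1), Algebra.subset_adjoin ⟨Pi.single i 1, rfl⟩, rfl⟩, ?_⟩
  change char (Pi.single i 1) x ≠ char (Pi.single i 1) y
  rw [char_single, char_single, fourier_one, fourier_one]
  exact fun h => hi (AddCircle.injective_toCircle Real.two_pi_pos.ne' (Circle.ext h))

theorem span_char_closure_eq_top :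
    (Submodule.span ℂ (Set.range char)).topologicalClosure = ⊤ := by
  rw [← charSubalgebra_toSubmodule]
  exact congr_arg (Subalgebra.toSubmodule <| StarSubalgebra.toSubalgebra ·)
    (ContinuousMap.starSubalgebra_topologicalClosure_eq_top_of_separatesPoints _
      charSubalgebra_separatesPoints)

theorem span_toL2_char_closure_eq_top :
    (Submodule.span ℂ (Set.range fun v => toL2 (char v))).topologicalClosure = ⊤ := by
  have : (haarTorus).WeaklyRegular := inferInstance
  have h := (ContinuousMap.toLp_denseRange (p := 2) ℂ haarTorus ℂ
    ENNReal.ofNat_ne_top).topologicalClosure_map_submodule span_char_closure_eq_top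
  simp only [Submodule.map_span, ContinuousLinearMap.coe_coe, ← Set.range_comp,
    Function.comp_def] at h
  exact h

theorem inner_toL2 (f g : C(Torus, ℂ)) :
    (inner ℂ (toL2 f) (toL2 g) : ℂ) = ∫ x, g x * conj (f x) ∂haarTorus :=
  ContinuousMap.inner_toLp haarTorus f g

theorem integral_char (w : Fin 2 → ℤ) : ∫ x, char w x ∂haarTorus = if w = 0 then 1 else 0 := by
  split_ifs with h
  · subst h
    simp [char_zero]
  · obtain ⟨i, hi⟩ := Function.ne_iff.mp h
    simp only [char, ContinuousMap.coe_mk]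
    unfold haarTorus
    rw [MeasureTheory.integral_fintype_prod_eq_prod (fun i => (fourier (w i) : AddCircle (2 * Real.pi) → ℂ))]
    apply Finset.prod_eq_zero (Finset.mem_univ i)
    have h1 := (orthonormal_iff_ite.mp <| orthonormal_fourier (T := 2 * Real.pi)) 0 (w i)
    rw [if_neg (fun h => hi h.symm), ContinuousMap.inner_toLp] at h1
    simpa using h1

theorem orthonormal_char : Orthonormal ℂ fun v => toL2 (char v) := by
  rw [orthonormal_iff_ite]
  intro m n
  simp only [inner_toL2, ← char_neg_apply, ← char_add_apply]
  rw [integral_char]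
  have : n + -m = 0 ↔ m = n := by rw [add_neg_eq_zero, eq_comm]
  simp only [this]

/-- The characters form a Hilbert basis of `L²(𝕋²)`. -/
noncomputable def charBasis : HilbertBasis (Fin 2 → ℤ) ℂ L2 :=
  HilbertBasis.mk orthonormal_char span_toL2_char_closure_eq_top.ge

theorem charBasis_apply (v : Fin 2 → ℤ) : charBasis v = toL2 (char v) := by
  simp [charBasis]

theorem charBasis_repr (f : L2) (v : Fin 2 → ℤ) : charBasis.repr f v = coef f v := by
  rw [HilbertBasis.repr_apply_apply, charBasis_apply]; rfl

theorem ext_coef {f g : L2} (h : ∀ v, coef f v = coef g v) : f = g := by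
  apply charBasis.repr.injective
  ext v
  simp only [charBasis_repr, h]

theorem coef_add (f g : L2) (v : Fin 2 → ℤ) : coef (f + g) v = coef f v + coef g v :=
  inner_add_right _ _ _

theorem coef_sub (f g : L2) (v : Fin 2 → ℤ) : coef (f - g) v = coef f v - coef g v :=
  inner_sub_right _ _ _

theorem coef_smul (c : ℂ) (f : L2) (v : Fin 2 → ℤ) : coef (c • f) v = c * coef f v :=
  inner_smul_right _ _ _

theorem coef_zero (v : Fin 2 → ℤ) : coef 0 v = 0 := inner_zero_right _

theorem coef_toL2_char (v w : Fin 2 → ℤ) : coef (toL2 (char w)) v = if v = w then 1 else 0 :=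
  orthonormal_iff_ite.mp orthonormal_char v w

theorem summable_norm_coef_sq (f : L2) : Summable fun v => ‖coef f v‖ ^ 2 := by
  have := lp.memℓp (charBasis.repr f)
  rw [memℓp_gen_iff (by norm_num)] at this
  simpa [charBasis_repr] using this

theorem tsum_norm_coef_sq (f : L2) : ∑' v, ‖coef f v‖ ^ 2 = ‖f‖ ^ 2 := by
  have := lp.norm_rpow_eq_tsum (p := 2) (by norm_num) (charBasis.repr f)
  simpa [charBasis_repr] using this.symm

/-- An element of `L²(𝕋²)` with prescribed square summable Fourier coefficients. -/
theorem exists_coef_eq {c : (Fin 2 → ℤ) → ℂ} (hc : Summable fun v => ‖c v‖ ^ 2) :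
    ∃ f : L2, ∀ v, coef f v = c v := by
  have hm : Memℓp c 2 := by
    rw [memℓp_gen_iff (by norm_num)]
    simpa using hc
  refine ⟨charBasis.repr.symm ⟨c, hm⟩, fun v => ?_⟩
  rw [← charBasis_repr, LinearIsometryEquiv.apply_symm_apply]

theorem hasSum_coef_smul (f : L2) : HasSum (fun v => coef f v • toL2 (char v)) f := by
  have := charBasis.hasSum_repr f
  simpa only [charBasis_repr, charBasis_apply] using this

/-! ### Sums over lattice points by energy -/

theorem normSq_nonneg (v : Fin 2 → ℤ) : 0 ≤ normSq v := by unfold normSq; positivity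

/-- The energy `|v|²` as a natural number. -/
def energy (v : Fin 2 → ℤ) : ℕ := (normSq v).toNat

theorem energy_cast (v : Fin 2 → ℤ) : (energy v : ℤ) = normSq v :=
  Int.toNat_of_nonneg (normSq_nonneg v)

theorem normSq_eq_energy {R : Type*} [Ring R] (v : Fin 2 → ℤ) : (normSq v : R) = (energy v : R) := by
  rw [← energy_cast]; simp

theorem energy_eq_iff {v : Fin 2 → ℤ} {n : ℕ} : energy v = n ↔ normSq v = n := by
  rw [← energy_cast]; exact_mod_cast Iff.rfl

instance finite_fiber_energy (n : ℕ) : Finite (energy ⁻¹' {n}) := by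
  have : energy ⁻¹' {n} = {v | normSq v = n} := by
    ext v; simp [energy_eq_iff]
  rw [this]
  exact finite_sphere n

theorem card_fiber_energy (n : ℕ) : Nat.card (energy ⁻¹' {n}) = r2 n := by
  have : energy ⁻¹' {n} = {v | normSq v = n} := by
    ext v; simp [energy_eq_iff]
  rw [this, Nat.card_coe_set_eq]; rfl

theorem tsum_fiber_energy {E : Type*} [NormedAddCommGroup E] [NormedSpace ℝ E] (h : ℕ → E) (n : ℕ) :
    ∑' v : energy ⁻¹' {n}, h (energy v) = (r2 n : ℝ) • h n := by
  have : ∀ v : energy ⁻¹' {n}, h (energy v) = h n := fun v => by rw [v.2]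
  have hf := Fintype.ofFinite (energy ⁻¹' {n})
  simp_rw [this]
  rw [tsum_fintype, Finset.sum_const, Finset.card_univ, ← Nat.card_eq_fintype_card,
    card_fiber_energy, Nat.cast_smul_eq_nsmul]

theorem summable_energy_iff {h : ℕ → ℝ} (hh : ∀ n, 0 ≤ h n) :
    (Summable fun v : Fin 2 → ℤ => h (energy v)) ↔ Summable fun n => (r2 n : ℝ) * h n := by
  rw [← (Equiv.sigmaFiberEquiv energy).summable_iff]
  refine (summable_sigma_of_nonneg
    (f := (fun v => h (energy v)) ∘ Equiv.sigmaFiberEquiv energy) fun _ => hh _).trans ?_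
  have h1 : ∀ n : ℕ, ∑' v : {v // energy v = n},
      ((fun v => h (energy v)) ∘ Equiv.sigmaFiberEquiv energy) ⟨n, v⟩ = r2 n * h n :=
    fun n => tsum_fiber_energy h n
  have h2 : ∀ n : ℕ, Finite {v // energy v = n} := finite_fiber_energy
  simp only [h1]
  refine and_iff_right fun n => ?_
  have := h2 n
  exact Summable.of_finite

theorem hasSum_energy {h : ℕ → ℂ} (hh : Summable fun n => (r2 n : ℝ) * ‖h n‖) :
    HasSum (fun v : Fin 2 → ℤ => h (energy v)) (∑' n, (r2 n : ℝ) • h n) := by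
  have h1 : Summable fun v : Fin 2 → ℤ => h (energy v) :=
    Summable.of_norm ((summable_energy_iff fun n => norm_nonneg (h n)).2 hh)
  have h2 := h1.hasSum.tsum_fiberwise energy
  simp only [tsum_fiber_energy] at h2
  rw [h2.tsum_eq]
  exact h1.hasSum

/-! ### Summability of the spectral sums -/

theorem summable_r2_div : Summable fun n : ℕ => (r2 n : ℝ) / ((n : ℝ) ^ 2 + 1) := by
  have h : Summable fun n : ℕ => 6 * (n : ℝ) ^ (-(3 / 2) : ℝ) :=
    (Real.summable_nat_rpow.2 (by norm_num)).mul_left 6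
  refine Summable.of_norm_bounded_eventually_nat h ?_
  filter_upwards [eventually_ge_atTop 1] with n hn
  have hn0 : (0 : ℝ) < n := by exact_mod_cast hn
  rw [Real.norm_of_nonneg (by positivity)]
  calc (r2 n : ℝ) / ((n : ℝ) ^ 2 + 1) ≤ 6 * (n : ℝ) ^ (1 / 2 : ℝ) / (n : ℝ) ^ 2 := by
        gcongr
        · exact r2_le_six_sqrt hn
        · linarith
    _ = 6 * (n : ℝ) ^ (-(3 / 2) : ℝ) := by
        rw [← Real.rpow_natCast, mul_div_assoc, ← Real.rpow_sub hn0]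
        norm_num

theorem c0_pos : 0 < c0 := by
  refine summable_r2_div.tsum_pos (fun n => by positivity) 0 ?_
  have : 0 < r2 0 := by simpa using r2_pos_of_sq_add_sq 0 0
  positivity

theorem summable_of_abs_le_eventually {f : ℕ → ℝ} (C : ℝ) (l : ℝ)
    (h : ∀ n : ℕ, 2 * |l| + 1 ≤ n → |f n| ≤ C * ((r2 n : ℝ) / ((n : ℝ) ^ 2 + 1))) : Summable f := by
  refine Summable.of_norm_bounded_eventually_nat (summable_r2_div.mul_left C) ?_
  filter_upwards [eventually_ge_atTop ⌈2 * |l| + 1⌉₊] with n hn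
  exact h n (Nat.ceil_le.1 hn)

theorem summable_specTerm (l : ℝ) : Summable (specTerm l) := by
  refine summable_of_abs_le_eventually (2 * (1 + |l|)) l fun n hn => ?_
  have h1 := abs_nonneg l
  have h2 := le_abs_self l
  have hnl : (n : ℝ) / 2 ≤ n - l := by linarith
  have hn1 : (1 : ℝ) ≤ n := by linarith
  unfold specTerm
  have e : 1 / ((n : ℝ) - l) - n / ((n : ℝ) ^ 2 + 1) = (1 + n * l) / ((n - l) * ((n : ℝ) ^ 2 + 1)) := by
    have : (n : ℝ) - l ≠ 0 := by linarith
    field_simp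
    ring
  rw [e, abs_mul, Nat.abs_cast, abs_div, abs_of_pos (a := ((n : ℝ) - l) * ((n : ℝ) ^ 2 + 1))
    (mul_pos (by linarith) (by positivity))]
  have h3 : |1 + n * l| ≤ n * (1 + |l|) := by
    calc |1 + n * l| ≤ |1| + |n * l| := abs_add_le _ _
      _ = 1 + n * |l| := by rw [abs_one, abs_mul, Nat.abs_cast]
      _ ≤ _ := by linarith
  calc (r2 n : ℝ) * (|1 + n * l| / ((n - l) * ((n : ℝ) ^ 2 + 1)))
      ≤ r2 n * (n * (1 + |l|) / ((n : ℝ) / 2 * ((n : ℝ) ^ 2 + 1))) := by gcongr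
    _ = _ := by field_simp

theorem summable_r2_div_sub_sq (l : ℝ) : Summable fun n : ℕ => (r2 n : ℝ) * (1 / ((n : ℝ) - l) ^ 2) := by
  refine summable_of_abs_le_eventually 8 l fun n hn => ?_
  have h1 := abs_nonneg l
  have h2 := le_abs_self l
  have hnl : (n : ℝ) / 2 ≤ n - l := by linarith
  have hn1 : (1 : ℝ) ≤ n := by linarith
  rw [abs_of_nonneg (by positivity)]
  calc (r2 n : ℝ) * (1 / ((n : ℝ) - l) ^ 2) ≤ r2 n * (1 / ((n : ℝ) / 2) ^ 2) := by gcongr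
    _ = r2 n * (8 / ((n : ℝ) ^ 2 + n ^ 2)) := by field_simp; ring
    _ ≤ r2 n * (8 / ((n : ℝ) ^ 2 + 1)) := by gcongr; nlinarith
    _ = _ := by ring

theorem summable_norm_div_sub_sq (c : ℂ) (x₀ : Torus) (l : ℝ) :
    Summable fun v : Fin 2 → ℤ => ‖c * (conj (char v x₀) / ((normSq v : ℂ) - l))‖ ^ 2 := by
  have h := ((summable_energy_iff (h := fun n => 1 / ((n : ℝ) - l) ^ 2)
    fun n => by positivity).2 (summable_r2_div_sub_sq l)).mul_left (‖c‖ ^ 2)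
  refine h.congr fun v => ?_
  rw [normSq_eq_energy, norm_mul, norm_div, RCLike.norm_conj, norm_char_apply, mul_pow, div_pow,
    one_pow]
  rw [← Complex.ofReal_natCast, ← Complex.ofReal_sub, Complex.norm_real, Real.norm_eq_abs, sq_abs]

/-! ### The Green's function -/

/-- The coefficients are square summable, so they belong to some `f` in `L²`, and the series that
defines `green` is the convergent Fourier expansion of `f`. The hypothesis covers `z = i` and `z =
-i` together. -/
theorem coef_green_of_sq {z : ℂ} (x₀ : Torus)
    (hz : ∀ n : ℕ, ‖(n : ℂ) - z‖ ^ 2 = (n : ℝ) ^ 2 + 1) (v : Fin 2 → ℤ) :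
    coef (green x₀ z) v =
      -(1 / (4 * (Real.pi : ℂ) ^ 2)) * (conj (char v x₀) / ((normSq v : ℂ) - z)) := by
  have h1 := ((summable_energy_iff (h := fun n => 1 / ((n : ℝ) ^ 2 + 1))
    fun n => by positivity).2 (by simpa [div_eq_mul_inv] using summable_r2_div)).mul_left
    (‖-(1 / (4 * (Real.pi : ℂ) ^ 2))‖ ^ 2)
  obtain ⟨f, hf⟩ := exists_coef_eq
    (c := fun v => -(1 / (4 * (Real.pi : ℂ) ^ 2)) * (conj (char v x₀) / ((normSq v : ℂ) - z))) (by
      refine h1.congr fun v => ?_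
      rw [normSq_eq_energy, norm_mul, norm_div, RCLike.norm_conj, norm_char_apply, mul_pow, div_pow,
        one_pow, hz])
  have : green x₀ z = f := by
    rw [← (hasSum_coef_smul f).tsum_eq]
    simp only [hf]
    rfl
  rw [this, hf]

theorem norm_natCast_sub_I_sq (n : ℕ) : ‖(n : ℂ) - Complex.I‖ ^ 2 = (n : ℝ) ^ 2 + 1 := by
  rw [← Complex.normSq_eq_norm_sq, Complex.normSq_apply]
  simp; ring

theorem norm_natCast_sub_neg_I_sq (n : ℕ) : ‖(n : ℂ) - -Complex.I‖ ^ 2 = (n : ℝ) ^ 2 + 1 := by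
  rw [← Complex.normSq_eq_norm_sq, Complex.normSq_apply]
  simp; ring

theorem natCast_sub_I_ne_zero (n : ℕ) : (n : ℂ) - Complex.I ≠ 0 := by
  intro h
  have := norm_natCast_sub_I_sq n
  rw [h, norm_zero] at this
  nlinarith [sq_nonneg (n : ℝ)]

theorem natCast_sub_neg_I_ne_zero (n : ℕ) : (n : ℂ) - -Complex.I ≠ 0 := by
  intro h
  have := norm_natCast_sub_neg_I_sq n
  rw [h, norm_zero] at this
  nlinarith [sq_nonneg (n : ℝ)]

/-! ### The graph of the point scatterer -/

/-- The defect of `H_φ` from acting as multiplication by `|v|²` on Fourier coefficients. -/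
theorem coef_snd_of_mem_graph {x₀ : Torus} {φ : ℝ} {p : L2 × L2} (hp : p ∈ scattererGraph x₀ φ) :
    ∃ c : ℂ, ∀ v, coef p.2 v = normSq v * coef p.1 v + c * conj (char v x₀) := by
  obtain ⟨f, h, a, hL, -, h1, h2⟩ := hp
  -- The coefficients of `z G_z` exceed `|v|²` times those of `G_z` by the conjugate character over
  -- `4π²`, whatever `z` is; the two deficiency vectors enter with weights `1` and `exp (iφ)`.
  refine ⟨a * (1 / (4 * (Real.pi : ℂ) ^ 2)) * (1 + Complex.exp (φ * Complex.I)), fun v => ?_⟩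
  have e1 := natCast_sub_I_ne_zero (energy v)
  have e2 := natCast_sub_neg_I_ne_zero (energy v)
  rw [h1, h2]
  simp only [coef_add, coef_smul, coef_sub, coef_green_of_sq x₀ norm_natCast_sub_I_sq,
    coef_green_of_sq x₀ norm_natCast_sub_neg_I_sq, hL v, normSq_eq_energy]
  have e3 : (Real.pi : ℂ) ≠ 0 := by exact_mod_cast Real.pi_ne_zero
  field_simp
  ring

/-- The coefficients of `p.2` would otherwise have a constant nonzero modulus, that is, a delta
function would lie in `L²`. This makes the graph that of a function. -/
theorem snd_eq_zero_of_mem_graph {x₀ : Torus} {φ : ℝ} {p : L2 × L2} (hp : p ∈ scattererGraph x₀ φ)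
    (h0 : p.1 = 0) : p.2 = 0 := by
  obtain ⟨c, hc⟩ := coef_snd_of_mem_graph hp
  simp only [h0, coef_zero, mul_zero, zero_add] at hc
  have h := summable_norm_coef_sq p.2
  simp only [hc, norm_mul, RCLike.norm_conj, norm_char_apply, mul_one] at h
  have hc0 : c = 0 := by simpa using (summable_const_iff _).1 h
  refine ext_coef fun v => ?_
  rw [hc, hc0, zero_mul, coef_zero]

theorem mem_graph_scatterer_iff {x₀ : Torus} {φ : ℝ} {p : L2 × L2} :
    p ∈ scattererGraph x₀ φ ↔ ∃ y : (scatterer x₀ φ).domain, (y : L2) = p.1 ∧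
      scatterer x₀ φ y = p.2 := by
  rw [← LinearPMap.mem_graph_iff, scatterer, Submodule.toLinearPMap_graph_eq]
  exact fun _ => snd_eq_zero_of_mem_graph

/-- The Fourier coefficients of an eigenfunction. -/
theorem coef_of_isEigenfunction {x₀ : Torus} {cpl : Coupling} {l : ℝ} {g : L2}
    (hg : IsEigenfunction x₀ cpl l g) (hl : ∀ n ∈ N2, l ≠ n) :
    ∃ c : ℂ, ∀ v, coef g v = c * (conj (char v x₀) / ((normSq v : ℂ) - l)) := by
  obtain ⟨-, hdom, heq⟩ := hg
  have hmem : (g, (l : ℂ) • g) ∈ scattererGraph x₀ (cpl.angle l) :=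
    mem_graph_scatterer_iff.2 ⟨⟨g, hdom⟩, rfl, heq⟩
  obtain ⟨c, hc⟩ := coef_snd_of_mem_graph hmem
  refine ⟨-c, fun v => ?_⟩
  have h := hc v
  simp only [coef_smul] at h
  have hne : (normSq v : ℂ) - l ≠ 0 := by
    have hn : energy v ∈ N2 := by
      have : 0 < Nat.card (energy ⁻¹' {energy v}) :=
        Nat.card_pos_iff.2 ⟨⟨⟨v, rfl⟩⟩, inferInstance⟩
      rwa [card_fiber_energy] at this
    rw [normSq_eq_energy, sub_ne_zero]
    exact_mod_cast (hl _ hn).symm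
  rw [mul_div_assoc', eq_div_iff hne]
  linear_combination -h

theorem one_add_exp_mul_I (φ : ℝ) : 1 + Complex.exp (φ * Complex.I) =
    2 * Complex.cos (φ / 2) * Complex.exp (φ / 2 * Complex.I) := by
  have : Complex.exp (φ * Complex.I) = Complex.exp (φ / 2 * Complex.I) ^ 2 := by
    rw [← Complex.exp_nat_mul]; congr 1; push_cast; ring
  rw [this, Complex.exp_mul_I]
  linear_combination -(Complex.sin_sq_add_cos_sq (φ / 2 : ℂ)) +
    Complex.sin (φ / 2) ^ 2 * Complex.I_sq

theorem one_sub_exp_mul_I (φ : ℝ) : Complex.I * (1 - Complex.exp (φ * Complex.I)) =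
    2 * Complex.sin (φ / 2) * Complex.exp (φ / 2 * Complex.I) := by
  have : Complex.exp (φ * Complex.I) = Complex.exp (φ / 2 * Complex.I) ^ 2 := by
    rw [← Complex.exp_nat_mul]; congr 1; push_cast; ring
  rw [this, Complex.exp_mul_I]
  linear_combination -Complex.I * (Complex.sin_sq_add_cos_sq (φ / 2 : ℂ)) -
    (Complex.sin (φ / 2) ^ 2 * Complex.I + 2 * Complex.sin (φ / 2) * Complex.cos (φ / 2)) * Complex.I_sq

theorem cos_half_pos {φ : ℝ} (hφ : φ ∈ Set.Ioo (-Real.pi) Real.pi) : 0 < Real.cos (φ / 2) :=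
  Real.cos_pos_of_mem_Ioo ⟨by linarith [hφ.1], by linarith [hφ.2]⟩

theorem one_add_exp_ne_zero {φ : ℝ} (hφ : φ ∈ Set.Ioo (-Real.pi) Real.pi) :
    1 + Complex.exp (φ * Complex.I) ≠ 0 := by
  rw [one_add_exp_mul_I]
  have h : Complex.cos (φ / 2) ≠ 0 := by
    have := (cos_half_pos hφ).ne'
    exact_mod_cast this
  simp [h]

/-- Translates von Neumann's phase into `tan (φ / 2)`: the value at `x₀` of the regular part weighs
the spectral sum with `1 + exp (iφ)` and `c₀` with `i (1 - exp (iφ))`. -/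
theorem one_add_exp_mul_tan {φ : ℝ} (hφ : φ ∈ Set.Ioo (-Real.pi) Real.pi) :
    (1 + Complex.exp (φ * Complex.I)) * Real.tan (φ / 2) =
      Complex.I * (1 - Complex.exp (φ * Complex.I)) := by
  have h : Complex.cos (φ / 2) ≠ 0 := by
    have := (cos_half_pos hφ).ne'
    exact_mod_cast this
  rw [one_add_exp_mul_I, one_sub_exp_mul_I, Real.tan_eq_sin_div_cos]
  push_cast
  field_simp

/-- The candidate has coefficients proportional to `conj (char v x₀) / (|v|² - l)`, scaled so that
its singular part is exactly `G_i + exp (iφ) G_{-i}`. The remainder vanishes at `x₀` precisely by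
the spectral equation. The scaling factor is not zero because `φ` is not `±π`. -/
theorem exists_mem_graph {x₀ : Torus} {φ l : ℝ} (hφ : φ ∈ Set.Ioo (-Real.pi) Real.pi)
    (hl : ∀ n ∈ N2, l ≠ n) (hs : ∑' n, specTerm l n = c0 * Real.tan (φ / 2)) :
    ∃ g : L2, g ≠ 0 ∧ (g, (l : ℂ) • g) ∈ scattererGraph x₀ φ := by
  obtain ⟨e, he⟩ : ∃ e, e = Complex.exp (φ * Complex.I) := ⟨_, rfl⟩
  obtain ⟨κ, hκ⟩ : ∃ κ : ℂ, κ = -(1 / (4 * (Real.pi : ℂ) ^ 2)) := ⟨_, rfl⟩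
  have hκ0 : κ ≠ 0 := by
    have e3 : (Real.pi : ℂ) ≠ 0 := by exact_mod_cast Real.pi_ne_zero
    rw [hκ]; simp [e3]
  have hn : ∀ v, energy v ∈ N2 := fun v => by
    have : 0 < Nat.card (energy ⁻¹' {energy v}) :=
      Nat.card_pos_iff.2 ⟨⟨⟨v, rfl⟩⟩, inferInstance⟩
    rwa [card_fiber_energy] at this
  have hne : ∀ v, (energy v : ℂ) - l ≠ 0 := fun v => by
    rw [sub_ne_zero]
    exact_mod_cast (hl _ (hn v)).symm
  obtain ⟨g, hg⟩ := exists_coef_eq (summable_norm_div_sub_sq (κ * (1 + e)) x₀ l)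
  refine ⟨g, ?_, g - (green x₀ Complex.I + e • green x₀ (-Complex.I)),
    (l : ℂ) • g - (Complex.I • green x₀ Complex.I - (Complex.I * e) • green x₀ (-Complex.I)), 1,
    fun v => ?_, ?_, ?_, ?_⟩
  · rintro rfl
    have h := hg 0
    rw [coef_zero] at h
    have h1 := one_add_exp_ne_zero hφ
    rw [← he] at h1
    have h2 := hne 0
    rw [normSq_eq_energy] at h
    have h3 : conj (char 0 x₀) ≠ 0 := by simpa using char_ne_zero 0 x₀
    exact mul_ne_zero (mul_ne_zero hκ0 h1) (div_ne_zero h3 h2) h.symm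
  · have e1 := natCast_sub_I_ne_zero (energy v)
    have e2 := natCast_sub_neg_I_ne_zero (energy v)
    have e3 := hne v
    simp only [coef_add, coef_smul, coef_sub, coef_green_of_sq x₀ norm_natCast_sub_I_sq,
      coef_green_of_sq x₀ norm_natCast_sub_neg_I_sq, hg, normSq_eq_energy, ← hκ]
    field_simp
    ring
  · obtain ⟨h, hh⟩ : ∃ h : ℕ → ℂ, h = fun n : ℕ => κ * ((1 + e) *
        ((1 / ((n : ℝ) - l) - n / ((n : ℝ) ^ 2 + 1) : ℝ) : ℂ) -
        Complex.I * (1 - e) * ((1 / ((n : ℝ) ^ 2 + 1) : ℝ) : ℂ)) := ⟨_, rfl⟩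
    have hterm : ∀ n : ℕ, (r2 n : ℝ) • h n = κ * ((1 + e) * (specTerm l n : ℂ) -
        Complex.I * (1 - e) * (((r2 n : ℝ) / ((n : ℝ) ^ 2 + 1) : ℝ) : ℂ)) := fun n => by
      rw [hh, Complex.real_smul, specTerm]
      push_cast
      ring
    have h1 : Summable fun n => (specTerm l n : ℂ) :=
      Complex.ofRealCLM.summable (summable_specTerm l)
    have h2 : Summable fun n : ℕ => (((r2 n : ℝ) / ((n : ℝ) ^ 2 + 1) : ℝ) : ℂ) :=
      Complex.ofRealCLM.summable summable_r2_div
    have h3 : HasSum (fun n : ℕ => (r2 n : ℝ) • h n) 0 := by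
      have h4 := ((h1.hasSum.mul_left (1 + e)).sub
        (h2.hasSum.mul_left (Complex.I * (1 - e)))).mul_left κ
      have h5 := one_add_exp_mul_tan hφ
      have h8 : κ * ((1 + e) * ∑' n, (specTerm l n : ℂ) - Complex.I * (1 - e) *
          ∑' n : ℕ, (((r2 n : ℝ) / ((n : ℝ) ^ 2 + 1) : ℝ) : ℂ)) = 0 := by
        rw [← Complex.ofReal_tsum, ← Complex.ofReal_tsum, hs, he, ← h5]
        change κ * (_ - _ * (c0 : ℂ)) = 0
        push_cast
        ring
      rw [h8] at h4
      simpa only [hterm] using h4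
    have h6 : Summable fun n => (r2 n : ℝ) * ‖h n‖ := by
      refine h3.summable.norm.congr fun n => ?_
      rw [norm_smul, Real.norm_natCast]
    have h7 := hasSum_energy h6
    rw [h3.tsum_eq] at h7
    have hterm' : ∀ v, coef (g - (green x₀ Complex.I + e • green x₀ (-Complex.I))) v * char v x₀ =
        h (energy v) := fun v => ?_
    · change HasSum (fun v => _) 0
      simpa only [hterm'] using h7
    have e1 := natCast_sub_I_ne_zero (energy v)
    have e2 := natCast_sub_neg_I_ne_zero (energy v)
    have e4 : (energy v : ℂ) ^ 2 + 1 = (energy v - Complex.I) * (energy v - -Complex.I) := by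
      linear_combination Complex.I_sq
    have e5 : 1 / ((energy v : ℂ) - Complex.I) = (energy v + Complex.I) / ((energy v : ℂ) ^ 2 + 1) := by
      rw [e4]; field_simp; ring
    have e6 : 1 / ((energy v : ℂ) - -Complex.I) = (energy v - Complex.I) / ((energy v : ℂ) ^ 2 + 1) := by
      rw [e4]; field_simp
    simp only [coef_add, coef_smul, coef_sub, coef_green_of_sq x₀ norm_natCast_sub_I_sq,
      coef_green_of_sq x₀ norm_natCast_sub_neg_I_sq, hg, normSq_eq_energy, ← hκ, hh]
    push_cast
    have e7 := conj_char_mul_char v x₀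
    generalize conj (char v x₀) = E at e7 ⊢
    calc _ = E * char v x₀ * (κ * ((1 + e) * (1 / ((energy v : ℂ) - l)) -
          1 / ((energy v : ℂ) - Complex.I) - e * (1 / ((energy v : ℂ) - -Complex.I)))) := by ring
      _ = _ := by rw [e7, e5, e6]; ring
  · simp [he]
  · simp [he]

theorem exists_isEigenfunction {x₀ : Torus} {cpl : Coupling} {l : ℝ}
    (hφ : cpl.angle l ∈ Set.Ioo (-Real.pi) Real.pi) (hl : ∀ n ∈ N2, l ≠ n)
    (hs : ∑' n, specTerm l n = c0 * Real.tan (cpl.angle l / 2)) :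
    ∃ g : L2, IsEigenfunction x₀ cpl l g := by
  obtain ⟨g, hg0, hg⟩ := exists_mem_graph (x₀ := x₀) hφ hl hs
  have h1 := (scattererGraph x₀ (cpl.angle l)).smul_mem ((‖g‖ : ℂ)⁻¹) hg
  obtain ⟨y, hy, hy'⟩ := mem_graph_scatterer_iff.1 h1
  refine ⟨(‖g‖ : ℂ)⁻¹ • g, ?_, ?_, ?_⟩
  · rw [norm_smul, norm_inv, Complex.norm_real, norm_norm, inv_mul_cancel₀ (norm_ne_zero_iff.2 hg0)]
  · have := y.2
    rwa [hy] at this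
  · have e : y = ⟨(‖g‖ : ℂ)⁻¹ • g, by have := y.2; rwa [hy] at this⟩ := Subtype.ext hy
    rw [← e, hy', Prod.smul_snd, smul_comm]

theorem mem_spec_of_eigenvector {H : L2 →ₗ.[ℂ] L2} {z : ℂ} {g : L2} (hg0 : g ≠ 0)
    (hg : g ∈ H.domain) (h : H ⟨g, hg⟩ = z • g) : z ∈ spec H := by
  rintro ⟨R, -, hR⟩
  have := hR ⟨g, hg⟩
  rw [h, sub_self, map_zero] at this
  exact hg0 this.symm

/-! ### New eigenvalues from the spectral equation -/

/-- The constant angle of a coupling. -/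
def Coupling.phase : Coupling → ℝ
  | .weak φ => φ
  | .strong φ _ => φ

/-- The energies that enter the spectral equation. -/
def Coupling.energies : Coupling → ℝ → Set ℕ
  | .weak _, _ => Set.univ
  | .strong _ η, l => window η l

/-- For strong coupling the angle is designed to absorb the energies outside the window, so the
truncated equation for the constant phase is the full equation for the angle at `l`. -/
theorem angle_spec {cpl : Coupling} (h : cpl.Admissible) {l : ℝ}
    (hs : ∑' n : cpl.energies l, specTerm l n = c0 * Real.tan (cpl.phase / 2)) :
    cpl.angle l ∈ Set.Ioo (-Real.pi) Real.pi ∧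
      ∑' n, specTerm l n = c0 * Real.tan (cpl.angle l / 2) := by
  cases cpl with
  | weak φ =>
    refine ⟨h, ?_⟩
    rw [← tsum_univ]
    exact hs
  | strong φ η =>
    simp only [Coupling.energies, Coupling.phase, Coupling.angle] at hs ⊢
    refine ⟨⟨?_, ?_⟩, ?_⟩
    · linarith [Real.neg_pi_div_two_lt_arctan (Real.tan (φ / 2) +
        (∑' n : ↥(N2 \ window η l), specTerm l n) / c0)]
    · linarith [Real.arctan_lt_pi_div_two (Real.tan (φ / 2) +
        (∑' n : ↥(N2 \ window η l), specTerm l n) / c0)]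
    · rw [mul_div_cancel_left₀ _ two_ne_zero, Real.tan_arctan, mul_add, ← hs,
        mul_div_cancel₀ _ c0_pos.ne', tsum_subtype, tsum_subtype,
        ← ((summable_specTerm l).indicator _).tsum_add ((summable_specTerm l).indicator _)]
      refine tsum_congr fun n => ?_
      by_cases h1 : n ∈ window η l
      · simp [h1]
      · by_cases h2 : n ∈ N2
        · simp [h1, h2]
        · have : r2 n = 0 := by simpa [N2] using h2
          simp [h1, h2, specTerm, this]

theorem mem_newEigenvalues (x₀ : Torus) {cpl : Coupling} (h : cpl.Admissible) {l : ℝ} (h0 : 0 < l)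
    (hl : ∀ n ∈ N2, l ≠ n)
    (hs : ∑' n : cpl.energies l, specTerm l n = c0 * Real.tan (cpl.phase / 2)) :
    l ∈ newEigenvalues x₀ cpl ∧ ∃ u, IsEigenfunction x₀ cpl l u := by
  obtain ⟨h1, h2⟩ := angle_spec h hs
  obtain ⟨u, hu⟩ := exists_isEigenfunction (x₀ := x₀) h1 hl h2
  refine ⟨?_, u, hu⟩
  cases cpl with
  | weak φ =>
    refine ⟨?_, hl⟩
    obtain ⟨hn, hd, he⟩ := hu
    refine mem_spec_of_eigenvector ?_ hd he
    rintro rfl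
    simp at hn
  | strong φ η => exact ⟨h0, hl, hs⟩

/-! ### Isolated new eigenvalues -/

theorem half_dist_le {N n : ℕ} {l : ℝ} (hl : l ∈ Set.Ico ((N : ℝ) - 1 / 2) N) (hn : n ≠ N) :
    |(n : ℝ) - N| / 2 ≤ |(n : ℝ) - l| ∧ 1 ≤ |(n : ℝ) - N| := by
  have h1 : (1 : ℝ) ≤ |(n : ℝ) - N| := by
    have : (1 : ℤ) ≤ |(n : ℤ) - N| := Int.one_le_abs (sub_ne_zero.2 (by exact_mod_cast hn))
    exact_mod_cast this
  refine ⟨?_, h1⟩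
  have h2 : |(n : ℝ) - N| ≤ |(n : ℝ) - l| + |l - N| := abs_sub_le _ _ _
  have h3 : |l - N| ≤ 1 / 2 := by rw [abs_le]; constructor <;> linarith [hl.1, hl.2]
  linarith

theorem ne_natCast_of_mem {N : ℕ} {l : ℝ} (hl : l ∈ Set.Ico ((N : ℝ) - 1 / 2) N) (n : ℕ) :
    l ≠ n := by
  rintro rfl
  rcases eq_or_ne n N with rfl | hn
  · exact lt_irrefl _ hl.2
  · have h := half_dist_le hl hn
    rw [sub_self, abs_zero] at h
    linarith

/-- A bound that does not depend on `l`, at the price of a factor 2 for the distance from `n`; it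
dominates the far part uniformly on the interval. -/
theorem abs_sub_le_kern {N n : ℕ} (hN : 1 ≤ N) {l : ℝ} (hl : l ∈ Set.Ico ((N : ℝ) - 1 / 2) N)
    (hn : n ≠ N) : |1 / ((n : ℝ) - l) - n / ((n : ℝ) ^ 2 + 1)| ≤ 2 * kern N n := by
  obtain ⟨h1, h2⟩ := half_dist_le hl hn
  have hN' : (1 : ℝ) ≤ N := by exact_mod_cast hN
  have h0 : (n : ℝ) - l ≠ 0 := sub_ne_zero.2 (ne_natCast_of_mem hl n).symm
  have e : 1 / ((n : ℝ) - l) - n / ((n : ℝ) ^ 2 + 1) = (1 + n * l) / ((n - l) * ((n : ℝ) ^ 2 + 1)) := by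
    field_simp
    ring
  have hl0 : 0 ≤ l := by linarith [hl.1]
  rw [e, abs_div, abs_mul, abs_of_nonneg (a := 1 + (n : ℝ) * l) (by positivity),
    abs_of_nonneg (a := (n : ℝ) ^ 2 + 1) (by positivity)]
  calc (1 + n * l) / (|(n : ℝ) - l| * ((n : ℝ) ^ 2 + 1))
      ≤ (1 + n * N) / (|(n : ℝ) - N| / 2 * ((n : ℝ) ^ 2 + 1)) := by
        gcongr
        exact hl.2.le
    _ = _ := by unfold kern; field_simp

/-- The same kernel dominates the weights in the norm of an eigenfunction, so one smallness
condition on the far sum serves both the root and the concentration. -/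
theorem one_div_sub_sq_le_kern {N n : ℕ} (hN : 1 ≤ N) {l : ℝ}
    (hl : l ∈ Set.Ico ((N : ℝ) - 1 / 2) N) (hn : n ≠ N) :
    1 / ((n : ℝ) - l) ^ 2 ≤ 8 * kern N n := by
  obtain ⟨h1, h2⟩ := half_dist_le hl hn
  have hN' : (1 : ℝ) ≤ N := by exact_mod_cast hN
  have hn0 : (0 : ℝ) ≤ n := Nat.cast_nonneg n
  have h3 : (n : ℝ) ^ 2 + 1 ≤ 2 * (1 + n * N) * |(n : ℝ) - N| := by
    rcases le_total (n : ℝ) (2 * N) with h | h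
    · calc (n : ℝ) ^ 2 + 1 ≤ 2 * (1 + n * N) * 1 := by nlinarith
        _ ≤ _ := by gcongr
    · rw [abs_of_nonneg (by linarith)]
      have h4 : (n : ℝ) / 2 ≤ n - N := by linarith
      calc (n : ℝ) ^ 2 + 1 ≤ 2 * (1 + n * N) * (n / 2) := by nlinarith [mul_nonneg hn0 hn0]
        _ ≤ _ := by gcongr
  rw [← sq_abs]
  calc 1 / |(n : ℝ) - l| ^ 2 ≤ 1 / (|(n : ℝ) - N| / 2) ^ 2 := by gcongr
    _ = 4 * ((n : ℝ) ^ 2 + 1) / (|(n : ℝ) - N| ^ 2 * ((n : ℝ) ^ 2 + 1)) := by field_simp; norm_num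
    _ ≤ 4 * (2 * (1 + n * N) * |(n : ℝ) - N|) / (|(n : ℝ) - N| ^ 2 * ((n : ℝ) ^ 2 + 1)) := by gcongr
    _ = _ := by unfold kern; field_simp; norm_num

theorem sq_add_one_mem_N2 (a : ℕ) : a ^ 2 + 1 ∈ N2 := by
  simpa [N2] using r2_pos_of_sq_add_sq a 1

theorem sq_mem_N2 (a : ℕ) : a ^ 2 ∈ N2 := by
  simpa [N2] using r2_pos_of_sq_add_sq a 0

theorem nPlus_eq {N : ℕ} (hN : N ∈ N2) {l : ℝ} (hl : l ∈ Set.Ico ((N : ℝ) - 1 / 2) N) :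
    nPlus l = N := by
  refine le_antisymm (Nat.sInf_le ⟨hN, hl.2⟩) (le_csInf ⟨N, hN, hl.2⟩ ?_)
  rintro m ⟨-, hm⟩
  have : (N : ℝ) < m + 1 := by linarith [hl.1]
  exact Nat.lt_succ_iff.1 (by exact_mod_cast this)

/-- Near `a² + 1` the set of energies in the spectral equation is constant and contains `a²` and
`a² + 1`. -/
theorem exists_energies_eq {cpl : Coupling} (h : cpl.Admissible) {a : ℕ} (ha : 1 ≤ a) :
    ∃ W : Set ℕ, a ^ 2 + 1 ∈ W ∧ a ^ 2 ∈ W ∧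
      ∀ l ∈ Set.Ico (((a ^ 2 + 1 : ℕ) : ℝ) - 1 / 2) ((a ^ 2 + 1 : ℕ) : ℝ), cpl.energies l = W := by
  cases cpl with
  | weak φ => exact ⟨Set.univ, trivial, trivial, fun _ _ => rfl⟩
  | strong φ η =>
    have hN : (1 : ℝ) < ((a ^ 2 + 1 : ℕ) : ℝ) := by
      have : 1 < a ^ 2 + 1 := by nlinarith
      exact_mod_cast this
    have hp : (1 : ℝ) < ((a ^ 2 + 1 : ℕ) : ℝ) ^ η :=
      Real.one_lt_rpow hN (by linarith [h.2.1])
    refine ⟨{n | n ∈ N2 ∧ |(n : ℝ) - (a ^ 2 + 1 : ℕ)| < ((a ^ 2 + 1 : ℕ) : ℝ) ^ η},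
      ⟨sq_add_one_mem_N2 a, ?_⟩, ⟨sq_mem_N2 a, ?_⟩, fun l hl => ?_⟩
    · rw [sub_self, abs_zero]; linarith
    · push_cast at hp ⊢
      rw [sub_add_cancel_left, abs_neg, abs_one]
      exact hp
    · simp only [Coupling.energies, window, nPlus_eq (sq_add_one_mem_N2 a) hl]

/-- The part of the spectral sum away from `a²` and `a² + 1`. -/
noncomputable def farPart (a : ℕ) (W : Set ℕ) (l : ℝ) (n : ℕ) : ℝ :=
  (W \ {a ^ 2 + 1, a ^ 2}).indicator (specTerm l) n

theorem abs_farPart_le {a : ℕ} {W : Set ℕ} {l : ℝ}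
    (hl : l ∈ Set.Ico (((a ^ 2 + 1 : ℕ) : ℝ) - 1 / 2) ((a ^ 2 + 1 : ℕ) : ℝ)) (n : ℕ) :
    |farPart a W l n| ≤ 2 * farTerm a n := by
  unfold farPart
  by_cases h : n ∈ W \ {a ^ 2 + 1, a ^ 2}
  · rw [Set.indicator_of_mem h]
    have h' : ¬ (n = a ^ 2 + 1 ∨ n = a ^ 2) := by simpa using h.2
    rw [farTerm, if_neg h', specTerm, abs_mul, Nat.abs_cast]
    calc _ ≤ (r2 n : ℝ) * (2 * kern (a ^ 2 + 1) n) := by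
          gcongr
          exact abs_sub_le_kern (by omega) hl (fun h => h' (Or.inl h))
      _ = _ := by ring
  · rw [Set.indicator_of_notMem h, abs_zero]
    linarith [farTerm_nonneg a n]

theorem tsum_energies_eq {a : ℕ} {W : Set ℕ} (h1 : a ^ 2 + 1 ∈ W) (h2 : a ^ 2 ∈ W) (l : ℝ) :
    ∑' n : W, specTerm l n =
      specTerm l (a ^ 2 + 1) + specTerm l (a ^ 2) + ∑' n, farPart a W l n := by
  have hs := (summable_specTerm l).indicator W
  have hf : Summable (farPart a W l) := (summable_specTerm l).indicator _
  have hfin : HasSum (fun n => ({a ^ 2 + 1, a ^ 2} : Set ℕ).indicator (specTerm l) n)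
      (specTerm l (a ^ 2 + 1) + specTerm l (a ^ 2)) := by
    have := hasSum_sum_of_ne_finset_zero (f := fun n =>
      ({a ^ 2 + 1, a ^ 2} : Set ℕ).indicator (specTerm l) n) (s := {a ^ 2 + 1, a ^ 2})
      (L := SummationFilter.unconditional ℕ)
      (fun b hb => Set.indicator_of_notMem (by simpa using hb) _)
    rw [Finset.sum_pair (by omega)] at this
    simpa using this
  rw [tsum_subtype, ← hfin.tsum_eq, ← hfin.summable.tsum_add hf]
  refine tsum_congr fun n => ?_
  unfold farPart
  by_cases hn : n ∈ ({a ^ 2 + 1, a ^ 2} : Set ℕ)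
  · have : n ∈ W := by rcases hn with rfl | rfl <;> assumption
    simp [hn, this]
  · by_cases hW : n ∈ W
    · have : n ∈ W \ {a ^ 2 + 1, a ^ 2} := ⟨hW, hn⟩
      simp [hn, this, hW]
    · simp [hn, hW]

theorem abs_tsum_farPart_le {a : ℕ} {W : Set ℕ} {l : ℝ}
    (hl : l ∈ Set.Ico (((a ^ 2 + 1 : ℕ) : ℝ) - 1 / 2) ((a ^ 2 + 1 : ℕ) : ℝ)) :
    |∑' n, farPart a W l n| ≤ 2 * ∑' n, farTerm a n := by
  rw [← tsum_mul_left]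
  exact tsum_of_norm_bounded ((summable_farTerm a).mul_left 2).hasSum
    fun n => (Real.norm_eq_abs _).trans_le (abs_farPart_le hl n)

theorem continuousOn_specTerm {N : ℕ} {s : Set ℝ} (hs : s ⊆ Set.Ico ((N : ℝ) - 1 / 2) N) (n : ℕ) :
    ContinuousOn (fun l => specTerm l n) s := by
  unfold specTerm
  refine continuousOn_const.mul (ContinuousOn.sub (continuousOn_const.div
    (continuousOn_const.sub continuousOn_id) fun l hl => ?_) continuousOn_const)
  exact sub_ne_zero.2 (ne_natCast_of_mem (hs hl) n).symm

/-- The solution of the spectral equation just below `a² + 1`, when the multiplicity of `a²`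
dominates. -/
theorem exists_root {a : ℕ} {W : Set ℕ} (h1 : a ^ 2 + 1 ∈ W) (h2 : a ^ 2 ∈ W)
    {C : ℝ} (hC : 8 * r2 (a ^ 2 + 1) + 4 * |C| + 1 ≤ r2 (a ^ 2))
    (hfar : ∑' n, farTerm a n ≤ r2 (a ^ 2) / 4) :
    ∃ l ∈ Set.Ico (((a ^ 2 + 1 : ℕ) : ℝ) - 1 / 2) ((a ^ 2 + 1 : ℕ) : ℝ),
      ∑' n : W, specTerm l n = C ∧
      (((a ^ 2 + 1 : ℕ) : ℝ) - l) * r2 (a ^ 2) ≤ 4 * r2 (a ^ 2 + 1) := by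
  have hr : (1 : ℝ) ≤ r2 (a ^ 2 + 1) := by
    have : 0 < r2 (a ^ 2 + 1) := sq_add_one_mem_N2 a
    exact_mod_cast this
  generalize hr' : (r2 (a ^ 2 + 1) : ℝ) = r at *
  generalize hR' : (r2 (a ^ 2) : ℝ) = R at *
  obtain ⟨N, hN⟩ : ∃ N : ℝ, N = ((a ^ 2 + 1 : ℕ) : ℝ) := ⟨_, rfl⟩
  have hN1 : 1 ≤ N := by
    rw [hN]; push_cast; nlinarith [sq_nonneg (a : ℝ)]
  have haN : ((a ^ 2 : ℕ) : ℝ) = N - 1 := by rw [hN]; push_cast; ring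
  have hCabs := abs_nonneg C
  have hC1 := le_abs_self C
  have hC2 := neg_abs_le C
  -- the two main terms
  have hmain : ∀ l, specTerm l (a ^ 2 + 1) + specTerm l (a ^ 2) =
      r / (N - l) - r * (N / (N ^ 2 + 1)) +
        R * (1 / (N - 1 - l) - (N - 1) / ((N - 1) ^ 2 + 1)) := fun l => by
    rw [specTerm, specTerm, hr', hR', haN, ← hN]; ring
  have hfrac : ∀ x : ℝ, 0 ≤ x → 0 ≤ x / (x ^ 2 + 1) ∧ x / (x ^ 2 + 1) ≤ 1 := fun x hx =>
    ⟨by positivity, by rw [div_le_one (by positivity)]; nlinarith⟩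
  have hb : ∀ l ∈ Set.Ico (N - 1 / 2) N, -2 ≤ 1 / (N - 1 - l) ∧ 1 / (N - 1 - l) ≤ -1 := by
    intro l hl
    have : N - 1 - l < 0 := by linarith [hl.1]
    constructor
    · rw [le_div_iff_of_neg this]; linarith [hl.1]
    · rw [div_le_iff_of_neg this]; linarith [hl.2]
  obtain ⟨f1, f2⟩ := hfrac N (by linarith)
  obtain ⟨f3, f4⟩ := hfrac (N - 1) (by linarith)
  -- The term of `a²` is at most `-R`, and the far part gives back at most `R / 2`.
  have hup : ∀ l ∈ Set.Ico (N - 1 / 2) N, ∑' n : W, specTerm l n ≤ r / (N - l) - R / 2 := by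
    intro l hl
    have h3 := (abs_le.1 (abs_tsum_farPart_le (W := W) (hN ▸ hl))).2
    rw [tsum_energies_eq h1 h2, hmain]
    have h4 := hb l hl
    nlinarith
  have hlow : ∀ l ∈ Set.Ico (N - 1 / 2) N,
      r / (N - l) - r - 4 * R ≤ ∑' n : W, specTerm l n := by
    intro l hl
    have h3 := (abs_le.1 (abs_tsum_farPart_le (W := W) (hN ▸ hl))).1
    rw [tsum_energies_eq h1 h2, hmain]
    have h4 := hb l hl
    nlinarith
  -- At distance `1 / D` below `N` the term `r D ≥ D` exceeds everything that `hlow` can subtract,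
  -- together with `|C|`.
  obtain ⟨D, hD⟩ : ∃ D : ℝ, D = 4 * R + r + |C| + 2 := ⟨_, rfl⟩
  have hD2 : 2 ≤ D := by rw [hD]; linarith
  have hsub : Set.Icc (N - 1 / 2) (N - 1 / D) ⊆ Set.Ico (N - 1 / 2) N := by
    intro l hl
    refine ⟨hl.1, lt_of_le_of_lt hl.2 ?_⟩
    have : 0 < 1 / D := by positivity
    linarith
  have hle : N - 1 / 2 ≤ N - 1 / D := by
    have : 1 / D ≤ 1 / 2 := one_div_le_one_div_of_le two_pos hD2
    linarith
  have hcont : ContinuousOn (fun l => ∑' n : W, specTerm l n) (Set.Icc (N - 1 / 2) (N - 1 / D)) := by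
    have hsub' := hsub
    rw [hN] at hsub'
    have := ((continuousOn_specTerm hsub' (a ^ 2 + 1)).add (continuousOn_specTerm hsub' (a ^ 2))).add
      (continuousOn_tsum (f := fun n l => farPart a W l n) (fun n => ?_)
        ((summable_farTerm a).mul_left 2) fun n l hl => abs_farPart_le (hsub' hl) n)
    · rw [hN]
      exact this.congr fun l _ => tsum_energies_eq h1 h2 l
    · unfold farPart
      by_cases h : n ∈ W \ {a ^ 2 + 1, a ^ 2}
      · simp only [Set.indicator_of_mem h]
        exact continuousOn_specTerm hsub' n
      · simp only [Set.indicator_of_notMem h]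
        exact continuousOn_const
  have hlo : ∑' n : W, specTerm (N - 1 / 2) n ≤ C := by
    refine (hup _ ⟨le_rfl, by linarith⟩).trans ?_
    rw [sub_sub_cancel]
    linarith
  have hhi : C ≤ ∑' n : W, specTerm (N - 1 / D) n := by
    refine le_trans ?_ (hlow _ (hsub ⟨hle, le_rfl⟩))
    rw [sub_sub_cancel, div_div_eq_mul_div, div_one]
    nlinarith
  obtain ⟨l, hl, hlC⟩ := intermediate_value_Icc hle hcont ⟨hlo, hhi⟩
  refine ⟨l, hN ▸ hsub hl, hlC, ?_⟩
  rw [← hN]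
  have h3 := hup l (hsub hl)
  simp only at hlC
  rw [hlC] at h3
  have hpos : 0 < N - l := by linarith [(hsub hl).2]
  -- At the root the main term must balance `C + R / 2`, which is at least `R / 4`.
  have h4 : R / 4 ≤ r / (N - l) := by linarith
  rw [le_div_iff₀ hpos] at h4
  linarith

/-! ### Concentration of the eigenfunctions on a circle -/

/-- The sum of the characters on the circle of radius `√n`, centred at `x₀`. -/
noncomputable def shell (x₀ : Torus) (n : ℕ) : L2 :=
  ∑ v ∈ (finite_sphere n).toFinset, conj (char v x₀) • toL2 (char v)

theorem coef_shell (x₀ : Torus) (n : ℕ) (v : Fin 2 → ℤ) :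
    coef (shell x₀ n) v = if energy v = n then conj (char v x₀) else 0 := by
  unfold shell coef
  simp only [inner_sum, inner_smul_right]
  change ∑ w ∈ _, conj (char w x₀) * coef (toL2 (char w)) v = _
  simp only [coef_toL2_char, mul_ite, mul_one, mul_zero, Finset.sum_ite_eq]
  simp [energy_eq_iff]

theorem tsum_energy_eq {h : ℕ → ℝ} (hh : ∀ n, 0 ≤ h n) (hs : Summable fun n => (r2 n : ℝ) * h n) :
    ∑' v : Fin 2 → ℤ, h (energy v) = ∑' n, (r2 n : ℝ) * h n := by
  have h2 := ((summable_energy_iff hh).2 hs).hasSum.tsum_fiberwise energy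
  simp only [tsum_fiber_energy, smul_eq_mul] at h2
  exact h2.tsum_eq.symm

/-- With `N = a² + 1`, `r = r₂(N)` and `R = r₂(a²)`: the mass on the circle is at most one, so `‖c‖²
r ≤ (N - l)² ≤ (4r/R)²`. The mass elsewhere is at most `‖c‖² (4R + 8 · R/4) = 6R ‖c‖²`, hence at
most `96 r / R`. -/
theorem concentration {x₀ : Torus} {a : ℕ} {l : ℝ}
    (hl : l ∈ Set.Ico (((a ^ 2 + 1 : ℕ) : ℝ) - 1 / 2) ((a ^ 2 + 1 : ℕ) : ℝ))
    (hy : (((a ^ 2 + 1 : ℕ) : ℝ) - l) * r2 (a ^ 2) ≤ 4 * r2 (a ^ 2 + 1))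
    (hfar : ∑' n, farTerm a n ≤ r2 (a ^ 2) / 4) {g : L2} (hg : ‖g‖ = 1) {c : ℂ}
    (hc : ∀ v, coef g v = c * (conj (char v x₀) / ((normSq v : ℂ) - l))) :
    ∃ b : ℂ, ‖g - b • shell x₀ (a ^ 2 + 1)‖ ^ 2 * r2 (a ^ 2) ≤ 96 * r2 (a ^ 2 + 1) ∧
      ‖b‖ ^ 2 * r2 (a ^ 2 + 1) + ‖g - b • shell x₀ (a ^ 2 + 1)‖ ^ 2 = 1 := by
  obtain ⟨N, hN⟩ : ∃ N : ℕ, N = a ^ 2 + 1 := ⟨_, rfl⟩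
  rw [← hN] at hl hy ⊢
  have hpos : 0 < (N : ℝ) - l := by linarith [hl.2]
  have hr : (1 : ℝ) ≤ r2 N := by
    have : 0 < r2 (a ^ 2 + 1) := sq_add_one_mem_N2 a
    rw [← hN] at this
    exact_mod_cast this
  obtain ⟨h, hh⟩ : ∃ h : ℕ → ℝ, h = fun n : ℕ => ‖c‖ ^ 2 * (1 / ((n : ℝ) - l) ^ 2) := ⟨_, rfl⟩
  have hh0 : ∀ n, 0 ≤ h n := fun n => by rw [hh]; positivity
  have hs : Summable fun n => (r2 n : ℝ) * h n :=
    ((summable_r2_div_sub_sq l).mul_left (‖c‖ ^ 2)).congr fun n => by rw [hh]; ring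
  have hnorm : ∀ v, ‖coef g v‖ ^ 2 = h (energy v) := fun v => by
    rw [hc, normSq_eq_energy, norm_mul, norm_div, RCLike.norm_conj, norm_char_apply, mul_pow, div_pow,
      one_pow, ← Complex.ofReal_natCast, ← Complex.ofReal_sub, Complex.norm_real, Real.norm_eq_abs,
      sq_abs, hh]
  have htot : ∑' n, (r2 n : ℝ) * h n = 1 := by
    rw [← tsum_energy_eq hh0 hs, ← tsum_congr hnorm, tsum_norm_coef_sq, hg, one_pow]
  obtain ⟨b, hb⟩ : ∃ b : ℂ, b = c / ((N : ℂ) - l) := ⟨_, rfl⟩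
  have hbN : ‖b‖ ^ 2 = h N := by
    rw [hb, norm_div, div_pow, ← Complex.ofReal_natCast, ← Complex.ofReal_sub, Complex.norm_real,
      Real.norm_eq_abs, sq_abs, hh]
    ring
  have hoff : ∀ v, ‖coef (g - b • shell x₀ N) v‖ ^ 2 = if energy v = N then 0 else h (energy v) := by
    intro v
    rw [coef_sub, coef_smul, coef_shell]
    split_ifs with hv
    · rw [hc, normSq_eq_energy, hv, hb]
      simp only [sq_eq_zero_iff, norm_eq_zero]
      ring
    · rw [mul_zero, sub_zero, hnorm]
  have hs' : Summable fun n => (r2 n : ℝ) * (if n = N then 0 else h n) :=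
    Summable.of_nonneg_of_le (fun n => mul_nonneg (Nat.cast_nonneg _) (by split_ifs; exacts [le_rfl, hh0 n]))
      (fun n => mul_le_mul_of_nonneg_left (by split_ifs; exacts [hh0 n, le_rfl]) (Nat.cast_nonneg _)) hs
  have hoffsum : ‖g - b • shell x₀ N‖ ^ 2 = ∑' n, (r2 n : ℝ) * (if n = N then 0 else h n) := by
    rw [← tsum_norm_coef_sq, tsum_congr hoff]
    exact tsum_energy_eq (h := fun n => if n = N then 0 else h n)
      (fun n => by split_ifs; exacts [le_rfl, hh0 n]) hs'
  have hsplit : ‖b‖ ^ 2 * r2 N + ‖g - b • shell x₀ N‖ ^ 2 = 1 := by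
    rw [hoffsum, hbN, ← htot, hs.tsum_eq_add_tsum_ite N, mul_comm]
    congr 1
    exact tsum_congr fun n => by split_ifs <;> simp
  refine ⟨b, ?_, hsplit⟩
  have hcy : ‖c‖ ^ 2 ≤ ((N : ℝ) - l) ^ 2 := by
    have h1 : ‖b‖ ^ 2 * r2 N ≤ 1 := by linarith [sq_nonneg ‖g - b • shell x₀ N‖]
    rw [hbN, hh] at h1
    have h2 : ‖c‖ ^ 2 * (1 / ((N : ℝ) - l) ^ 2) ≤ 1 :=
      le_trans (le_mul_of_one_le_right (by positivity) hr) h1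
    rw [mul_one_div, div_le_one (by positivity)] at h2
    exact h2
  have hbound : ∑' n, (r2 n : ℝ) * (if n = N then 0 else h n) ≤ ‖c‖ ^ 2 * (6 * r2 (a ^ 2)) := by
    have hterm : ∀ n, (r2 n : ℝ) * (if n = N then 0 else h n) ≤
        ‖c‖ ^ 2 * ((if n = a ^ 2 then 4 * (r2 (a ^ 2) : ℝ) else 0) + 8 * farTerm a n) := by
      intro n
      split_ifs with h1 h2 h2
      · have := farTerm_nonneg a n
        rw [mul_zero]; positivity
      · have := farTerm_nonneg a n
        rw [mul_zero]; positivity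
      · subst h2
        have h3 : 1 / (((a ^ 2 : ℕ) : ℝ) - l) ^ 2 ≤ 4 := by
          have h4 : ((a ^ 2 : ℕ) : ℝ) = N - 1 := by rw [hN]; push_cast; ring
          rw [h4]
          have h5 : (1 / 2 : ℝ) ≤ l - (N - 1) := by linarith [hl.1]
          rw [div_le_iff₀ (by nlinarith)]
          nlinarith
        have := farTerm_nonneg a (a ^ 2)
        rw [hh]
        calc _ = ‖c‖ ^ 2 * (1 / (((a ^ 2 : ℕ) : ℝ) - l) ^ 2 * r2 (a ^ 2)) := by ring
          _ ≤ ‖c‖ ^ 2 * (4 * (r2 (a ^ 2) : ℝ) + 8 * farTerm a (a ^ 2)) := by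
              gcongr
              nlinarith [Nat.cast_nonneg (α := ℝ) (r2 (a ^ 2))]
      · rw [hN] at h1 hl
        rw [farTerm, if_neg (not_or.2 ⟨h1, h2⟩), hh, zero_add]
        have h3 := one_div_sub_sq_le_kern (by omega) hl h1
        calc _ = ‖c‖ ^ 2 * (r2 n * (1 / ((n : ℝ) - l) ^ 2)) := by ring
          _ ≤ ‖c‖ ^ 2 * (r2 n * (8 * kern (a ^ 2 + 1) n)) := by gcongr
          _ = _ := by ring
    have hsr : HasSum (fun n => ‖c‖ ^ 2 * ((if n = a ^ 2 then 4 * (r2 (a ^ 2) : ℝ) else 0) +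
        8 * farTerm a n)) (‖c‖ ^ 2 * (4 * (r2 (a ^ 2) : ℝ) + 8 * ∑' n, farTerm a n)) :=
      ((hasSum_ite_eq _ _).add ((summable_farTerm a).hasSum.mul_left 8)).mul_left _
    refine (hs'.tsum_le_tsum hterm hsr.summable).trans ?_
    rw [hsr.tsum_eq]
    gcongr
    linarith
  rw [hoffsum]
  have hR : (0 : ℝ) ≤ r2 (a ^ 2) := Nat.cast_nonneg _
  have hbn : ‖b‖ ^ 2 * r2 N ≤ 1 := by linarith [sq_nonneg ‖g - b • shell x₀ N‖]
  have hcb : ‖c‖ ^ 2 * r2 N ≤ ((N : ℝ) - l) ^ 2 := by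
    rw [hbN, hh] at hbn
    have : ‖c‖ ^ 2 * (1 / ((N : ℝ) - l) ^ 2) * r2 N = ‖c‖ ^ 2 * r2 N / ((N : ℝ) - l) ^ 2 := by ring
    simp only at hbn
    rw [this, div_le_one (by positivity)] at hbn
    exact hbn
  have h1 : ‖c‖ ^ 2 * r2 N * (r2 (a ^ 2) : ℝ) ^ 2 ≤ (4 * r2 N) ^ 2 := by
    calc _ ≤ ((N : ℝ) - l) ^ 2 * (r2 (a ^ 2) : ℝ) ^ 2 := by gcongr
      _ = (((N : ℝ) - l) * r2 (a ^ 2)) ^ 2 := by ring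
      _ ≤ _ := by gcongr
  have h2 : ‖c‖ ^ 2 * (r2 (a ^ 2) : ℝ) ^ 2 ≤ 16 * r2 N := by
    have : ‖c‖ ^ 2 * (r2 (a ^ 2) : ℝ) ^ 2 * r2 N ≤ 16 * r2 N * r2 N := by nlinarith
    exact le_of_mul_le_mul_right this (by linarith)
  calc _ ≤ ‖c‖ ^ 2 * (6 * r2 (a ^ 2)) * r2 (a ^ 2) := by gcongr
    _ = 6 * (‖c‖ ^ 2 * (r2 (a ^ 2) : ℝ) ^ 2) := by ring
    _ ≤ 6 * (16 * r2 N) := by gcongr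
    _ = _ := by ring

/-- New eigenvalues just below some `a² + 1`, with eigenfunctions that concentrate on the circle of
radius `√(a² + 1)`, which carries a fixed number of lattice points. -/
theorem exists_concentrated (x₀ : Torus) {cpl : Coupling} (hcpl : cpl.Admissible) :
    ∃ r : ℕ, 0 < r ∧ ∀ δ > (0 : ℝ), ∀ A : ℕ, ∃ a ≥ A, r2 (a ^ 2 + 1) = r ∧
      ∃ l ∈ Set.Ico (((a ^ 2 + 1 : ℕ) : ℝ) - 1 / 2) ((a ^ 2 + 1 : ℕ) : ℝ),
        l ∈ newEigenvalues x₀ cpl ∧ (∃ u, IsEigenfunction x₀ cpl l u) ∧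
        ∀ g, IsEigenfunction x₀ cpl l g →
          ∃ b : ℂ, ‖g - b • shell x₀ (a ^ 2 + 1)‖ ^ 2 ≤ δ ∧ |‖b‖ ^ 2 * r - 1| ≤ δ := by
  obtain ⟨r, hr⟩ := exists_isolated_eq
  have hr0 : 0 < r := by
    obtain ⟨a, -, ha, -⟩ := hr 1 one_pos 0
    rw [← ha]
    exact sq_add_one_mem_N2 a
  have hr0' : (0 : ℝ) < r := by exact_mod_cast hr0
  refine ⟨r, hr0, fun δ hδ A => ?_⟩
  obtain ⟨C, hC⟩ : ∃ C : ℝ, C = c0 * Real.tan (cpl.phase / 2) := ⟨_, rfl⟩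
  -- A common lower bound for `r₂(a²)`: for the root, for a far sum of at most a quarter of
  -- `r₂(a²)`, and for a mass of at most `δ` off the circle.
  obtain ⟨D, hD⟩ : ∃ D : ℝ, D = 8 * r + 4 * |C| + 4 + 96 * r / δ := ⟨_, rfl⟩
  have hD0 : 0 < D := by rw [hD]; positivity
  obtain ⟨a, haA, har, h1, h2⟩ := hr (1 / D) (by positivity) (max A 1)
  have ha1 : 1 ≤ a := (le_max_right _ _).trans haA
  have hDR : D ≤ r2 (a ^ 2) := by
    rw [one_div_mul_eq_div, le_div_iff₀ hD0] at h1
    linarith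
  have hfar : ∑' n, farTerm a n ≤ r2 (a ^ 2) / 4 := by
    refine h2.trans ?_
    rw [one_div_mul_eq_div]
    have : 4 ≤ D := by rw [hD]; have : 0 ≤ 96 * r / δ := by positivity
                       linarith [abs_nonneg C]
    gcongr
  obtain ⟨W, hW1, hW2, hW⟩ := exists_energies_eq hcpl ha1
  have hCR : 8 * r2 (a ^ 2 + 1) + 4 * |C| + 1 ≤ r2 (a ^ 2) := by
    rw [har]
    have : 0 ≤ 96 * r / δ := by positivity
    linarith
  obtain ⟨l, hl, hlC, hly⟩ := exists_root hW1 hW2 hCR hfar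
  have hlN : ∀ n ∈ N2, l ≠ n := fun n _ => ne_natCast_of_mem hl n
  have hl0 : 0 < l := by
    have : (1 : ℝ) ≤ ((a ^ 2 + 1 : ℕ) : ℝ) := by exact_mod_cast (by omega : 1 ≤ a ^ 2 + 1)
    linarith [hl.1]
  obtain ⟨hnew, hex⟩ := mem_newEigenvalues x₀ hcpl hl0 hlN (by rw [hW l hl, hlC, hC])
  refine ⟨a, (le_max_left _ _).trans haA, har, l, hl, hnew, hex, fun g hg => ?_⟩
  obtain ⟨c, hc⟩ := coef_of_isEigenfunction hg hlN
  obtain ⟨b, hb1, hb2⟩ := concentration hl hly hfar hg.1 hc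
  rw [har] at hb1 hb2
  have hle : ‖g - b • shell x₀ (a ^ 2 + 1)‖ ^ 2 ≤ δ := by
    have h3 : 96 * r / δ ≤ r2 (a ^ 2) := by linarith [abs_nonneg C]
    rw [div_le_iff₀ hδ] at h3
    have h4 : (0 : ℝ) < r2 (a ^ 2) := lt_of_lt_of_le hD0 hDR
    have h5 := hb1.trans h3
    rw [mul_comm] at h5
    exact le_of_mul_le_mul_left h5 h4
  refine ⟨b, hle, ?_⟩
  rw [← hb2, abs_le]
  constructor <;> linarith [sq_nonneg ‖g - b • shell x₀ (a ^ 2 + 1)‖]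

/-! ### Multiplication and multiplier operators -/

/-- Multiplication by a continuous function, as a bounded operator on `L²`. -/
noncomputable def mulOp (b : C(Torus, ℂ)) : L2 →L[ℂ] L2 :=
  (ContinuousLinearMap.mul ℂ ℂ).holderL haarTorus ⊤ 2 2 (ContinuousMap.toLp ⊤ haarTorus ℂ b)

theorem mulOp_toL2 (b f : C(Torus, ℂ)) : mulOp b (toL2 f) = toL2 (b * f) := by
  apply Lp.ext
  have h1 := (ContinuousLinearMap.mul ℂ ℂ).coeFn_holder (r := 2)
    (ContinuousMap.toLp (E := ℂ) ⊤ haarTorus ℂ b) (toL2 f)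
  have h2 := ContinuousMap.coeFn_toLp (p := ⊤) (𝕜 := ℂ) haarTorus b
  have h3 := ContinuousMap.coeFn_toLp (p := 2) (𝕜 := ℂ) haarTorus f
  have h4 := ContinuousMap.coeFn_toLp (p := 2) (𝕜 := ℂ) haarTorus (b * f)
  filter_upwards [h1, h2, h3, h4] with x e1 e2 e3 e4
  change _ = (ContinuousMap.toLp 2 haarTorus ℂ (b * f) : Torus → ℂ) x
  rw [e4]
  refine e1.trans ?_
  change _ * (ContinuousMap.toLp 2 haarTorus ℂ f : Torus → ℂ) x = _
  rw [e2, e3]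
  rfl

theorem norm_mulOp_le (b : C(Torus, ℂ)) : ‖mulOp b‖ ≤ ‖b‖ := by
  refine ContinuousLinearMap.opNorm_le_bound _ (norm_nonneg _) fun f => ?_
  refine ((ContinuousLinearMap.mul ℂ ℂ).norm_holder_apply_apply_le _ f).trans ?_
  have h1 : ‖ContinuousMap.toLp (E := ℂ) ⊤ haarTorus ℂ b‖ ≤ ‖b‖ := by
    have := ContinuousMap.toLp_norm_le (E := ℂ) (p := ⊤) (μ := haarTorus) (𝕜 := ℂ)
    refine (ContinuousLinearMap.le_of_opNorm_le _ this b).trans ?_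
    simp
  gcongr
  calc _ ≤ 1 * ‖ContinuousMap.toLp (E := ℂ) ⊤ haarTorus ℂ b‖ := by
        gcongr
        exact ContinuousLinearMap.opNorm_mul_le ℂ ℂ
    _ ≤ ‖b‖ := by rw [one_mul]; exact h1

theorem orthonormal_smul_char {m : (Fin 2 → ℤ) → ℂ} (hm : ∀ v, ‖m v‖ = 1) :
    Orthonormal ℂ fun v => m v • toL2 (char v) := by
  classical
  rw [orthonormal_iff_ite]
  intro v w
  rw [inner_smul_left, inner_smul_right, orthonormal_iff_ite.1 orthonormal_char]
  split_ifs with h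
  · subst h
    rw [mul_one, ← Complex.normSq_eq_conj_mul_self, Complex.normSq_eq_norm_sq, hm]
    norm_num
  · simp

/-- A unimodular Fourier multiplier. -/
theorem exists_multiplier {m : (Fin 2 → ℤ) → ℂ} (hm : ∀ v, ‖m v‖ = 1) :
    ∃ D : L2 →L[ℂ] L2, ‖D‖ ≤ 1 ∧ ∀ v, D (toL2 (char v)) = m v • toL2 (char v) := by
  classical
  have hO := (orthonormal_smul_char hm).orthogonalFamily
  refine ⟨(hO.linearIsometry.comp charBasis.repr.toLinearIsometry).toContinuousLinearMap,
    LinearIsometry.norm_toContinuousLinearMap_le _, fun v => ?_⟩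
  change hO.linearIsometry (charBasis.repr (toL2 (char v))) = _
  rw [← charBasis_apply, HilbertBasis.repr_self, OrthogonalFamily.linearIsometry_apply_single,
    charBasis_apply]
  simp

/-! ### Decay of the Fourier coefficients of an observable -/

theorem norm_fourierCoeffOn_le {f : ℝ → ℂ} {T : ℝ} (hT : 0 < 0 + T) {M : ℝ}
    (hM : ∀ s ∈ Set.Icc 0 (0 + T), ‖f s‖ ≤ M) (n : ℤ) : ‖fourierCoeffOn hT f n‖ ≤ M := by
  have hT' : 0 < 0 + T - 0 := by linarith
  rw [fourierCoeffOn_eq_integral, norm_smul]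
  have h := intervalIntegral.norm_integral_le_of_norm_le_const (a := 0) (b := 0 + T) (C := M)
    (f := fun x : ℝ => fourier (-n) (x : AddCircle (0 + T - 0)) • f x) (fun s hs => by
      rw [Set.uIoc_of_le hT.le] at hs
      rw [norm_smul]
      simp only [fourier_apply, Circle.norm_coe, one_mul]
      exact hM s ⟨hs.1.le, hs.2⟩)
  rw [abs_of_pos hT'] at h
  rw [Real.norm_of_nonneg (by positivity)]
  calc _ ≤ 1 / (0 + T - 0) * (M * (0 + T - 0)) := by gcongr
    _ = M := by field_simp

/-- Two integrations by parts; the boundary terms cancel because `f`, and hence `f₁`, is periodic.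
-/
theorem norm_fourierCoeff_le {G : AddCircle (2 * Real.pi) → ℂ} {f f₁ f₂ : ℝ → ℂ}
    (hG : ∀ s : ℝ, G s = f s) (h1 : ∀ s, HasDerivAt f (f₁ s) s) (h2 : ∀ s, HasDerivAt f₁ (f₂ s) s)
    (hc : Continuous f₂) {M : ℝ} (hM : ∀ s ∈ Set.Icc 0 (2 * Real.pi), ‖f₂ s‖ ≤ M) {n : ℤ}
    (hn : n ≠ 0) : ‖fourierCoeff G n‖ ≤ M / (n : ℝ) ^ 2 := by
  have hT : 0 < 0 + 2 * Real.pi := by linarith [Real.two_pi_pos]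
  have hGf : G = AddCircle.liftIco (2 * Real.pi) 0 f := by
    funext x
    obtain ⟨y, hy, rfl⟩ : x ∈ ((↑) : ℝ → AddCircle (2 * Real.pi)) '' Set.Ico 0 (0 + 2 * Real.pi) := by
      rw [AddCircle.coe_image_Ico_eq]; trivial
    rw [AddCircle.liftIco_coe_apply hy, hG]
  have hper : ∀ s, f (s + 2 * Real.pi) = f s := fun s => by
    rw [← hG, ← hG, AddCircle.coe_add, AddCircle.coe_period, add_zero]
  have hper1 : f₁ (0 + 2 * Real.pi) = f₁ 0 := by
    have h3 := (h1 (0 + 2 * Real.pi)).comp_add_const 0 (2 * Real.pi)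
    simp only [hper] at h3
    exact h3.unique (h1 0)
  have hf1c : Continuous f₁ := continuous_iff_continuousAt.2 fun s => (h2 s).continuousAt
  rw [hGf, fourierCoeff_liftIco_eq,
    fourierCoeffOn_of_hasDerivAt _ hn (fun s _ => h1 s) (hf1c.intervalIntegrable _ _),
    fourierCoeffOn_of_hasDerivAt _ hn (fun s _ => h2 s) (hc.intervalIntegrable _ _), hper1,
    hper 0, sub_self, mul_zero, zero_sub, sub_self, mul_zero, zero_sub]
  have hb := norm_fourierCoeffOn_le hT (f := f₂) (by simpa using hM) n
  have e : ∀ w : ℂ, 1 / (-2 * (Real.pi : ℂ) * Complex.I * n) * -(((0 + 2 * Real.pi : ℝ) - (0 : ℝ) : ℂ) *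
      (1 / (-2 * (Real.pi : ℂ) * Complex.I * n) * -(((0 + 2 * Real.pi : ℝ) - (0 : ℝ) : ℂ) * w))) =
      -(w / (n : ℂ) ^ 2) := by
    intro w
    have h3 : (Real.pi : ℂ) ≠ 0 := by exact_mod_cast Real.pi_ne_zero
    have h4 : (n : ℂ) ≠ 0 := by exact_mod_cast hn
    have h5 := Complex.I_ne_zero
    push_cast
    field_simp
    rw [Complex.I_sq]
    ring
  rw [e, norm_neg, norm_div, norm_pow, Complex.norm_intCast, sq_abs]
  gcongr

theorem hasDerivAt_snd {F : (Fin 2 → ℝ) × ℝ → ℂ} (hF : ContDiff ℝ ∞ F) (y : Fin 2 → ℝ) (s : ℝ) :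
    HasDerivAt (fun s => F (y, s)) (fderiv ℝ F (y, s) (0, 1)) s := by
  have h1 : HasFDerivAt F (fderiv ℝ F (y, s)) (y, s) :=
    (hF.differentiable (by simp) (y, s)).hasFDerivAt
  have h2 : HasDerivAt (fun s : ℝ => (y, s)) ((0 : Fin 2 → ℝ), (1 : ℝ)) s :=
    (hasDerivAt_const s y).prodMk (hasDerivAt_id s)
  exact h1.comp_hasDerivAt s h2

theorem contDiff_fderiv_snd {F : (Fin 2 → ℝ) × ℝ → ℂ} (hF : ContDiff ℝ ∞ F) :
    ContDiff ℝ ∞ fun p => fderiv ℝ F p (0, 1) :=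
  (hF.fderiv_right (m := ∞) (by simp)).clm_apply contDiff_const

/-- The Fourier coefficients, in the direction variable, of an observable. -/
noncomputable def angleCoeff (a : C(PhaseSpace, ℂ)) (k : ℤ) : C(Torus, ℂ) :=
  fourierCoeff (fun s : AddCircle (2 * Real.pi) => slice a (AddCircle.toCircle s)) k

theorem continuous_slice_toCircle (a : C(PhaseSpace, ℂ)) :
    Continuous fun s : AddCircle (2 * Real.pi) => slice a (AddCircle.toCircle s) := by
  have hc : Continuous (AddCircle.toCircle : AddCircle (2 * Real.pi) → Circle) :=
    AddCircle.continuous_toCircle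
  let g : C(AddCircle (2 * Real.pi) × Torus, ℂ) :=
    ⟨fun p => a (p.2, AddCircle.toCircle p.1), by fun_prop⟩
  exact g.curry.continuous

theorem angleCoeff_apply (a : C(PhaseSpace, ℂ)) (k : ℤ) (x : Torus) :
    angleCoeff a k x =
      fourierCoeff (fun s : AddCircle (2 * Real.pi) => a (x, AddCircle.toCircle s)) k := by
  unfold angleCoeff fourierCoeff
  have hint : Integrable (fun s : AddCircle (2 * Real.pi) =>
      fourier (-k) s • slice a (AddCircle.toCircle s)) AddCircle.haarAddCircle := by
    have : Continuous fun s : AddCircle (2 * Real.pi) =>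
      fourier (-k) s • slice a (AddCircle.toCircle s) :=
      (fourier (-k)).continuous.smul (continuous_slice_toCircle a)
    exact this.integrable_of_hasCompactSupport (HasCompactSupport.of_compactSpace _)
  exact ((ContinuousMap.evalCLM ℂ x).integral_comp_comm hint).symm

theorem toCircle_coe (s : ℝ) :
    AddCircle.toCircle (s : AddCircle (2 * Real.pi)) = Circle.exp s := by
  rw [AddCircle.toCircle_apply_mk, div_self Real.two_pi_pos.ne', one_mul]

/-- The second derivative in the angle is bounded on a compact fundamental domain, hence uniformly
in the position. -/
theorem norm_angleCoeff_le {a : C(PhaseSpace, ℂ)} (ha : IsSmooth a) :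
    ∃ M : ℝ, ∀ k : ℤ, k ≠ 0 → ‖angleCoeff a k‖ ≤ M / (k : ℝ) ^ 2 := by
  obtain ⟨F, hFdef⟩ : ∃ F : (Fin 2 → ℝ) × ℝ → ℂ, F = fun p : (Fin 2 → ℝ) × ℝ =>
    a ((fun i => (p.1 i : AddCircle (2 * Real.pi))), Circle.exp p.2) := ⟨_, rfl⟩
  have hF : ContDiff ℝ ∞ F := hFdef ▸ ha
  have hF1 := contDiff_fderiv_snd hF
  have hF2 := contDiff_fderiv_snd hF1
  have hK : IsCompact ((Set.univ.pi fun _ : Fin 2 => Set.Icc 0 (2 * Real.pi)) ×ˢ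
      Set.Icc (0 : ℝ) (2 * Real.pi)) := (isCompact_univ_pi fun _ => isCompact_Icc).prod isCompact_Icc
  obtain ⟨M, hM⟩ := hK.exists_bound_of_continuousOn hF2.continuous.continuousOn
  refine ⟨M, fun k hk => ?_⟩
  have hpt : ∀ x, ‖angleCoeff a k x‖ ≤ M / (k : ℝ) ^ 2 := by
    intro x
    have hx : ∀ i, ∃ y ∈ Set.Icc 0 (2 * Real.pi), (y : AddCircle (2 * Real.pi)) = x i := fun i => by
      obtain ⟨y, hy, h⟩ : x i ∈ ((↑) : ℝ → AddCircle (2 * Real.pi)) ''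
          Set.Ico 0 (0 + 2 * Real.pi) := by
        rw [AddCircle.coe_image_Ico_eq]; trivial
      rw [zero_add] at hy
      exact ⟨y, ⟨hy.1, hy.2.le⟩, h⟩
    choose y hy hyx using hx
    rw [angleCoeff_apply]
    refine norm_fourierCoeff_le (f := fun s => F (y, s)) (fun s => ?_) (hasDerivAt_snd hF y)
      (hasDerivAt_snd hF1 y) ?_ (fun s hs => hM (y, s) ⟨fun i _ => hy i, hs⟩) hk
    · simp only [hFdef, toCircle_coe, hyx]
    · exact hF2.continuous.comp (by fun_prop)
  have h0 : 0 ≤ M / (k : ℝ) ^ 2 := (norm_nonneg _).trans (hpt 0)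
  exact (ContinuousMap.norm_le _ h0).2 hpt

theorem summable_norm_angleCoeff {a : C(PhaseSpace, ℂ)} (ha : IsSmooth a) :
    Summable fun k => ‖angleCoeff a k‖ := by
  obtain ⟨M, hM⟩ := norm_angleCoeff_le ha
  have h : Summable fun k : ℤ => M * (1 / (k : ℝ) ^ 2) :=
    (Real.summable_one_div_int_pow.2 one_lt_two).mul_left M
  refine Summable.of_norm_bounded_eventually h ?_
  have : {k : ℤ | k ≠ 0} ∈ (cofinite : Filter ℤ) := (Set.finite_singleton (0 : ℤ)).compl_mem_cofinite
  filter_upwards [this] with k hk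
  rw [norm_norm, mul_one_div]
  exact hM k hk

/-- The series converges absolutely in the uniform norm; its sum is identified at each `x` by the
Fourier series in the angle. -/
theorem hasSum_angleCoeff {a : C(PhaseSpace, ℂ)} (ha : IsSmooth a) (θ : Circle) :
    HasSum (fun k : ℤ => ((θ : ℂ) ^ k) • angleCoeff a k) (slice a θ) := by
  have hs : Summable fun k : ℤ => ((θ : ℂ) ^ k) • angleCoeff a k := by
    refine Summable.of_norm ((summable_norm_angleCoeff ha).congr fun k => ?_)
    rw [norm_smul, norm_zpow, Circle.norm_coe, one_zpow, one_mul]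
  obtain ⟨s, rfl⟩ : ∃ s : AddCircle (2 * Real.pi), AddCircle.toCircle s = θ := by
    refine ⟨(Complex.arg θ : ℝ), ?_⟩
    rw [toCircle_coe, Circle.exp_arg]
  have heq : ∑' k : ℤ, (((AddCircle.toCircle s : Circle) : ℂ) ^ k) • angleCoeff a k =
      slice a (AddCircle.toCircle s) := by
    ext x
    have h1 := (ContinuousMap.evalCLM ℂ x).hasSum hs.hasSum
    have hc : Continuous (AddCircle.toCircle : AddCircle (2 * Real.pi) → Circle) :=
      AddCircle.continuous_toCircle
    let f : C(AddCircle (2 * Real.pi), ℂ) := ⟨fun s => a (x, AddCircle.toCircle s), by fun_prop⟩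
    have h2 : Summable (fourierCoeff f) := by
      refine Summable.of_norm (Summable.of_nonneg_of_le (fun _ => norm_nonneg _) (fun k => ?_)
        (summable_norm_angleCoeff ha))
      change ‖fourierCoeff (fun s : AddCircle (2 * Real.pi) => a (x, AddCircle.toCircle s)) k‖ ≤ _
      rw [← angleCoeff_apply]
      exact (angleCoeff a k).norm_coe_le_norm x
    have h3 := has_pointwise_sum_fourier_series_of_summable h2 s
    refine h1.unique ?_
    convert h3 using 1
    · funext k
      change _ * angleCoeff a k x = fourierCoeff (fun s : AddCircle (2 * Real.pi) =>
        a (x, AddCircle.toCircle s)) k * _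
      rw [angleCoeff_apply, mul_comm, fourier_apply, AddCircle.toCircle_zsmul, Circle.coe_zpow]
    · rfl
  rw [← heq]
  exact hs.hasSum

/-- The quantization of a smooth observable is a bounded operator. -/
theorem exists_isOp {a : C(PhaseSpace, ℂ)} (ha : IsSmooth a) : ∃ T, IsOp a T := by
  -- Expanding `a` in the direction gives `Op(a)` as a norm convergent sum of products of a
  -- multiplication operator and the unimodular multiplier `dir v ^ k`.
  have hD : ∀ k : ℤ, ∃ D : L2 →L[ℂ] L2, ‖D‖ ≤ 1 ∧
      ∀ v, D (toL2 (char v)) = ((dir v : ℂ) ^ k) • toL2 (char v) := fun k =>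
    exists_multiplier fun v => by rw [norm_zpow, Circle.norm_coe, one_zpow]
  choose D hD1 hD2 using hD
  have hs : Summable fun k => (mulOp (angleCoeff a k)).comp (D k) := by
    refine Summable.of_norm (Summable.of_nonneg_of_le (fun _ => norm_nonneg _) (fun k => ?_)
      (summable_norm_angleCoeff ha))
    calc _ ≤ ‖mulOp (angleCoeff a k)‖ * ‖D k‖ := ContinuousLinearMap.opNorm_comp_le _ _
      _ ≤ ‖angleCoeff a k‖ * 1 := by
          gcongr
          exacts [norm_mulOp_le _, hD1 k]
      _ = _ := mul_one _
  refine ⟨∑' k, (mulOp (angleCoeff a k)).comp (D k), fun v => ?_⟩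
  have h1 := (ContinuousLinearMap.apply ℂ L2 (toL2 (char v))).hasSum hs.hasSum
  have h2 : HasSum (fun k : ℤ => toL2 ((((dir v : ℂ) ^ k) • angleCoeff a k) * char v))
      (toL2 (slice a (dir v) * char v)) :=
    (ContinuousMap.toLp (E := ℂ) 2 haarTorus ℂ).hasSum ((hasSum_angleCoeff ha (dir v)).mul_right _)
  refine h1.unique ?_
  convert h2 using 1
  funext k
  change mulOp (angleCoeff a k) (D k (toL2 (char v))) = _
  rw [hD2, map_smul, mulOp_toL2, smul_mul_assoc]
  exact (map_smul (ContinuousMap.toLp (E := ℂ) 2 haarTorus ℂ) _ _).symm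

/-! ### Clusters of lattice points -/

theorem dir_mul_norm (v : Fin 2 → ℤ) :
    (dir v : ℂ) * ‖(v 0 : ℂ) + (v 1 : ℂ) * Complex.I‖ = (v 0 : ℂ) + (v 1 : ℂ) * Complex.I := by
  have h := Complex.norm_mul_exp_arg_mul_I ((v 0 : ℂ) + (v 1 : ℂ) * Complex.I)
  rw [dir, Circle.coe_exp, mul_comm]
  exact h

theorem norm_eq_sqrt_normSq (v : Fin 2 → ℤ) :
    ‖(v 0 : ℂ) + (v 1 : ℂ) * Complex.I‖ = √(normSq v) := by
  rw [← Complex.ofReal_intCast, ← Complex.ofReal_intCast, Complex.norm_add_mul_I]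
  congr 1
  simp [normSq]

theorem norm_dir_sub_dir_mul {v w : Fin 2 → ℤ} {n : ℤ} (hv : normSq v = n) (hw : normSq w = n) :
    ‖(dir v : ℂ) - dir w‖ * √(n : ℝ) =
      ‖((v - w) 0 : ℂ) + ((v - w) 1 : ℂ) * Complex.I‖ := by
  have h1 := dir_mul_norm v
  have h2 := dir_mul_norm w
  rw [norm_eq_sqrt_normSq, hv] at h1
  rw [norm_eq_sqrt_normSq, hw] at h2
  have e : ((v - w) 0 : ℂ) + ((v - w) 1 : ℂ) * Complex.I =
      ((dir v : ℂ) - dir w) * (√(n : ℝ) : ℝ) := by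
    rw [sub_mul, h1, h2]
    simp only [Pi.sub_apply]
    push_cast
    ring
  rw [e, norm_mul, Complex.norm_real, Real.norm_of_nonneg (Real.sqrt_nonneg _)]

/-- Points at bounded distance on a circle of radius `√n → ∞` have directions that differ by
`O(1/√n)`. -/
theorem eq_of_tendsto_dir {v w : ℕ → Fin 2 → ℤ} {n : ℕ → ℕ} (hn : Tendsto n atTop atTop)
    (hv : ∀ j, normSq (v j) = n j) (hw : ∀ j, normSq (w j) = n j) {θ θ' : Circle}
    (h1 : Tendsto (fun j => dir (v j)) atTop (𝓝 θ)) (h2 : Tendsto (fun j => dir (w j)) atTop (𝓝 θ'))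
    {u : Fin 2 → ℤ} (hu : ∀ᶠ j in atTop, v j - w j = u) : θ = θ' := by
  have h3 : Tendsto (fun j => ‖(dir (v j) : ℂ) - dir (w j)‖) atTop (𝓝 ‖(θ : ℂ) - θ'‖) :=
    (((continuous_subtype_val.tendsto θ).comp h1).sub
      ((continuous_subtype_val.tendsto θ').comp h2)).norm
  have h4 : Tendsto (fun j => ‖(u 0 : ℂ) + (u 1 : ℂ) * Complex.I‖ / √(n j : ℝ)) atTop (𝓝 0) :=
    tendsto_const_nhds.div_atTop
      (Real.tendsto_sqrt_atTop.comp (tendsto_natCast_atTop_atTop.comp hn))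
  have h5 : Tendsto (fun j => ‖(dir (v j) : ℂ) - dir (w j)‖) atTop (𝓝 0) := by
    refine h4.congr' ?_
    filter_upwards [hu, hn.eventually_gt_atTop 0] with j hj hj0
    have h6 := norm_dir_sub_dir_mul (hv j) (hw j)
    rw [hj, Int.cast_natCast] at h6
    have h7 : 0 < √(n j : ℝ) := Real.sqrt_pos.2 (by exact_mod_cast hj0)
    rw [← h6, mul_div_cancel_right₀ _ h7.ne']
  have h6 := tendsto_nhds_unique h3 h5
  exact Circle.ext (sub_eq_zero.1 (norm_eq_zero.1 h6))

/-- Lattice points on growing circles, whose differences either stabilize or diverge, split into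
clusters: the relative positions within a cluster stabilize, while different clusters move apart. -/
theorem exists_clusters {r : ℕ} {e : ℕ → Fin r → Fin 2 → ℤ} (hinj : ∀ j, Function.Injective (e j))
    {n : ℕ → ℕ} (hn : Tendsto n atTop atTop) (hnorm : ∀ j k, normSq (e j k) = n j)
    {θ : Fin r → Circle} (hθ : ∀ k, Tendsto (fun j => dir (e j k)) atTop (𝓝 (θ k)))
    (hd : ∀ k l w, (∀ᶠ j in atTop, e j k - e j l = w) ∨ ∀ᶠ j in atTop, e j k - e j l ≠ w) :
    ∃ (cls : Fin r → Fin r) (u : Fin r → Fin 2 → ℤ), (∀ k, θ (cls k) = θ k) ∧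
      (∀ k l, cls k = cls l → ∀ᶠ j in atTop, e j l - e j k = u l - u k) ∧
      (∀ k l, cls k ≠ cls l → ∀ w, ∀ᶠ j in atTop, e j l - e j k ≠ w) ∧
      ∀ k l, cls k = cls l → u k = u l → k = l := by
  -- The clusters are the classes of "eventually constant difference". The chosen representative
  -- serves as origin of its cluster, and `u` is the position relative to it.
  let s : Setoid (Fin r) :=
    { r := fun k l => ∃ w, ∀ᶠ j in atTop, e j k - e j l = w
      iseqv := by
        refine ⟨fun k => ⟨0, by simp⟩, ?_, ?_⟩
        · rintro k l ⟨w, hw⟩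
          refine ⟨-w, hw.mono fun j hj => by rw [← hj, neg_sub]⟩
        · rintro k l m ⟨w, hw⟩ ⟨w', hw'⟩
          refine ⟨w + w', (hw.and hw').mono fun j hj => by rw [← hj.1, ← hj.2]; abel⟩ }
  have hout : ∀ k, ∃ w, ∀ᶠ j in atTop, e j k - e j (Quotient.mk s k).out = w := fun k =>
    s.symm (Quotient.mk_out (s := s) k)
  choose u hu using hout
  have hcls : ∀ k l, (Quotient.mk s k).out = (Quotient.mk s l).out ↔
      ∃ w, ∀ᶠ j in atTop, e j k - e j l = w := fun k l =>
    Quotient.out_inj.trans Quotient.eq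
  have hi : ∀ k l, (Quotient.mk s k).out = (Quotient.mk s l).out →
      ∀ᶠ j in atTop, e j l - e j k = u l - u k := fun k l hkl => by
    filter_upwards [hu k, hu l] with j h1 h2
    rw [← h1, ← h2, hkl]; abel
  refine ⟨fun k => (Quotient.mk s k).out, u, fun k => ?_, hi, fun k l hkl w => ?_,
    fun k l hkl huv => ?_⟩
  · exact (eq_of_tendsto_dir hn (fun j => hnorm j _) (fun j => hnorm j _) (hθ k) (hθ _) (hu k)).symm
  · refine (hd l k w).resolve_left fun h => hkl ((hcls l k).2 ⟨w, h⟩).symm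
  · obtain ⟨j, hj⟩ := (hi k l hkl).exists
    rw [huv, sub_self, sub_eq_zero] at hj
    exact (hinj j hj).symm

/-! ### Matrix elements and their limits -/

/-- The integral of `f` against the character with frequency `d`, centred at `x₀`. -/
noncomputable def centredIntegral (x₀ : Torus) (f : C(Torus, ℂ)) (d : Fin 2 → ℤ) : ℂ :=
  coef (toL2 f) (-d) * conj (char d x₀)

theorem centredIntegral_eq (x₀ : Torus) (f : C(Torus, ℂ)) (d : Fin 2 → ℤ) :
    centredIntegral x₀ f d = ∫ x, f x * (char d x * conj (char d x₀)) ∂haarTorus := by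
  unfold centredIntegral coef
  rw [inner_toL2, ← integral_mul_const]
  refine integral_congr_ae (Eventually.of_forall fun x => ?_)
  simp only [char_neg_apply, Complex.conj_conj]
  ring

theorem norm_coef_le (f : L2) (v : Fin 2 → ℤ) : ‖coef f v‖ ≤ ‖f‖ := by
  have h := norm_inner_le_norm (𝕜 := ℂ) (toL2 (char v)) f
  rwa [orthonormal_char.1 v, one_mul] at h

theorem tendsto_toL2 {f : ℕ → C(Torus, ℂ)} {f' : C(Torus, ℂ)} (hf : Tendsto f atTop (𝓝 f')) :
    Tendsto (fun j => toL2 (f j)) atTop (𝓝 (toL2 f')) :=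
  ((ContinuousMap.toLp (E := ℂ) 2 haarTorus ℂ).continuous.tendsto f').comp hf

theorem tendsto_coef_sub {f : ℕ → C(Torus, ℂ)} {f' : C(Torus, ℂ)} (hf : Tendsto f atTop (𝓝 f'))
    (d : ℕ → Fin 2 → ℤ) :
    Tendsto (fun j => coef (toL2 (f j)) (d j) - coef (toL2 f') (d j)) atTop (𝓝 0) := by
  have h1 := tendsto_iff_norm_sub_tendsto_zero.1 (tendsto_toL2 hf)
  refine squeeze_zero_norm (fun j => ?_) h1
  rw [← coef_sub]
  exact norm_coef_le _ _

theorem tendsto_centredIntegral_of_eventually_eq (x₀ : Torus) {f : ℕ → C(Torus, ℂ)}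
    {f' : C(Torus, ℂ)} (hf : Tendsto f atTop (𝓝 f')) {d : ℕ → Fin 2 → ℤ} {w : Fin 2 → ℤ}
    (hd : ∀ᶠ j in atTop, d j = w) :
    Tendsto (fun j => centredIntegral x₀ (f j) (d j)) atTop (𝓝 (centredIntegral x₀ f' w)) := by
  have h1 := (tendsto_coef_sub hf fun _ => -w).add_const (coef (toL2 f') (-w))
  simp only [sub_add_cancel, zero_add] at h1
  refine (h1.mul_const (conj (char w x₀))).congr' ?_
  filter_upwards [hd] with j hj
  rw [hj, centredIntegral]

/-- The Riemann–Lebesgue lemma for the limit `f'`, with an error that is uniform in the frequency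
for replacing `f j` by `f'`. -/
theorem tendsto_centredIntegral_zero (x₀ : Torus) {f : ℕ → C(Torus, ℂ)}
    {f' : C(Torus, ℂ)} (hf : Tendsto f atTop (𝓝 f')) {d : ℕ → Fin 2 → ℤ}
    (hd : ∀ w, ∀ᶠ j in atTop, d j ≠ w) :
    Tendsto (fun j => centredIntegral x₀ (f j) (d j)) atTop (𝓝 0) := by
  have h1 := tendsto_coef_sub hf fun j => -d j
  have h2 : Tendsto (fun j => -d j) atTop cofinite := by
    refine le_cofinite_iff_eventually_ne.2 fun w => ?_
    exact (hd (-w)).mono fun j hj h => hj (by rw [← h, neg_neg])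
  have h3 : Tendsto (fun v => coef (toL2 f') v) cofinite (𝓝 0) := by
    have h4 := (summable_norm_coef_sq (toL2 f')).tendsto_cofinite_zero
    have h5 := (Real.continuous_sqrt.tendsto 0).comp h4
    rw [Real.sqrt_zero] at h5
    refine tendsto_zero_iff_norm_tendsto_zero.2 (h5.congr fun v => ?_)
    simp
  have h6 := h1.add (h3.comp h2)
  simp only [Function.comp_def, sub_add_cancel, add_zero] at h6
  refine squeeze_zero_norm (fun j => ?_) (tendsto_zero_iff_norm_tendsto_zero.1 h6)
  rw [centredIntegral, norm_mul, RCLike.norm_conj, norm_char_apply, mul_one]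

theorem continuous_slice (a : C(PhaseSpace, ℂ)) : Continuous (slice a) := by
  let g : C(Circle × Torus, ℂ) := ⟨fun p => a (p.2, p.1), by fun_prop⟩
  exact g.curry.continuous

/-- After centring at `x₀`, the matrix element depends on the position of the points only through
their difference and the direction of `w`. -/
theorem inner_op_char {a : C(PhaseSpace, ℂ)} {T : L2 →L[ℂ] L2} (hT : IsOp a T) (x₀ : Torus)
    (v w : Fin 2 → ℤ) :
    (inner ℂ (conj (char v x₀) • toL2 (char v)) (T (conj (char w x₀) • toL2 (char w))) : ℂ) =
      centredIntegral x₀ (slice a (dir w)) (w - v) := by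
  rw [map_smul, inner_smul_left, inner_smul_right, hT, inner_toL2, centredIntegral_eq,
    ← integral_const_mul, ← integral_const_mul]
  refine integral_congr_ae (Eventually.of_forall fun x => ?_)
  simp only [sub_eq_add_neg, char_add_apply, char_neg_apply, Complex.conj_conj, map_mul,
    ContinuousMap.mul_apply]
  ring

theorem inner_op_shell {a : C(PhaseSpace, ℂ)} {T : L2 →L[ℂ] L2} (hT : IsOp a T) (x₀ : Torus)
    {r n : ℕ} {e : Fin r → Fin 2 → ℤ} (hinj : Function.Injective e)
    (he : Finset.univ.image e = (finite_sphere n).toFinset) :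
    (inner ℂ (shell x₀ n) (T (shell x₀ n)) : ℂ) =
      ∑ k, ∑ l, centredIntegral x₀ (slice a (dir (e l))) (e l - e k) := by
  have hs : shell x₀ n = ∑ k, conj (char (e k) x₀) • toL2 (char (e k)) := by
    rw [shell, ← he, Finset.sum_image fun _ _ _ _ h => hinj h]
  rw [hs, map_sum, sum_inner]
  refine Finset.sum_congr rfl fun k _ => ?_
  rw [inner_sum]
  exact Finset.sum_congr rfl fun l _ => inner_op_char hT x₀ _ _

/-- The limit of the matrix elements along clusters of lattice points. -/
theorem tendsto_inner_op_shell {a : C(PhaseSpace, ℂ)} {T : L2 →L[ℂ] L2} (hT : IsOp a T)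
    (x₀ : Torus) {r : ℕ} {n : ℕ → ℕ} {e : ℕ → Fin r → Fin 2 → ℤ}
    (hinj : ∀ j, Function.Injective (e j))
    (he : ∀ j, Finset.univ.image (e j) = (finite_sphere (n j)).toFinset)
    {θ : Fin r → Circle} (hθ : ∀ k, Tendsto (fun j => dir (e j k)) atTop (𝓝 (θ k)))
    {cls : Fin r → Fin r} {u : Fin r → Fin 2 → ℤ}
    (h1 : ∀ k l, cls k = cls l → ∀ᶠ j in atTop, e j l - e j k = u l - u k)
    (h2 : ∀ k l, cls k ≠ cls l → ∀ w, ∀ᶠ j in atTop, e j l - e j k ≠ w) :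
    Tendsto (fun j => (inner ℂ (shell x₀ (n j)) (T (shell x₀ (n j))) : ℂ)) atTop
      (𝓝 (∑ k, ∑ l, if cls k = cls l then
        centredIntegral x₀ (slice a (θ l)) (u l - u k) else 0)) := by
  simp only [fun j => inner_op_shell hT x₀ (hinj j) (he j)]
  refine tendsto_finsetSum _ fun k _ => tendsto_finsetSum _ fun l _ => ?_
  have hsl : Tendsto (fun j => slice a (dir (e j l))) atTop (𝓝 (slice a (θ l))) :=
    ((continuous_slice a).tendsto _).comp (hθ l)
  split_ifs with h
  · exact tendsto_centredIntegral_of_eventually_eq x₀ hsl (h1 k l h)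
  · exact tendsto_centredIntegral_zero x₀ hsl (h2 k l h)

/-! ### The limit measure -/

/-- The trigonometric polynomial of a cluster. -/
noncomputable def clusterPoly (x₀ : Torus) {r : ℕ} (cls : Fin r → Fin r) (u : Fin r → Fin 2 → ℤ)
    (c : Fin r) : C(Torus, ℂ) :=
  ∑ k, if cls k = c then conj (char (u k) x₀) • char (u k) else 0

/-- The limit measure: each cluster contributes its limit direction, with the density of its
trigonometric polynomial. -/
noncomputable def clusterMeasure (x₀ : Torus) {r : ℕ} (θ : Fin r → Circle) (cls : Fin r → Fin r)
    (u : Fin r → Fin 2 → ℤ) : Measure PhaseSpace :=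
  ∑ c, (haarTorus.withDensity fun x =>
    ((‖clusterPoly x₀ cls u c x‖₊ ^ 2 / r : NNReal) : ENNReal)).map fun x => (x, θ c)

theorem measurable_prodMk_const (θ : Circle) : Measurable fun x : Torus => ((x, θ) : PhaseSpace) :=
  measurable_id.prodMk measurable_const

theorem measurable_clusterDensity (x₀ : Torus) {r : ℕ} (cls : Fin r → Fin r)
    (u : Fin r → Fin 2 → ℤ) (c : Fin r) :
    Measurable fun x => (‖clusterPoly x₀ cls u c x‖₊ ^ 2 / r : NNReal) :=
  Continuous.measurable (by fun_prop)

theorem isFiniteMeasure_cluster (x₀ : Torus) {r : ℕ} (cls : Fin r → Fin r)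
    (u : Fin r → Fin 2 → ℤ) (c : Fin r) : IsFiniteMeasure (haarTorus.withDensity fun x =>
      ((‖clusterPoly x₀ cls u c x‖₊ ^ 2 / r : NNReal) : ENNReal)) := by
  refine isFiniteMeasure_withDensity (ne_of_lt ?_)
  have hle : ∀ x, (‖clusterPoly x₀ cls u c x‖₊ ^ 2 / r : NNReal) ≤
      ‖clusterPoly x₀ cls u c‖₊ ^ 2 / r := fun x => by
    gcongr
    exact (clusterPoly x₀ cls u c).norm_coe_le_norm x
  calc _ ≤ ∫⁻ _, ((‖clusterPoly x₀ cls u c‖₊ ^ 2 / r : NNReal) : ENNReal) ∂haarTorus :=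
        lintegral_mono fun x => ENNReal.coe_le_coe.2 (hle x)
    _ < ⊤ := by simp

theorem isFiniteMeasure_clusterMeasure (x₀ : Torus) {r : ℕ} (θ : Fin r → Circle)
    (cls : Fin r → Fin r) (u : Fin r → Fin 2 → ℤ) :
    IsFiniteMeasure (clusterMeasure x₀ θ cls u) := by
  have := isFiniteMeasure_cluster x₀ cls u
  unfold clusterMeasure
  infer_instance

theorem integrable_continuous {X : Type*} [TopologicalSpace X] [CompactSpace X] [MeasurableSpace X]
    [OpensMeasurableSpace X] (μ : Measure X) [IsFiniteMeasure μ] (f : C(X, ℂ)) : Integrable f μ :=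
  f.continuous.integrable_of_hasCompactSupport (HasCompactSupport.of_compactSpace _)

/-- The squared modulus of the cluster polynomial expands over pairs within the cluster, as does the
limit in `tendsto_inner_op_shell`; `1 / r` is the normalization. -/
theorem integral_clusterMeasure (x₀ : Torus) {r : ℕ} (θ : Fin r → Circle) (cls : Fin r → Fin r)
    (u : Fin r → Fin 2 → ℤ) (F : C(PhaseSpace, ℂ)) :
    ∫ p, F p ∂(clusterMeasure x₀ θ cls u) = (r : ℂ)⁻¹ * ∑ k, ∑ l, if cls k = cls l then
      centredIntegral x₀ (slice F (θ (cls l))) (u l - u k) else 0 := by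
  have hfin := isFiniteMeasure_cluster x₀ cls u
  have hmain : ∀ c, ∫ p, F p ∂((haarTorus.withDensity fun x =>
      ((‖clusterPoly x₀ cls u c x‖₊ ^ 2 / r : NNReal) : ENNReal)).map fun x => (x, θ c)) =
      (r : ℂ)⁻¹ * ∑ k, ∑ l, if cls k = c ∧ cls l = c then
        centredIntegral x₀ (slice F (θ c)) (u l - u k) else 0 := by
    intro c
    rw [integral_map (measurable_prodMk_const _).aemeasurable F.continuous.aestronglyMeasurable,
      integral_withDensity_eq_integral_smul (measurable_clusterDensity x₀ cls u c)]
    have hpt : ∀ x, (‖clusterPoly x₀ cls u c x‖₊ ^ 2 / r : NNReal) • F (x, θ c) =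
        (r : ℂ)⁻¹ * ∑ k, ∑ l, if cls k = c ∧ cls l = c then
          F (x, θ c) * (char (u l - u k) x * conj (char (u l - u k) x₀)) else 0 := by
      intro x
      have h1 : ((‖clusterPoly x₀ cls u c x‖₊ ^ 2 / r : NNReal) : ℂ) =
          (r : ℂ)⁻¹ * (conj (clusterPoly x₀ cls u c x) * clusterPoly x₀ cls u c x) := by
        rw [← Complex.normSq_eq_conj_mul_self, Complex.normSq_eq_norm_sq]
        push_cast
        rw [div_eq_inv_mul]
      rw [NNReal.smul_def, Complex.real_smul]
      change ((‖clusterPoly x₀ cls u c x‖₊ ^ 2 / r : NNReal) : ℂ) * _ = _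
      rw [h1, mul_assoc]
      congr 1
      simp only [clusterPoly, ContinuousMap.coe_sum, Finset.sum_apply, map_sum]
      rw [Finset.sum_mul_sum, Finset.sum_mul]
      refine Finset.sum_congr rfl fun k _ => ?_
      rw [Finset.sum_mul]
      refine Finset.sum_congr rfl fun l _ => ?_
      by_cases hk : cls k = c <;> by_cases hl : cls l = c <;>
        simp [hk, hl, sub_eq_add_neg, char_add_apply, char_neg_apply]
      ring
    simp only [hpt]
    rw [integral_const_mul]
    congr 1
    have hint : ∀ k l, Integrable (fun x => if cls k = c ∧ cls l = c then
          F (x, θ c) * (char (u l - u k) x * conj (char (u l - u k) x₀)) else 0) haarTorus := by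
      intro k l
      split_ifs
      · exact integrable_continuous haarTorus ⟨fun x => F (x, θ c) *
          (char (u l - u k) x * conj (char (u l - u k) x₀)), by fun_prop⟩
      · exact integrable_zero _ _ _
    rw [integral_finsetSum _ fun k _ => integrable_finsetSum _ fun l _ => hint k l]
    refine Finset.sum_congr rfl fun k _ => ?_
    rw [integral_finsetSum _ fun l _ => hint k l]
    refine Finset.sum_congr rfl fun l _ => ?_
    split_ifs
    · rw [centredIntegral_eq]; rfl
    · simp
  rw [clusterMeasure, integral_finsetSum_measure fun c _ => integrable_continuous _ F]
  simp only [hmain]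
  rw [← Finset.mul_sum, Finset.sum_comm]
  congr 1
  refine Finset.sum_congr rfl fun k _ => ?_
  rw [Finset.sum_comm]
  refine Finset.sum_congr rfl fun l _ => ?_
  rw [Finset.sum_eq_single (cls l) (fun c _ hc => if_neg fun h => hc h.2.symm) (by simp)]
  simp

theorem centredIntegral_char (x₀ : Torus) (w d : Fin 2 → ℤ) :
    centredIntegral x₀ (char (-w)) d = if d = w then conj (char w x₀) else 0 := by
  rw [centredIntegral, coef_toL2_char]
  by_cases h : d = w
  · simp [h]
  · simp [h]

/-- The Fourier coefficients of the position distribution of the limit measure count the differences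
within clusters. -/
theorem integral_char_clusterMeasure (x₀ : Torus) {r : ℕ} (θ : Fin r → Circle) (cls : Fin r → Fin r)
    (u : Fin r → Fin 2 → ℤ) (w : Fin 2 → ℤ) :
    ∫ p, conj (char w p.1) ∂(clusterMeasure x₀ θ cls u) = (r : ℂ)⁻¹ *
      ((∑ k, ∑ l, if cls k = cls l ∧ u l - u k = w then 1 else 0 : ℕ) * conj (char w x₀)) := by
  obtain ⟨G, hG, hGs⟩ : ∃ G : C(PhaseSpace, ℂ), (∀ p, G p = conj (char w p.1)) ∧
      ∀ t, slice G t = char (-w) :=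
    ⟨⟨fun p => char (-w) p.1, by fun_prop⟩, fun p => char_neg_apply w p.1, fun t => rfl⟩
  have h := integral_clusterMeasure x₀ θ cls u G
  simp only [hG, hGs, centredIntegral_char] at h
  rw [h]
  congr 1
  push_cast
  simp only [Finset.sum_mul, ite_mul, one_mul, zero_mul, ite_and]

/-- The total mass is the coefficient at frequency zero. Distinct points of a cluster have distinct
positions, so only the `r` diagonal pairs count. -/
theorem isProbabilityMeasure_clusterMeasure (x₀ : Torus) {r : ℕ} (hr : 0 < r) (θ : Fin r → Circle)
    {cls : Fin r → Fin r} {u : Fin r → Fin 2 → ℤ}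
    (h : ∀ k l, cls k = cls l → u k = u l → k = l) :
    IsProbabilityMeasure (clusterMeasure x₀ θ cls u) := by
  have hfin := isFiniteMeasure_clusterMeasure x₀ θ cls u
  have h1 := integral_char_clusterMeasure x₀ θ cls u 0
  have h2 : ∀ k l, (cls k = cls l ∧ u l - u k = 0) ↔ k = l := fun k l => by
    constructor
    · rintro ⟨e1, e2⟩
      exact h k l e1 (sub_eq_zero.1 e2).symm
    · rintro rfl
      simp
  have hr' : (r : ℂ) ≠ 0 := by exact_mod_cast hr.ne'
  simp only [h2, char_zero, ContinuousMap.one_apply, map_one, mul_one, Finset.sum_ite_eq,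
    Finset.mem_univ, if_true, Finset.sum_const, Finset.card_univ, Fintype.card_fin, smul_eq_mul,
    integral_const, inv_mul_cancel₀ hr'] at h1
  have h3 : (clusterMeasure x₀ θ cls u).real Set.univ = 1 := by
    rw [Complex.real_smul, mul_one] at h1
    exact_mod_cast h1
  refine ⟨?_⟩
  rw [← ENNReal.ofReal_one, ← h3, ofReal_measureReal]

theorem clusterMeasure_snd_compl (x₀ : Torus) {r : ℕ} (θ : Fin r → Circle) (cls : Fin r → Fin r)
    (u : Fin r → Fin 2 → ℤ) :
    clusterMeasure x₀ θ cls u (Prod.snd ⁻¹' (Set.range θ)ᶜ) = 0 := by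
  have hm : MeasurableSet (Prod.snd ⁻¹' (Set.range θ)ᶜ : Set PhaseSpace) :=
    measurable_snd (Set.finite_range θ).measurableSet.compl
  rw [clusterMeasure, Measure.finsetSum_apply]
  refine Finset.sum_eq_zero fun c _ => ?_
  rw [Measure.map_apply (measurable_prodMk_const _) hm]
  have : (fun x : Torus => ((x, θ c) : PhaseSpace)) ⁻¹' (Prod.snd ⁻¹' (Set.range θ)ᶜ) = ∅ := by
    ext x; simp
  rw [this, measure_empty]

/-- A probability measure carried by a finite set is carried by its atoms. -/
theorem exists_atoms {X : Type*} [MeasurableSpace X] (m : Measure X) [IsProbabilityMeasure m]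
    {A : Finset X} (hA : m (A : Set X)ᶜ = 0) :
    ∃ S : Finset X, S.Nonempty ∧ (∀ s ∈ S, 0 < m {s}) ∧ 1 ≤ m (S : Set X) := by
  classical
  have hS : 1 ≤ m (A.filter fun s => 0 < m {s} : Finset X) := by
    have h0 : m (⋃ s ∈ A.filter fun s => m {s} = 0, {s}) = 0 :=
      (measure_biUnion_null_iff (Finset.countable_toSet _)).2 fun s hs => (Finset.mem_filter.1 hs).2
    calc 1 = m Set.univ := measure_univ.symm
      _ ≤ m (((A.filter fun s => 0 < m {s} : Finset X) : Set X) ∪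
          ((⋃ s ∈ A.filter fun s => m {s} = 0, {s}) ∪ (A : Set X)ᶜ)) := by
        refine measure_mono fun x _ => ?_
        by_cases hx : x ∈ A
        · by_cases h : m {x} = 0
          · right; left; simp [hx, h]
          · left; simp [hx, pos_iff_ne_zero, h]
        · right; right; exact hx
      _ ≤ m (A.filter fun s => 0 < m {s} : Finset X) + (0 + 0) := by
        refine (measure_union_le _ _).trans (add_le_add le_rfl ?_)
        exact (measure_union_le _ _).trans (add_le_add h0.le hA.le)
      _ = _ := by simp
  refine ⟨A.filter fun s => 0 < m {s}, ?_, fun s hs => (Finset.mem_filter.1 hs).2, hS⟩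
  rw [Finset.nonempty_iff_ne_empty]
  intro h
  rw [h] at hS
  simp at hS

/-! ### Sequences of concentrated eigenfunctions -/

theorem exists_enumeration {n r : ℕ} (h : r2 n = r) : ∃ e : Fin r → Fin 2 → ℤ,
    Function.Injective e ∧ Finset.univ.image e = (finite_sphere n).toFinset := by
  have hc : (finite_sphere n).toFinset.card = r := by
    rw [← h, r2, Set.ncard_eq_toFinset_card _ (finite_sphere n)]
  let q := (finite_sphere n).toFinset.equivFinOfCardEq hc
  refine ⟨fun k => q.symm k, fun k l hkl => q.symm.injective (Subtype.ext hkl), ?_⟩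
  ext v
  simp only [Finset.mem_image, Finset.mem_univ, true_and]
  constructor
  · rintro ⟨k, rfl⟩
    exact (q.symm k).2
  · intro hv
    exact ⟨q ⟨v, hv⟩, by simp⟩

/-- A sequence of new eigenvalues whose eigenfunctions concentrate on circles with a fixed number of
lattice points, with convergent directions, and differences that stabilize or diverge. -/
theorem exists_concentrated_seq (x₀ : Torus) {cpl : Coupling} (hcpl : cpl.Admissible) :
    ∃ (r : ℕ) (l : ℕ → ℝ) (n : ℕ → ℕ) (e : ℕ → Fin r → Fin 2 → ℤ) (θ : Fin r → Circle),
      0 < r ∧ StrictMono l ∧ Tendsto l atTop atTop ∧ Tendsto n atTop atTop ∧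
      (∀ j, l j ∈ newEigenvalues x₀ cpl ∧ ∃ u, IsEigenfunction x₀ cpl (l j) u) ∧
      (∀ j g, IsEigenfunction x₀ cpl (l j) g → ∃ b : ℂ,
        ‖g - b • shell x₀ (n j)‖ ^ 2 ≤ 1 / ((j : ℝ) + 1) ∧ |‖b‖ ^ 2 * r - 1| ≤ 1 / ((j : ℝ) + 1)) ∧
      (∀ j, Function.Injective (e j)) ∧
      (∀ j, Finset.univ.image (e j) = (finite_sphere (n j)).toFinset) ∧
      (∀ k, Tendsto (fun j => dir (e j k)) atTop (𝓝 (θ k))) ∧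
      (∀ k m w, (∀ᶠ j in atTop, e j k - e j m = w) ∨ ∀ᶠ j in atTop, e j k - e j m ≠ w) ∧
      ∀ j, ∃ k m, e j k - e j m = ![0, 2] := by
  classical
  obtain ⟨r, hr, h⟩ := exists_concentrated x₀ hcpl
  choose a ha har l hl hnew hex hconc using
    fun j : ℕ => h (1 / ((j : ℝ) + 1)) (by positivity) j
  choose e hinj himg using fun j => exists_enumeration (har j)
  -- Compactness of a countable product. The Boolean coordinates record whether a difference equals
  -- `w`, and their convergence is the dichotomy between stabilizing and diverging.
  obtain ⟨⟨θ, P⟩, φ, hφ, hlim⟩ := CompactSpace.tendsto_subseq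
    (fun j => ((fun k => dir (e j k), fun k m w => decide (e j k - e j m = w)) :
      (Fin r → Circle) × (Fin r → Fin r → (Fin 2 → ℤ) → Bool)))
  have ha_top : Tendsto (a ∘ φ) atTop atTop :=
    tendsto_atTop_mono (fun j => (hφ.le_apply).trans (ha (φ j))) tendsto_id
  -- A further subsequence makes `a` strictly increasing; the eigenvalues lie less than one apart
  -- from `a² + 1`, so they increase too.
  obtain ⟨ψ, hψ, haψ⟩ := strictMono_subseq_of_tendsto_atTop ha_top
  have hχ : StrictMono (φ ∘ ψ) := hφ.comp hψ
  have hlim' := hlim.comp hψ.tendsto_atTop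
  have haj : ∀ j, j ≤ a (φ (ψ j)) := fun j => haψ.le_apply
  have hn_top : Tendsto (fun j => a (φ (ψ j)) ^ 2 + 1) atTop atTop := by
    refine tendsto_atTop_mono (fun j => ?_) tendsto_id
    have := haj j
    simp only [id]
    nlinarith
  have hl_mono : StrictMono fun j => l (φ (ψ j)) := by
    refine strictMono_nat_of_lt_succ fun j => ?_
    have h1 := (hl (φ (ψ j))).2
    have h2 := (hl (φ (ψ (j + 1)))).1
    have h3 : a (φ (ψ j)) + 1 ≤ a (φ (ψ (j + 1))) := haψ (Nat.lt_succ_self j)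
    have h4 : (a (φ (ψ j)) ^ 2 + 1) + 1 ≤ a (φ (ψ (j + 1))) ^ 2 + 1 := by nlinarith
    have h5 : ((a (φ (ψ j)) ^ 2 + 1 : ℕ) : ℝ) + 1 ≤ ((a (φ (ψ (j + 1))) ^ 2 + 1 : ℕ) : ℝ) := by
      exact_mod_cast h4
    linarith
  refine ⟨r, fun j => l (φ (ψ j)), fun j => a (φ (ψ j)) ^ 2 + 1, fun j => e (φ (ψ j)), θ, hr, hl_mono,
    ?_, hn_top, fun j => ⟨hnew _, hex _⟩, fun j g hg => ?_, fun j => hinj _, fun j => himg _,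
    fun k => ?_, fun k m w => ?_, fun j => ?_⟩
  · have h1 := tendsto_atTop_add_const_right atTop (-(1 / 2) : ℝ)
      (tendsto_natCast_atTop_atTop (R := ℝ) |>.comp hn_top)
    exact tendsto_atTop_mono (fun j => (hl (φ (ψ j))).1) h1
  · obtain ⟨b, hb1, hb2⟩ := hconc _ g hg
    have h1 : (j : ℝ) ≤ (φ (ψ j) : ℕ) := by exact_mod_cast hχ.le_apply
    have h2 : 1 / (((φ (ψ j) : ℕ) : ℝ) + 1) ≤ 1 / ((j : ℝ) + 1) := by gcongr
    exact ⟨b, hb1.trans h2, hb2.trans h2⟩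
  · exact (tendsto_pi_nhds.1 (Prod.tendsto_iff _ _ |>.1 hlim').1) k
  · have h1 := tendsto_pi_nhds.1 (tendsto_pi_nhds.1
      (tendsto_pi_nhds.1 (Prod.tendsto_iff _ _ |>.1 hlim').2 k) m) w
    rw [nhds_discrete, tendsto_pure] at h1
    cases hP : P k m w with
    | true =>
      left
      exact h1.mono fun j hj => by simpa [hP] using hj
    | false =>
      right
      exact h1.mono fun j hj => by simpa [hP] using hj
  -- The points `(a, 1)` and `(a, -1)` lie on the circle `|v|² = a² + 1`.
  · have hmem : ∀ s : ℤ, s ^ 2 = 1 → ∃ k, e (φ (ψ j)) k = ![(a (φ (ψ j)) : ℤ), s] := fun s hs => by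
      have h1 : ![(a (φ (ψ j)) : ℤ), s] ∈ (finite_sphere (a (φ (ψ j)) ^ 2 + 1)).toFinset := by
        simp [normSq, hs]
      rw [← himg] at h1
      obtain ⟨k, -, hk⟩ := Finset.mem_image.1 h1
      exact ⟨k, hk⟩
    obtain ⟨k, hk⟩ := hmem 1 (by norm_num)
    obtain ⟨m, hm⟩ := hmem (-1) (by norm_num)
    refine ⟨k, m, ?_⟩
    change e (φ (ψ j)) k - e (φ (ψ j)) m = _
    rw [hk, hm]
    ext i
    fin_cases i <;> simp

/-! ### Quantum limits of concentrated eigenfunctions -/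

theorem atTop_inf_principal_range_le {l : ℕ → ℝ} (hl : StrictMono l) :
    atTop ⊓ 𝓟 (Set.range l) ≤ map l atTop := by
  intro U hU
  obtain ⟨J, hJ⟩ := mem_atTop_sets.1 (mem_map.1 hU)
  refine mem_inf_principal.2 ?_
  filter_upwards [eventually_ge_atTop (l J)] with x hx
  rintro ⟨i, rfl⟩
  exact hJ i (hl.le_iff_le.1 hx)

theorem norm_inner_sub_inner_le (T : L2 →L[ℂ] L2) (g s : L2) :
    ‖(inner ℂ g (T g) : ℂ) - inner ℂ s (T s)‖ ≤ ‖T‖ * (‖g - s‖ * (2 * ‖g‖ + ‖g - s‖)) := by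
  have e : (inner ℂ g (T g) : ℂ) - inner ℂ s (T s) =
      inner ℂ (g - s) (T g) + inner ℂ s (T (g - s)) := by
    rw [map_sub, inner_sub_left, inner_sub_right]; ring
  have hs : ‖s‖ ≤ ‖g‖ + ‖g - s‖ := by
    calc ‖s‖ = ‖g - (g - s)‖ := by rw [sub_sub_cancel]
      _ ≤ _ := norm_sub_le _ _
  rw [e]
  calc _ ≤ ‖g - s‖ * ‖T g‖ + ‖s‖ * ‖T (g - s)‖ :=
        (norm_add_le _ _).trans (add_le_add (norm_inner_le_norm _ _) (norm_inner_le_norm _ _))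
    _ ≤ ‖g - s‖ * (‖T‖ * ‖g‖) + (‖g‖ + ‖g - s‖) * (‖T‖ * ‖g - s‖) := by
        gcongr <;> exact T.le_opNorm _
    _ = _ := by ring

/-- The part off the circle tends to zero in norm and `‖b j‖²` tends to `1 / r`, which is the factor
in the limit. -/
theorem tendsto_inner_of_concentrated {T : L2 →L[ℂ] L2} {g s : ℕ → L2} {b : ℕ → ℂ} {r : ℝ}
    (hr : 0 < r) (hg : ∀ j, ‖g j‖ = 1) (h1 : ∀ j : ℕ, ‖g j - b j • s j‖ ^ 2 ≤ 1 / ((j : ℝ) + 1))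
    (h2 : ∀ j : ℕ, |‖b j‖ ^ 2 * r - 1| ≤ 1 / ((j : ℝ) + 1)) {z : ℂ}
    (hs : Tendsto (fun j => (inner ℂ (s j) (T (s j)) : ℂ)) atTop (𝓝 z)) :
    Tendsto (fun j => (inner ℂ (g j) (T (g j)) : ℂ)) atTop (𝓝 ((r : ℂ)⁻¹ * z)) := by
  have h0 := tendsto_one_div_add_atTop_nhds_zero_nat (𝕜 := ℝ)
  have hd : Tendsto (fun j => ‖g j - b j • s j‖) atTop (𝓝 0) := by
    have h3 : Tendsto (fun j => ‖g j - b j • s j‖ ^ 2) atTop (𝓝 0) :=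
      squeeze_zero (fun j => sq_nonneg _) h1 h0
    have h4 := (Real.continuous_sqrt.tendsto 0).comp h3
    rw [Real.sqrt_zero] at h4
    exact h4.congr fun j => by simp
  have hb : Tendsto (fun j => ‖b j‖ ^ 2) atTop (𝓝 r⁻¹) := by
    have h3 : Tendsto (fun j => ‖b j‖ ^ 2 * r - 1) atTop (𝓝 0) := squeeze_zero_norm h2 h0
    have h4 := (h3.add_const 1).mul_const r⁻¹
    simp only [sub_add_cancel, zero_add, one_mul] at h4
    exact h4.congr fun j => by field_simp
  have hmain : Tendsto (fun j => (inner ℂ (b j • s j) (T (b j • s j)) : ℂ)) atTop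
      (𝓝 ((r : ℂ)⁻¹ * z)) := by
    have h5 := (((Complex.continuous_ofReal.tendsto _).comp hb)).mul hs
    rw [Complex.ofReal_inv] at h5
    refine h5.congr fun j => ?_
    rw [map_smul, inner_smul_left, inner_smul_right, ← mul_assoc, ← Complex.normSq_eq_conj_mul_self,
      Complex.normSq_eq_norm_sq]
    rfl
  have hdiff : Tendsto (fun j => (inner ℂ (g j) (T (g j)) : ℂ) -
      inner ℂ (b j • s j) (T (b j • s j))) atTop (𝓝 0) := by
    have h6 := (hd.mul (hd.const_add 2)).const_mul ‖T‖
    simp only [add_zero, zero_mul, mul_zero] at h6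
    refine squeeze_zero_norm (fun j => ?_) h6
    have h7 := norm_inner_sub_inner_le T (g j) (b j • s j)
    rwa [hg j, mul_one] at h7
  have h8 := hdiff.add hmain
  simpa only [sub_add_cancel, zero_add] using h8

end PointScatterer

open PointScatterer

/-! ### The theorem -/

theorem theorem2 (x₀ : Torus) (cpl : Coupling) (hcpl : cpl.Admissible) (ε : ℝ) (hε : 0 < ε) :
    ∃ L : Set ℝ, L ⊆ newEigenvalues x₀ cpl ∧ L.Infinite ∧ (∀ B : ℝ, (L ∩ Set.Iic B).Finite) ∧
      (∀ l ∈ L, ∃ u : L2, IsEigenfunction x₀ cpl l u) ∧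
      ∃ μ : MeasureTheory.Measure PhaseSpace, MeasureTheory.IsProbabilityMeasure μ ∧
        -- `μ` is the quantum limit along `L`
        (∀ g : ℝ → L2, (∀ l ∈ L, IsEigenfunction x₀ cpl l (g l)) → IsQuantumLimit L g μ) ∧
        -- scarring in momentum space
        (∃ S : Finset Circle, S.Nonempty ∧ (∀ s ∈ S, 0 < μ.map Prod.snd {s}) ∧
          ENNReal.ofReal (1 / 2 - ε) ≤ μ.map Prod.snd (S : Set Circle)) ∧
        -- scarring in position space
        (∃ w : Fin 2 → ℤ, w ≠ 0 ∧
          ∫ x, (starRingEnd ℂ) (PointScatterer.char w x) ∂(μ.map Prod.fst) ≠ 0) := by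
  classical
  obtain ⟨r, l, n, e, θ, hr, hmono, htop, hn, hnew, hconc, hinj, himg, hθ, hd, hpair⟩ :=
    exists_concentrated_seq x₀ hcpl
  have hnorm : ∀ j k, normSq (e j k) = n j := fun j k => by
    have : e j k ∈ (finite_sphere (n j)).toFinset := by
      rw [← himg]; exact Finset.mem_image_of_mem _ (Finset.mem_univ k)
    simpa using this
  obtain ⟨cls, u, hcls, h1, h2, h3⟩ := exists_clusters hinj hn hnorm hθ hd
  have hprob := isProbabilityMeasure_clusterMeasure x₀ hr θ h3
  refine ⟨Set.range l, ?_, Set.infinite_range_of_injective hmono.injective, fun B => ?_, ?_,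
    clusterMeasure x₀ θ cls u, hprob, ?_, ?_, ![0, 2], ?_, ?_⟩
  · rintro _ ⟨j, rfl⟩
    exact (hnew j).1
  · obtain ⟨J, hJ⟩ := eventually_atTop.1 (htop.eventually_gt_atTop B)
    refine ((Set.finite_lt_nat J).image l).subset ?_
    rintro _ ⟨⟨j, rfl⟩, hj⟩
    refine ⟨j, ?_, rfl⟩
    by_contra hlt
    exact absurd (hJ j (not_lt.1 hlt)) (not_lt.2 hj)
  · rintro _ ⟨j, rfl⟩
    exact (hnew j).2
  · intro g hg a ha
    obtain ⟨T, hT⟩ := exists_isOp ha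
    refine ⟨T, hT, Tendsto.mono_left ?_ (atTop_inf_principal_range_le hmono)⟩
    rw [tendsto_map'_iff]
    choose b hb1 hb2 using fun j => hconc j (g (l j)) (hg _ ⟨j, rfl⟩)
    have hlim := tendsto_inner_of_concentrated (r := (r : ℝ)) (by exact_mod_cast hr)
      (fun j => (hg (l j) ⟨j, rfl⟩).1) hb1 hb2
      (tendsto_inner_op_shell hT x₀ hinj himg hθ h1 h2)
    rw [integral_clusterMeasure]
    simp only [hcls]
    rw [Complex.ofReal_natCast] at hlim
    exact hlim
  · have hprob' : IsProbabilityMeasure ((clusterMeasure x₀ θ cls u).map Prod.snd) :=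
      Measure.isProbabilityMeasure_map measurable_snd.aemeasurable
    -- The momentum marginal is carried by the finitely many limit directions, so its atoms have
    -- total mass one.
    obtain ⟨S, hS, hpos, hmass⟩ := exists_atoms ((clusterMeasure x₀ θ cls u).map Prod.snd)
      (A := Finset.univ.image θ) (by
        rw [Measure.map_apply measurable_snd (Finset.measurableSet _).compl]
        simpa using clusterMeasure_snd_compl x₀ θ cls u)
    refine ⟨S, hS, hpos, le_trans ?_ hmass⟩
    rw [ENNReal.ofReal_le_one]
    linarith
  · intro h
    have := congrFun h 1
    simp at this
  · have hint : ∫ x, (starRingEnd ℂ) (PointScatterer.char ![0, 2] x)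
        ∂((clusterMeasure x₀ θ cls u).map Prod.fst) =
        ∫ p, (starRingEnd ℂ) (PointScatterer.char ![0, 2] p.1) ∂(clusterMeasure x₀ θ cls u) :=
      integral_map measurable_fst.aemeasurable (Continuous.aestronglyMeasurable (by fun_prop))
    rw [hint, integral_char_clusterMeasure]
    -- For each `j` some pair of indices differs by `(0, 2)`. There are finitely many pairs, so by
    -- the dichotomy `hd` one of them does so eventually.
    obtain ⟨k, m, hkm⟩ : ∃ k m, ∀ᶠ j in atTop, e j k - e j m = ![0, 2] := by
      by_contra hcon
      have hall : ∀ᶠ j in atTop, ∀ k m, e j k - e j m ≠ ![0, 2] := by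
        refine eventually_all.2 fun k => eventually_all.2 fun m => ?_
        exact (hd k m _).resolve_left fun h => hcon ⟨k, m, h⟩
      obtain ⟨j, hj⟩ := hall.exists
      obtain ⟨k, m, h⟩ := hpair j
      exact hj k m h
    have hc : cls m = cls k := by
      by_contra hne
      obtain ⟨j, hj, hj'⟩ := (hkm.and (h2 m k hne ![0, 2])).exists
      exact hj' hj
    have hu : u k - u m = ![0, 2] := by
      obtain ⟨j, hj, hj'⟩ := (hkm.and (h1 m k hc)).exists
      rw [← hj', hj]
    -- The coefficient counts pairs, so nothing can cancel.
    have hcount : 0 < ∑ k, ∑ m, if cls k = cls m ∧ u m - u k = ![0, 2] then 1 else 0 := by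
      refine Finset.sum_pos' (fun _ _ => Nat.zero_le _) ⟨m, Finset.mem_univ _, ?_⟩
      refine Finset.sum_pos' (fun _ _ => Nat.zero_le _) ⟨k, Finset.mem_univ _, ?_⟩
      rw [if_pos ⟨hc, hu⟩]
      exact one_pos
    have hr' : (r : ℂ)⁻¹ ≠ 0 := inv_ne_zero (by exact_mod_cast hr.ne')
    refine mul_ne_zero hr' (mul_ne_zero (by exact_mod_cast hcount.ne') ?_)
    simpa using char_ne_zero ![0, 2] x₀
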